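/- **Setting.** There are $N$ agents $\mathcal V=\{1,\dots,N\}$; agent $i$ has a decision variable $x^i\in\mathbb R^{n^i}$, a cost $f^i(x^i)=\sum_{l=1}^{n^i}f^i_l(x^i_l)$ and a matrix $w^i\in\mathbb R^{p\times n^i}$ with $k$-th row $[w^i]_k$. Consider $\min\sum_i f^i(x^i)$ subject to $\sum_i [w^i]_k x^i=\mathsf b_k$, $k=1,\dots,p$, where $W=[w^1,\dots,w^N]$ has full row rank. Its KKT conditions for $(x^\star,\nu^\star)$ are $$\nabla f^i(x^{i\star})+w^{i\top}\nu^\star=0\ (i\in\mathcal V),\qquad \sum_{i}[w^i]_kx^{i\star}=\mathsf b_k\ (k=1,\dots,p).$$ Let $(\mathsf a_{ij})$ be the symmetric, nonnegative weighted adjacency matrix of an undirected graph on $\mathcal V$. For each $k$ let $\mathcal V_k\subseteq\mathcal V$ contain every $i$ with $[w^i]_k\ne0$ and induce a connected subgraph $\mathcal G_k$. Let $\mathcal T^i=\{k: i\in\mathcal V_k\}$, let $\sum_{l\in\mathcal V_k}\bar{\mathsf b}^l_k=\mathsf b_k$ for every $k$, and let $\beta_k>0$, $\rho^i\ge0$.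 The algorithm is, for $k=1,\dots,p$, $l\in\mathcal V_k$, $i\in\mathcal V$, $$\dot y^l_k=\beta_k\sum_{j\in\mathcal V_k}\mathsf a_{lj}(v^l_k-v^j_k),\qquad \dot v^l_k=[w^l]_kx^l-\bar{\mathsf b}^l_k-\beta_k\sum_{j\in\mathcal V_k}\mathsf a_{lj}(v^l_k-v^j_k)-y^l_k,$$ $$\dot x^i=-(1+\rho^i)\nabla f^i(x^i)-\rho^i\sum_{k\in\mathcal T^i}[w^i]_k^\top([w^i]_kx^i-\bar{\mathsf b}^i_k)+\rho^i\sum_{k\in\mathcal T^i}[w^i]_k^\top y^i_k-(1+\rho^i)\sum_{k\in\mathcal T^i}[w^i]_k^\top v^i_k .$$ **Theorem.** Assume that each $f^i_l:\mathbb R\to\mathbb R$ is differentiable, $m^i_l$-strongly convex with $m^i_l>0$, and has $M^i_l$-Lipschitz gradient. Then the KKT conditions have a unique solution $(x^\star,\nu^\star)$, and from every initial state with $\sum_{l\in\mathcal V_k}y^l_k(0)=0$ for all $k$ the algorithm has a solution on $[0,\infty)$. For every solution so initialized: 1. If $\rho^i>0$ for all $i$, the solution converges exponentially fast to the target $v^l_k=\nu^\star_k$,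 $x=x^\star$, $y^l_k=[w^l]_kx^{l\star}-\bar{\mathsf b}^l_k$: there are $C,c>0$, depending only on $(n^i)$, $(w^i)$, $(\mathsf a_{ij})$, $(\mathcal V_k)$, $(\beta_k)$, $(\rho^i)$, $(m^i_l)$, $(M^i_l)$ (so neither on the initial state, nor on $\mathsf b$ and $\bar{\mathsf b}$, nor otherwise on the costs), such that at every time $t\ge0$ the distance of $(y,v,x)(t)$ from the target is at most $Ce^{-ct}$ times its distance at time $0$. 2. If $\rho^i\ge0$ for all $i$ (some or all of them possibly $0$), the convergence to the unique KKT solution is still guaranteed asymptotically: $v^l_k(t)\to\nu^\star_k$ for all $k$ and $l\in\mathcal V_k$, and $x^i(t)\to x^{i\star}$ for all $i$, as $t\to\infty$. -/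

import Mathlib

open scoped NNReal Topology

noncomputable section

/-- The stacked decision variable: agent `i` holds `xⁱ ∈ ℝ^{nⁱ}`. -/
abbrev PrimalVar {N : ℕ} (n : Fin N → ℕ) : Type :=
  ∀ i, EuclideanSpace ℝ (Fin (n i))

/-- One scalar for every constraint `k` and every agent `l ∈ 𝒱_k`. -/
abbrev DualVar {N p : ℕ} (V : Fin p → Finset (Fin N)) : Type :=
  ∀ k, EuclideanSpace ℝ (V k)

/-- A state `(y, v, x)` of the algorithm. -/
abbrev AlgState {N p : ℕ} (n : Fin N → ℕ) (V : Fin p → Finset (Fin N)) : Type :=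
  DualVar V × DualVar V × PrimalVar n

/-- The undirected graph with an edge between distinct `i`, `j` when the weight is positive. -/
def weightGraph {N : ℕ} (a : Matrix (Fin N) (Fin N) ℝ) : SimpleGraph (Fin N) :=
  SimpleGraph.fromRel (fun i j => 0 < a i j)

/-- The matrix `W = [w¹, …, w^N] ∈ ℝ^{p × (n¹ + ⋯ + n^N)}`. -/
def stackedWeights {N p : ℕ} {n : Fin N → ℕ} (w : ∀ i, Matrix (Fin p) (Fin (n i)) ℝ) :
    Matrix (Fin p) (Σ i, Fin (n i)) ℝ :=
  fun k s => w s.1 k s.2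

/-- The number `[w]_k x`. -/
def rowDot {p d : ℕ} (w : Matrix (Fin p) (Fin d) ℝ) (k : Fin p) (x : EuclideanSpace ℝ (Fin d)) : ℝ :=
  ∑ l, w k l * x l

/-- The vector `[w]_kᵀ`. -/
def rowVec {p d : ℕ} (w : Matrix (Fin p) (Fin d) ℝ) (k : Fin p) : EuclideanSpace ℝ (Fin d) :=
  WithLp.toLp 2 (w k)

/-- The separable cost `∑ l, g_l(x_l)` of one agent. -/
def localCost {d : ℕ} (g : Fin d → ℝ → ℝ) (x : EuclideanSpace ℝ (Fin d)) : ℝ :=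
  ∑ l, g l (x l)

/-- A differentiable function on `ℝ` that is `μ`-strongly convex and has `K`-Lipschitz gradient. -/
structure StronglyConvexSmooth (μ : ℝ) (K : ℝ≥0) (g : ℝ → ℝ) : Prop where
  differentiable : Differentiable ℝ g
  strong : ∀ x z : ℝ, μ * ‖z - x‖ ^ 2 ≤ (z - x) * (deriv g z - deriv g x)
  lipschitz : LipschitzWith K (deriv g)

/-- The KKT conditions of `min ∑ i, fⁱ(xⁱ)` subject to `∑ i, wⁱ xⁱ = b`. -/
structure IsKKT {N p : ℕ} {n : Fin N → ℕ} (f : ∀ i, Fin (n i) → ℝ → ℝ)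
    (w : ∀ i, Matrix (Fin p) (Fin (n i)) ℝ) (b : Fin p → ℝ)
    (x : PrimalVar n) (ν : Fin p → ℝ) : Prop where
  stationary : ∀ i, gradient (localCost (f i)) (x i) + ∑ k, ν k • rowVec (w i) k = 0
  feasible : ∀ k, ∑ i, rowDot (w i) k (x i) = b k

/-- `∑_{j ∈ 𝒱_k} a_{lj} (v_k^l - v_k^j)`. -/
def disagreement {N p : ℕ} {V : Fin p → Finset (Fin N)} (a : Matrix (Fin N) (Fin N) ℝ)
    (v : DualVar V) (k : Fin p) (l : V k) : ℝ :=
  ∑ j : V k, a l j * (v k l - v k j)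

/-- The right-hand side of the algorithm at the state `(y, v, x)`; the sums over
`{k // i ∈ V k}` are those over the set `𝒯ⁱ` of constraints that agent `i` takes part in. -/
def algField {N p : ℕ} {n : Fin N → ℕ} (f : ∀ i, Fin (n i) → ℝ → ℝ)
    (w : ∀ i, Matrix (Fin p) (Fin (n i)) ℝ) (a : Matrix (Fin N) (Fin N) ℝ)
    {V : Fin p → Finset (Fin N)} (bbar : ∀ k, V k → ℝ) (β : Fin p → ℝ) (ρ : Fin N → ℝ) :
    AlgState n V → AlgState n V
  | (y, v, x) =>
    (fun k => WithLp.toLp 2 fun l => β k * disagreement a v k l,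
     fun k => WithLp.toLp 2 fun l =>
      (rowDot (w l) k (x l) - bbar k l) - β k * disagreement a v k l - y k l,
     fun i =>
      -((1 + ρ i) • gradient (localCost (f i)) (x i))
        - ρ i • ∑ k : {k : Fin p // i ∈ V k},
            (rowDot (w i) k (x i) - bbar k ⟨i, k.2⟩) • rowVec (w i) k
        + ρ i • ∑ k : {k : Fin p // i ∈ V k}, y k ⟨i, k.2⟩ • rowVec (w i) k
        - (1 + ρ i) • ∑ k : {k : Fin p // i ∈ V k}, v k ⟨i, k.2⟩ • rowVec (w i) k)

/-- `z` solves `ż = F(z)` on `[0, ∞)`. -/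
def SolvesODE {E : Type*} [NormedAddCommGroup E] [NormedSpace ℝ E] (F : E → E) (z : ℝ → E) : Prop :=
  ∀ t ∈ Set.Ici (0 : ℝ), HasDerivWithinAt z (F (z t)) (Set.Ici 0) t

/-- The initialization condition `∑_{l ∈ 𝒱_k} y_k^l = 0` for every `k`. -/
def ZeroSumY {N p : ℕ} {n : Fin N → ℕ} {V : Fin p → Finset (Fin N)} (z : AlgState n V) : Prop :=
  ∀ k, ∑ l : V k, z.1 k l = 0

/-- Every agent of `𝒱_k` holds the same copy `ν_k` of the multiplier. -/
def consensusDual {N p : ℕ} (V : Fin p → Finset (Fin N)) (ν : Fin p → ℝ) : DualVar V :=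
  fun k => WithLp.toLp 2 fun _ => ν k

/-- The state `(y, v, x)` with `x = x⋆`, `v_k^l = ν⋆_k` and `y_k^l = [w^l]_k x^{l⋆} - b̄_k^l`. -/
def targetState {N p : ℕ} {n : Fin N → ℕ} (w : ∀ i, Matrix (Fin p) (Fin (n i)) ℝ)
    {V : Fin p → Finset (Fin N)} (bbar : ∀ k, V k → ℝ) (xs : PrimalVar n) (ν : Fin p → ℝ) :
    AlgState n V :=
  (fun k => WithLp.toLp 2 fun l => rowDot (w l) k (xs l) - bbar k l, consensusDual V ν, xs)

end

/-! ### Strongly monotone maps -/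

/-! Subtract the target. Let `η, ζ, ξ` be the errors of `y, v, x`, let `B` be the block matrix of
the local rows, `L` the Laplacian of the disjoint union of the graphs `𝒢_k` with gains as weights,
and `s = ρ / (1 + ρ) ∈ [0, 1)`. The algorithm becomes `η' = Lζ`, `ζ' = Bξ - Lζ - η`, `(1 - s) ξ' =
-(F'(ξ) + Bᵀζ + s Bᵀ(Bξ - η))`, where `F` is the cost minus its tangent at `x⋆`, translated to the
origin. The zero sums put `η` in the range of `L = SᵀS`, so `η = Sᵀe` with `e' = Sζ`. A single
exponential estimate for this system, with constants that see the costs only through their moduli,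
yields both parts of the theorem.

The obstacle is the penalty term `s Bᵀ(Bξ - η)`, which spoils the usual energy decay. For the
analysis a low-pass filter `x` of `ξ`, `(1 + s) x' = ξ - x`, is adjoined. A linear combination `y`
of the enlarged state then satisfies `(1 + s) y' = F'(ξ) - y` (`gradFilter_velocity`): it is the
gradient sent through the same filter. By `energy_identity` the bad terms of the energy balance
become products `ξ y`, and in the balance for the velocities, which solve the linearized system, `ξ'
y'`. As with a Zames-Falb multiplier, both are absorbed by the Fenchel-Young gap `F(ξ) + F*(y) - ξ y
≥ 0`, whose derivative is `(F'(ξ) - y) ξ' - (ξ - F*'(y)) y'`; the last product is nonnegative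
because `F'` is monotone. `lyap` combines the energies of state and velocity, filter terms and this
gap; `le_lyap` and `lyapRate_le` give its positivity and decay.

What is dissipated is `Sζ, Sζ', ξ, ξ'`. A small multiple of `s |Bᵀζ|² + |x|²` adds control of `Bᵀζ`
and `x` (`extraRate_le`). Connectivity and full row rank make `(S, Bᵀ)` injective, which recovers
`ζ`, and `Sζ'` then recovers `e` (`quadBdd_dissipation`). Grönwall's inequality finishes the
estimate; since `F'` is only Lipschitz, derivatives are replaced by upper bounds for right
difference quotients.

The KKT point comes from a strongly monotone dual equation (`exists_stationary_feasible`), global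
solutions from a contraction in a weighted norm (`LipschitzWith.exists_solvesODE`). -/

theorem surjective_of_stronglyMonotone {H : Type*} [NormedAddCommGroup H] [InnerProductSpace ℝ H]
    [CompleteSpace H] {T : H → H} {m : ℝ} {K : ℝ≥0} (hm : 0 < m) (hT : LipschitzWith K T)
    (hmono : ∀ x y, m * ‖x - y‖ ^ 2 ≤ inner ℝ (x - y) (T x - T y)) : Function.Surjective T := by
  intro b
  -- The map `x ↦ x - (m / k) • (T x - b)` contracts squared distances by `1 - 2m²/k + m²K²/k² ≤ 1 -
  -- m²/k`. The summand `m ^ 2` makes `k` positive and `1 - m²/k` nonnegative without comparing `K`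
  -- with `m`.
  set k : ℝ := (K : ℝ) ^ 2 + m ^ 2 with hk
  have hkpos : 0 < k := by positivity
  have hq1 : 1 - m ^ 2 / k < 1 := by
    have : 0 < m ^ 2 / k := by positivity
    linarith
  have hq0 : 0 ≤ 1 - m ^ 2 / k := by
    rw [sub_nonneg, div_le_one hkpos, hk]
    nlinarith [sq_nonneg (K : ℝ)]
  have hcontr : ContractingWith (√(1 - m ^ 2 / k)).toNNReal
      (fun x => x - (m / k) • (T x - b)) := by
    refine ⟨?_, LipschitzWith.of_dist_le_mul fun x y => ?_⟩
    · rw [← NNReal.coe_lt_coe, Real.coe_toNNReal _ (Real.sqrt_nonneg _)]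
      exact (Real.sqrt_lt' one_pos).2 (by simpa using hq1)
    · have hnorm : ‖T x - T y‖ ≤ K * ‖x - y‖ := by
        simpa [dist_eq_norm] using hT.dist_le_mul x y
      have e : (x - (m / k) • (T x - b)) - (y - (m / k) • (T y - b))
          = (x - y) - (m / k) • (T x - T y) := by
        module
      simp only [dist_eq_norm, e, Real.coe_toNNReal _ (Real.sqrt_nonneg _)]
      refine le_of_sq_le_sq ?_ (by positivity)
      rw [mul_pow, Real.sq_sqrt hq0, norm_sub_sq_real, inner_smul_right, norm_smul, mul_pow,
        Real.norm_eq_abs, sq_abs]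
      have h1 : ‖T x - T y‖ ^ 2 ≤ (K : ℝ) ^ 2 * ‖x - y‖ ^ 2 := by
        rw [← mul_pow]; exact pow_le_pow_left₀ (norm_nonneg _) hnorm 2
      have h2 := mul_le_mul_of_nonneg_left (hmono x y) (by positivity : 0 ≤ m / k)
      have h3 := mul_le_mul_of_nonneg_left h1 (by positivity : 0 ≤ (m / k) ^ 2)
      have h4 : (m / k) ^ 2 * ((K : ℝ) ^ 2 * ‖x - y‖ ^ 2) ≤ m ^ 2 / k * ‖x - y‖ ^ 2 := by
        have : (m / k) ^ 2 * (K : ℝ) ^ 2 ≤ m ^ 2 / k := by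
          have hK : (K : ℝ) ^ 2 / k ≤ 1 := by
            rw [div_le_one hkpos, hk]; nlinarith [sq_nonneg m]
          calc (m / k) ^ 2 * (K : ℝ) ^ 2 = m ^ 2 / k * ((K : ℝ) ^ 2 / k) := by field_simp
            _ ≤ m ^ 2 / k * 1 := by gcongr
            _ = _ := mul_one _
        nlinarith [sq_nonneg ‖x - y‖]
      have h5 : m / k * (m * ‖x - y‖ ^ 2) = m ^ 2 / k * ‖x - y‖ ^ 2 := by ring
      linarith
  have hfix := hcontr.fixedPoint_isFixedPt
  set x := ContractingWith.fixedPoint _ hcontr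
  refine ⟨x, ?_⟩
  have : (m / k) • (T x - b) = 0 := by
    have := hfix.eq
    simpa [sub_eq_self] using this
  rcases smul_eq_zero.1 this with h | h
  · exact absurd h (by positivity)
  · exact sub_eq_zero.1 h

/-! ### Scalar strongly convex functions -/

namespace StronglyConvexSmooth

variable {μ : ℝ} {K : ℝ≥0} {F : ℝ → ℝ}

theorem deriv_surjective (h : StronglyConvexSmooth μ K F) (hμ : 0 < μ) :
    Function.Surjective (deriv F) := by
  refine surjective_of_stronglyMonotone hμ h.lipschitz fun x y => ?_
  have := h.strong y x
  simp only [RCLike.inner_apply, conj_trivial]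
  linarith

theorem monotone_deriv (h : StronglyConvexSmooth μ K F) (hμ : 0 < μ) : Monotone (deriv F) := by
  intro x z hxz
  rcases hxz.eq_or_lt with rfl | hlt
  · exact le_rfl
  have h1 := h.strong x z
  have h2 : 0 ≤ (z - x) * (deriv F z - deriv F x) := le_trans (by positivity) h1
  have := nonneg_of_mul_nonneg_right h2 (sub_pos.2 hlt)
  linarith

theorem add_deriv_mul_le (h : StronglyConvexSmooth μ K F) (hμ : 0 < μ) (x z : ℝ) :
    F x + deriv F x * (z - x) ≤ F z := by
  have hc : ConvexOn ℝ Set.univ F := (h.monotone_deriv hμ).convexOn_univ_of_deriv h.differentiable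
  rcases lt_trichotomy x z with hlt | rfl | hlt
  · have := hc.le_slope_of_hasDerivAt (Set.mem_univ _) (Set.mem_univ _) hlt
      (h.differentiable x).hasDerivAt
    rw [slope_def_field, le_div_iff₀ (sub_pos.2 hlt)] at this
    linarith
  · simp
  · have := hc.slope_le_of_hasDerivAt (Set.mem_univ _) (Set.mem_univ _) hlt
      (h.differentiable x).hasDerivAt
    rw [slope_def_field, div_le_iff₀ (sub_pos.2 hlt)] at this
    linarith

theorem abs_deriv_sub_le (h : StronglyConvexSmooth μ K F) (x z : ℝ) :
    |deriv F z - deriv F x| ≤ K * |z - x| := by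
  simpa [Real.dist_eq] using h.lipschitz.dist_le_mul z x

theorem mul_abs_sub_le (h : StronglyConvexSmooth μ K F) (x z : ℝ) :
    μ * |z - x| ≤ |deriv F z - deriv F x| := by
  rcases eq_or_ne z x with rfl | hne
  · simp
  have h1 := h.strong x z
  have hpos : 0 < |z - x| := abs_pos.2 (sub_ne_zero.2 hne)
  have h2 : μ * |z - x| ^ 2 ≤ |z - x| * |deriv F z - deriv F x| := by
    rw [← abs_mul]
    exact le_trans (by simpa using h1) (le_abs_self _)
  have : |z - x| * (μ * |z - x|) ≤ |z - x| * |deriv F z - deriv F x| := by nlinarith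
  exact le_of_mul_le_mul_left this hpos

/-- Monotonicity gives the increments of argument and derivative the same sign, so the Lipschitz
bound may be multiplied by the increment of `F'`. This cocoercivity is what makes the dual map of
the KKT system strongly monotone. -/
theorem sq_deriv_sub_le (h : StronglyConvexSmooth μ K F) (hμ : 0 < μ) (x z : ℝ) :
    (deriv F z - deriv F x) ^ 2 ≤ K * ((z - x) * (deriv F z - deriv F x)) := by
  have h0 : 0 ≤ (z - x) * (deriv F z - deriv F x) := le_trans (by positivity) (h.strong x z)
  calc (deriv F z - deriv F x) ^ 2 = |deriv F z - deriv F x| * |deriv F z - deriv F x| := by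
        rw [← sq, sq_abs]
    _ ≤ (K * |z - x|) * |deriv F z - deriv F x| := by gcongr; exact h.abs_deriv_sub_le x z
    _ = K * |(z - x) * (deriv F z - deriv F x)| := by rw [abs_mul]; ring
    _ = _ := by rw [abs_of_nonneg h0]

end StronglyConvexSmooth

/-! ### Convex conjugates of scalar functions -/

noncomputable section

/-- A right inverse of the derivative. -/
def derivInv (F : ℝ → ℝ) : ℝ → ℝ := Function.invFun (deriv F)

/-- The convex conjugate of a function with surjective derivative. -/
def convexConj (F : ℝ → ℝ) (y : ℝ) : ℝ := derivInv F y * y - F (derivInv F y)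

end

namespace StronglyConvexSmooth

variable {μ : ℝ} {K : ℝ≥0} {F : ℝ → ℝ}

theorem deriv_derivInv (h : StronglyConvexSmooth μ K F) (hμ : 0 < μ) (y : ℝ) :
    deriv F (derivInv F y) = y :=
  Function.invFun_eq (h.deriv_surjective hμ y)

theorem lipschitzWith_derivInv (h : StronglyConvexSmooth μ K F) (hμ : 0 < μ) :
    LipschitzWith (μ⁻¹).toNNReal (derivInv F) := by
  refine LipschitzWith.of_dist_le_mul fun x y => ?_
  have := h.mul_abs_sub_le (derivInv F y) (derivInv F x)
  rw [h.deriv_derivInv hμ, h.deriv_derivInv hμ] at this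
  rw [Real.dist_eq, Real.dist_eq, Real.coe_toNNReal _ (inv_nonneg.2 hμ.le)]
  rw [← div_eq_inv_mul, le_div_iff₀ hμ]
  linarith

theorem continuous_derivInv (h : StronglyConvexSmooth μ K F) (hμ : 0 < μ) :
    Continuous (derivInv F) :=
  (h.lipschitzWith_derivInv hμ).continuous

theorem fenchel_young (h : StronglyConvexSmooth μ K F) (hμ : 0 < μ) (x y : ℝ) :
    x * y ≤ F x + convexConj F y := by
  have := h.add_deriv_mul_le hμ (derivInv F y) x
  rw [h.deriv_derivInv hμ] at this
  unfold convexConj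
  linarith

/-- `derivInv F y'` is a subgradient of the conjugate at `y'`, by Fenchel-Young with equality at
`y'`. This one-sided bound suffices for `hasUpperSlope_convexConj`. -/
theorem convexConj_sub_le (h : StronglyConvexSmooth μ K F) (hμ : 0 < μ) (y y' : ℝ) :
    convexConj F y' - convexConj F y ≤ derivInv F y' * (y' - y) := by
  have := h.fenchel_young hμ (derivInv F y') y
  have e : convexConj F y' = derivInv F y' * y' - F (derivInv F y') := rfl
  rw [e]
  linarith

theorem continuous_convexConj (h : StronglyConvexSmooth μ K F) (hμ : 0 < μ) :
    Continuous (convexConj F) :=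
  ((h.continuous_derivInv hμ).mul continuous_id).sub
    (h.differentiable.continuous.comp (h.continuous_derivInv hμ))

theorem nonneg (h : StronglyConvexSmooth μ K F) (hμ : 0 < μ) (h0 : F 0 = 0)
    (h0' : deriv F 0 = 0) (x : ℝ) : 0 ≤ F x := by
  simpa [h0, h0'] using h.add_deriv_mul_le hμ 0 x

theorem le_mul_deriv (h : StronglyConvexSmooth μ K F) (hμ : 0 < μ) (h0 : F 0 = 0) (x : ℝ) :
    F x ≤ x * deriv F x := by
  have := h.add_deriv_mul_le hμ x 0
  rw [h0] at this
  linarith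

theorem convexConj_nonneg (h : StronglyConvexSmooth μ K F) (hμ : 0 < μ) (h0 : F 0 = 0) (y : ℝ) :
    0 ≤ convexConj F y := by
  simpa [h0] using h.fenchel_young hμ 0 y

theorem convexConj_le (h : StronglyConvexSmooth μ K F) (hμ : 0 < μ) (h0 : F 0 = 0)
    (h0' : deriv F 0 = 0) (y : ℝ) : convexConj F y ≤ y ^ 2 / μ := by
  have h1 := h.nonneg hμ h0 h0' (derivInv F y)
  have h2 := h.mul_abs_sub_le 0 (derivInv F y)
  rw [h.deriv_derivInv hμ, h0', sub_zero, sub_zero] at h2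
  have h3 : derivInv F y * y ≤ |derivInv F y| * |y| := by
    rw [← abs_mul]; exact le_abs_self _
  rw [le_div_iff₀ hμ]
  unfold convexConj
  have h4 : μ * |derivInv F y| * |y| ≤ |y| * |y| := by gcongr
  have h5 : |y| * |y| = y ^ 2 := by rw [← sq, sq_abs]
  nlinarith

theorem sq_deriv_le (h : StronglyConvexSmooth μ K F) (h0' : deriv F 0 = 0) (x : ℝ) :
    deriv F x ^ 2 ≤ (K : ℝ) ^ 2 * x ^ 2 := by
  have := h.abs_deriv_sub_le 0 x
  rw [h0', sub_zero, sub_zero] at this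
  rw [← mul_pow, ← sq_abs, ← sq_abs (K * x), abs_mul, NNReal.abs_eq]
  gcongr

theorem mul_sq_le (h : StronglyConvexSmooth μ K F) (h0' : deriv F 0 = 0) (x : ℝ) :
    μ * x ^ 2 ≤ x * deriv F x := by
  simpa [h0'] using h.strong 0 x

end StronglyConvexSmooth

/-! ### Upper bounds for right difference quotients -/

/-- The right difference quotients of `f` at `t` are eventually below a function that tends
to `d`. -/
def HasUpperSlope (f : ℝ → ℝ) (t d : ℝ) : Prop :=
  ∃ E : ℝ → ℝ, (∀ᶠ s in 𝓝[>] t, slope f t s ≤ E s) ∧ Filter.Tendsto E (𝓝[>] t) (𝓝 d)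

namespace HasUpperSlope

variable {f g : ℝ → ℝ} {t d e : ℝ}

theorem add (hf : HasUpperSlope f t d) (hg : HasUpperSlope g t e) :
    HasUpperSlope (fun s => f s + g s) t (d + e) := by
  obtain ⟨E, hE, hEt⟩ := hf
  obtain ⟨G, hG, hGt⟩ := hg
  refine ⟨fun s => E s + G s, ?_, hEt.add hGt⟩
  filter_upwards [hE, hG] with s h1 h2
  have : slope (fun s => f s + g s) t s = slope f t s + slope g t s := by
    simp only [slope_def_field]; ring
  rw [this]
  exact add_le_add h1 h2

theorem const_mul (hf : HasUpperSlope f t d) {c : ℝ} (hc : 0 ≤ c) :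
    HasUpperSlope (fun s => c * f s) t (c * d) := by
  obtain ⟨E, hE, hEt⟩ := hf
  refine ⟨fun s => c * E s, ?_, hEt.const_mul c⟩
  filter_upwards [hE] with s h1
  have : slope (fun s => c * f s) t s = c * slope f t s := by
    simp only [slope_def_field]; ring
  rw [this]
  exact mul_le_mul_of_nonneg_left h1 hc

theorem sum {ι : Type*} {u : Finset ι} {f : ι → ℝ → ℝ} {d : ι → ℝ}
    (h : ∀ i ∈ u, HasUpperSlope (f i) t (d i)) :
    HasUpperSlope (fun s => ∑ i ∈ u, f i s) t (∑ i ∈ u, d i) := by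
  classical
  induction u using Finset.induction_on with
  | empty =>
    refine ⟨fun _ => 0, ?_, by simp⟩
    filter_upwards with s
    simp [slope_def_field]
  | insert i u hi ih =>
    simp only [Finset.sum_insert hi]
    exact (h i (Finset.mem_insert_self i u)).add
      (ih fun j hj => h j (Finset.mem_insert_of_mem hj))

end HasUpperSlope

theorem HasDerivWithinAt.tendsto_slope_Ioi {f : ℝ → ℝ} {t d : ℝ}
    (hf : HasDerivWithinAt f d (Set.Ici t) t) :
    Filter.Tendsto (slope f t) (𝓝[>] t) (𝓝 d) := by
  have := hasDerivWithinAt_iff_tendsto_slope.1 hf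
  rwa [Set.Ici_sdiff_left] at this

theorem HasDerivWithinAt.hasUpperSlope {f : ℝ → ℝ} {t d : ℝ}
    (hf : HasDerivWithinAt f d (Set.Ici t) t) : HasUpperSlope f t d :=
  ⟨slope f t, Filter.Eventually.of_forall fun _ => le_rfl, hf.tendsto_slope_Ioi⟩

theorem HasDerivWithinAt.tendsto_Ioi {f : ℝ → ℝ} {t d : ℝ}
    (hf : HasDerivWithinAt f d (Set.Ici t) t) : Filter.Tendsto f (𝓝[>] t) (𝓝 (f t)) :=
  hf.continuousWithinAt.tendsto.mono_left (nhdsWithin_mono _ Set.Ioi_subset_Ici_self)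

/-- The subgradient inequality at the later time bounds the quotient by a product of two convergent
factors. -/
theorem StronglyConvexSmooth.hasUpperSlope_convexConj {μ : ℝ} {K : ℝ≥0} {F : ℝ → ℝ}
    (h : StronglyConvexSmooth μ K F) (hμ : 0 < μ) {y : ℝ → ℝ} {t d : ℝ}
    (hy : HasDerivWithinAt y d (Set.Ici t) t) :
    HasUpperSlope (fun s => convexConj F (y s)) t (derivInv F (y t) * d) := by
  refine ⟨fun s => derivInv F (y s) * slope y t s, ?_,
    (((h.continuous_derivInv hμ).tendsto (y t)).comp hy.tendsto_Ioi).mul hy.tendsto_slope_Ioi⟩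
  filter_upwards [self_mem_nhdsWithin] with s hs
  rw [slope_def_field, slope_def_field, ← mul_div_assoc,
    div_le_div_iff_of_pos_right (sub_pos.2 hs)]
  exact h.convexConj_sub_le hμ _ _

/-- Along a curve with velocity `ℓ - a • F'(x)`, the kinetic energy decreases at least as fast as
if `F''` were `μ`. -/
theorem StronglyConvexSmooth.hasUpperSlope_half_sq_velocity {μ : ℝ} {K : ℝ≥0} {F : ℝ → ℝ}
    (h : StronglyConvexSmooth μ K F) {a : ℝ} (ha : 0 ≤ a) {x ℓ : ℝ → ℝ} {t ℓ' : ℝ}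
    (hx : HasDerivWithinAt x (ℓ t - a * deriv F (x t)) (Set.Ici t) t)
    (hℓ : HasDerivWithinAt ℓ ℓ' (Set.Ici t) t) :
    HasUpperSlope (fun s => (ℓ s - a * deriv F (x s)) ^ 2 / 2) t
      ((ℓ t - a * deriv F (x t)) * ℓ' - a * μ * (ℓ t - a * deriv F (x t)) ^ 2) := by
  set V : ℝ → ℝ := fun s => ℓ s - a * deriv F (x s) with hV
  have hVt : Filter.Tendsto V (𝓝[>] t) (𝓝 (V t)) :=
    hℓ.tendsto_Ioi.sub (((h.lipschitz.continuous.tendsto (x t)).comp hx.tendsto_Ioi).const_mul a)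
  have hs := hx.tendsto_slope_Ioi
  have hmid : Filter.Tendsto (fun s => (V s + V t) / 2) (𝓝[>] t) (𝓝 (V t)) := by
    have := (hVt.add_const (V t)).div_const 2
    simpa using this
  -- The quotient of `V² / 2` is the mean velocity times the quotient of `V`. Strong convexity
  -- applies once the mean velocity is replaced by the quotient of `x`; the last summand bounds the
  -- error of that replacement by the Lipschitz constant and tends to `0`, since both tend to `V t`.
  refine ⟨fun s => (V s + V t) / 2 * slope ℓ t s - a * μ * slope x t s ^ 2
      + a * K * (|(V s + V t) / 2 - slope x t s| * |slope x t s|), ?_, ?_⟩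
  · filter_upwards [self_mem_nhdsWithin] with s hs
    have hpos : 0 < s - t := sub_pos.2 hs
    set D := slope (fun s => deriv F (x s)) t s with hD
    have e1 : slope (fun s => V s ^ 2 / 2) t s = (V s + V t) / 2 * (slope ℓ t s - a * D) := by
      simp only [hD, hV, slope_def_field]
      field_simp
      ring
    have e2 : μ * slope x t s ^ 2 ≤ slope x t s * D := by
      have := h.strong (x t) (x s)
      simp only [hD, slope_def_field]
      rw [div_pow, ← mul_div_assoc, div_mul_div_comm, ← sq,
        div_le_div_iff_of_pos_right (by positivity)]
      simpa using this
    have e3 : |D| ≤ K * |slope x t s| := by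
      have := h.abs_deriv_sub_le (x t) (x s)
      simp only [hD, slope_def_field, abs_div, ← mul_div_assoc]
      rw [div_le_div_iff_of_pos_right (abs_pos.2 hpos.ne')]
      exact this
    have e4 : -(((V s + V t) / 2 - slope x t s) * D)
        ≤ K * (|(V s + V t) / 2 - slope x t s| * |slope x t s|) := by
      calc -(((V s + V t) / 2 - slope x t s) * D) ≤ |((V s + V t) / 2 - slope x t s) * D| :=
            neg_le_abs _
        _ = |(V s + V t) / 2 - slope x t s| * |D| := abs_mul _ _
        _ ≤ |(V s + V t) / 2 - slope x t s| * (K * |slope x t s|) := by gcongr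
        _ = _ := by ring
    rw [e1]
    have e5 := mul_le_mul_of_nonneg_left e2 ha
    have e6 := mul_le_mul_of_nonneg_left e4 ha
    nlinarith
  · have := ((hmid.mul hℓ.tendsto_slope_Ioi).sub ((hs.pow 2).const_mul (a * μ))).add
      ((((hmid.sub hs).abs).mul hs.abs).const_mul (a * K))
    simpa [hV] using this

/-- Grönwall's inequality only asks that right difference quotients be frequently below each number
exceeding the rate, which an upper slope supplies. -/
theorem le_mul_exp_of_hasUpperSlope {W D : ℝ → ℝ} {κ : ℝ}
    (hc : ContinuousOn W (Set.Ici 0)) (hW : ∀ t, 0 ≤ t → HasUpperSlope W t (D t))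
    (hD : ∀ t, 0 ≤ t → D t ≤ -κ * W t) {t : ℝ} (ht : 0 ≤ t) :
    W t ≤ W 0 * Real.exp (-κ * t) := by
  have := le_gronwallBound_of_liminf_deriv_right_le (f := W) (f' := D) (δ := W 0) (K := -κ)
    (ε := 0) (a := 0) (b := t) (hc.mono Set.Icc_subset_Ici_self) ?_ le_rfl
    (fun x hx => by simpa using hD x hx.1) t (Set.right_mem_Icc.2 ht)
  · simpa [gronwallBound_ε0] using this
  · intro x hx r hr
    obtain ⟨E, hE, hEt⟩ := hW x hx.1
    refine Filter.Eventually.frequently ?_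
    filter_upwards [hE, hEt.eventually_lt_const hr] with z h1 h2
    have : (z - x)⁻¹ * (W z - W x) = slope W x z := by
      rw [slope_def_field, div_eq_inv_mul]
    rw [this]
    exact h1.trans_lt h2

/-! ### Energy identities for primal-dual dynamics in coordinates -/

section Energy

open Matrix

variable {E I J : Type*}

theorem sum_mul_transpose_mulVec [Fintype I] [Fintype J] (M : Matrix I J ℝ) (u : J → ℝ) (d : I → ℝ) :
    ∑ j, u j * (Mᵀ *ᵥ d) j = ∑ i, (M *ᵥ u) i * d i := by
  simp only [mulVec, dotProduct, transpose_apply, Finset.mul_sum, Finset.sum_mul]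
  rw [Finset.sum_comm]
  exact Finset.sum_congr rfl fun i _ => Finset.sum_congr rfl fun j _ => by ring

/-- The weights `σ` and `s` are intertwined by `B`. -/
def Intertwines (B : Matrix I J ℝ) (σ : I → ℝ) (s : J → ℝ) : Prop :=
  ∀ i j, B i j ≠ 0 → σ i = s j

namespace Intertwines

variable {B : Matrix I J ℝ} {σ : I → ℝ} {s : J → ℝ}

/-- `B` links only coordinates of equal weight, so every function of the weights passes through it.
In the application both weights are `ρ / (1 + ρ)` of the agent that owns the coordinate. -/
theorem mulVec_mul [Fintype J] (h : Intertwines B σ s) (φ : ℝ → ℝ) (u : J → ℝ) (i : I) :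
    (B *ᵥ fun j => φ (s j) * u j) i = φ (σ i) * (B *ᵥ u) i := by
  simp only [mulVec, dotProduct, Finset.mul_sum]
  refine Finset.sum_congr rfl fun j _ => ?_
  by_cases hB : B i j = 0
  · simp [hB]
  · rw [h i j hB]; ring

theorem transpose_mulVec_mul [Fintype I] (h : Intertwines B σ s) (φ : ℝ → ℝ) (d : I → ℝ) (j : J) :
    (Bᵀ *ᵥ fun i => φ (σ i) * d i) j = φ (s j) * (Bᵀ *ᵥ d) j := by
  simp only [mulVec, dotProduct, Finset.mul_sum, transpose_apply]
  refine Finset.sum_congr rfl fun i _ => ?_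
  by_cases hB : B i j = 0
  · simp [hB]
  · rw [h i j hB]; ring

theorem sum_mul_transpose_mulVec [Fintype I] [Fintype J] (h : Intertwines B σ s) (φ : ℝ → ℝ)
    (u : J → ℝ) (d : I → ℝ) :
    ∑ j, φ (s j) * u j * (Bᵀ *ᵥ d) j = ∑ i, φ (σ i) * (B *ᵥ u) i * d i := by
  rw [_root_.sum_mul_transpose_mulVec B (fun j => φ (s j) * u j) d]
  exact Finset.sum_congr rfl fun i _ => by rw [h.mulVec_mul]

end Intertwines

/-- The velocity of a first order low-pass filter of `ξ`. -/
noncomputable def filterVel (s ξ x : J → ℝ) (j : J) : ℝ := (ξ j - x j) / (1 + s j)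

theorem mulVec_filterVel [Fintype J] {B : Matrix I J ℝ} {σ : I → ℝ} {s : J → ℝ}
    (h : Intertwines B σ s) (ξ x : J → ℝ) (i : I) :
    (B *ᵥ filterVel s ξ x) i = ((B *ᵥ ξ) i - (B *ᵥ x) i) / (1 + σ i) := by
  have : filterVel s ξ x = fun j => (fun a => (1 + a)⁻¹) (s j) * (ξ - x) j := by
    funext j; simp [filterVel, div_eq_inv_mul]
  rw [this, h.mulVec_mul (fun a => (1 + a)⁻¹) (ξ - x) i, mulVec_sub, Pi.sub_apply, div_eq_inv_mul]

variable [Fintype E] [Fintype I] [Fintype J]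

/-- The velocity of the dual error. -/
def dualVel (S : Matrix E I ℝ) (B : Matrix I J ℝ) (e : E → ℝ) (ζ : I → ℝ) (ξ : J → ℝ) : I → ℝ :=
  B *ᵥ ξ - Sᵀ *ᵥ (S *ᵥ ζ) - Sᵀ *ᵥ e

/-- The linear part of the force on the primal error. -/
def linForce (S : Matrix E I ℝ) (B : Matrix I J ℝ) (s : J → ℝ) (e : E → ℝ) (ζ : I → ℝ)
    (ξ : J → ℝ) (j : J) : ℝ :=
  (Bᵀ *ᵥ ζ) j + s j * (Bᵀ *ᵥ (B *ᵥ ξ - Sᵀ *ᵥ e)) j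

/-- The velocity of the primal error. -/
noncomputable def primalVel (S : Matrix E I ℝ) (B : Matrix I J ℝ) (s : J → ℝ) (e : E → ℝ)
    (ζ : I → ℝ) (ξ γ : J → ℝ) (j : J) : ℝ :=
  -(γ j + linForce S B s e ζ ξ j) / (1 - s j)

/-- The signal that turns out to be a low-pass filtered gradient. -/
noncomputable def gradFilter (S : Matrix E I ℝ) (B : Matrix I J ℝ) (s : J → ℝ) (e : E → ℝ)
    (ζ : I → ℝ) (ξ x : J → ℝ) (j : J) : ℝ :=
  (Bᵀ *ᵥ (B *ᵥ x - Sᵀ *ᵥ e - ζ)) j + (1 - s j) / (1 + s j) * (x j - ξ j)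

variable {S : Matrix E I ℝ} {B : Matrix I J ℝ} {σ : I → ℝ} {s : J → ℝ}

/-- The left side is the rate of `(|e|² + |ζ|²) / 2 + ∑ (1 - s) / (1 + s) ξ² / 2`. The couplings
through `S` and `B` cancel by skew-symmetry, and `gradFilter` absorbs the contribution of `s`,
leaving `ξ y`, `ξ x'` and `Bξ (Bξ - Bx)`, for each of which `lyap` has a matching term. As `γ` is
arbitrary, the identity also applies to the velocities. -/
theorem energy_identity (h : Intertwines B σ s) (hs : ∀ j, 0 ≤ s j) (e : E → ℝ) (ζ : I → ℝ)
    (ξ γ x : J → ℝ) :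
    ∑ i, ζ i * dualVel S B e ζ ξ i + ∑ k, e k * (S *ᵥ ζ) k
        - ∑ j, ξ j * (γ j + linForce S B s e ζ ξ j) / (1 + s j)
      = -∑ k, (S *ᵥ ζ) k ^ 2
        - ∑ j, (ξ j * (γ j + s j * gradFilter S B s e ζ ξ x j) / (1 + s j)
            + s j * ((1 - s j) / (1 + s j)) * ξ j * filterVel s ξ x j)
        - ∑ i, σ i / (1 + σ i) * (B *ᵥ ξ) i * ((B *ᵥ ξ) i - (B *ᵥ x) i) := by
  have h1 : ∑ i, ζ i * dualVel S B e ζ ξ i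
      = ∑ j, ξ j * (Bᵀ *ᵥ ζ) j - ∑ k, (S *ᵥ ζ) k ^ 2 - ∑ k, e k * (S *ᵥ ζ) k := by
    have e1 : ∀ i, ζ i * dualVel S B e ζ ξ i = (B *ᵥ ξ) i * ζ i
        - ζ i * (Sᵀ *ᵥ (S *ᵥ ζ)) i - ζ i * (Sᵀ *ᵥ e) i := by
      intro i; simp only [dualVel, Pi.sub_apply]; ring
    simp only [e1, Finset.sum_sub_distrib, sum_mul_transpose_mulVec]
    congr 1
    · congr 1
      exact Finset.sum_congr rfl fun k _ => by ring
    · exact Finset.sum_congr rfl fun k _ => by ring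
  have h2 := h.sum_mul_transpose_mulVec (fun a => a / (1 + a)) ξ (B *ᵥ ξ - B *ᵥ x)
  simp only [Pi.sub_apply] at h2
  rw [h1, ← h2]
  have h3 : ∑ j, (ξ j * (Bᵀ *ᵥ ζ) j - ξ j * (γ j + linForce S B s e ζ ξ j) / (1 + s j))
      = ∑ j, (-(ξ j * (γ j + s j * gradFilter S B s e ζ ξ x j) / (1 + s j)
            + s j * ((1 - s j) / (1 + s j)) * ξ j * filterVel s ξ x j)
            - s j / (1 + s j) * ξ j * (Bᵀ *ᵥ (B *ᵥ ξ - B *ᵥ x)) j) := by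
    refine Finset.sum_congr rfl fun j _ => ?_
    have := hs j
    have hc : 1 + s j ≠ 0 := by positivity
    simp only [linForce, gradFilter, filterVel, mulVec_sub, Pi.sub_apply]
    field_simp
    ring
  simp only [Finset.sum_sub_distrib, Finset.sum_neg_distrib] at h3
  linarith

/-- Inserting the primal and dual equations cancels every term but `γ` and `gradFilter` itself,
because `B` commutes with the filter. Thus `gradFilter` follows `γ` exactly as `x` follows `ξ`. -/
theorem gradFilter_velocity (h : Intertwines B σ s) (hs : ∀ j, 0 ≤ s j) (hs1 : ∀ j, s j < 1)
    (e : E → ℝ) (ζ : I → ℝ) (ξ γ x : J → ℝ) (j : J) :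
    gradFilter S B s (S *ᵥ ζ) (dualVel S B e ζ ξ) (primalVel S B s e ζ ξ γ) (filterVel s ξ x) j
      = (γ j - gradFilter S B s e ζ ξ x j) / (1 + s j) := by
  have hc : 1 + s j ≠ 0 := by have := hs j; positivity
  have hd : 1 - s j ≠ 0 := (sub_pos.2 (hs1 j)).ne'
  have e1 : B *ᵥ filterVel s ξ x = fun i => (fun a => (1 + a)⁻¹) (σ i) * (B *ᵥ ξ - B *ᵥ x) i := by
    funext i
    rw [mulVec_filterVel h, div_eq_inv_mul, Pi.sub_apply]
  have e2 := h.transpose_mulVec_mul (fun a => (1 + a)⁻¹) (B *ᵥ ξ - B *ᵥ x) j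
  rw [← e1] at e2
  simp only [gradFilter, primalVel, linForce, dualVel, mulVec_sub, Pi.sub_apply, e2, filterVel]
  field_simp
  ring

/-- The Lyapunov function; `φ` and `ψ` stand for the values of the costs and their conjugates. -/
noncomputable def lyap (S : Matrix E I ℝ) (B : Matrix I J ℝ) (σ : I → ℝ) (s : J → ℝ) (e : E → ℝ)
    (ζ : I → ℝ) (ξ γ x φ ψ : J → ℝ) : ℝ :=
  ∑ k, (e k ^ 2 / 2 + 8 * (S *ᵥ ζ) k ^ 2)
  + ∑ i, (ζ i ^ 2 / 2 + 8 * dualVel S B e ζ ξ i ^ 2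
      + σ i * ((B *ᵥ x) i ^ 2 / 2 + 8 * (B *ᵥ filterVel s ξ x) i ^ 2))
  + ∑ j, ((1 - s j) / (1 + s j) * (ξ j ^ 2 / 2)
      + 16 * ((1 - s j) / (1 + s j)) * (primalVel S B s e ζ ξ γ j ^ 2 / 2)
      + s j * ((1 - s j) / (1 + s j)) * (x j ^ 2 / 2 + 8 * filterVel s ξ x j ^ 2)
      + s j * (16 / (1 + s j) ^ 2 * (φ j - ξ j * gradFilter S B s e ζ ξ x j)
          + (16 / (1 + s j) ^ 2 - 1) * ψ j))

/-- The sign of `lyap` is hidden by the Fenchel-Young gap being diminished by `ψ`. Twice the energy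
identity trades the missing part for products of state and velocity, and the weights `1 / 2` and `8`
are large enough to complete the squares. -/
theorem le_lyap (h : Intertwines B σ s) (hσ : ∀ i, 0 ≤ σ i) (hs : ∀ j, 0 ≤ s j)
    (hs1 : ∀ j, s j < 1) (e : E → ℝ) (ζ : I → ℝ) (ξ γ x φ ψ : J → ℝ) (hφ : ∀ j, 0 ≤ φ j) (hψ : ∀ j, 0 ≤ ψ j)
    (hφγ : ∀ j, φ j ≤ ξ j * γ j)
    (hfy : ∀ j, ξ j * gradFilter S B s e ζ ξ x j ≤ φ j + ψ j) :
    (∑ k, e k ^ 2 + ∑ i, ζ i ^ 2 + ∑ j, (1 - s j) / (1 + s j) * ξ j ^ 2) / 4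
      ≤ lyap S B σ s e ζ ξ γ x φ ψ := by
  have hid := energy_identity (S := S) h hs e ζ ξ γ x
  have hE : ∑ k, (e k ^ 2 / 4 + 2 * (S *ᵥ ζ) k ^ 2 - 2 * (e k * (S *ᵥ ζ) k) - 2 * (S *ᵥ ζ) k ^ 2)
      ≤ ∑ k, (e k ^ 2 / 2 + 8 * (S *ᵥ ζ) k ^ 2) := by
    refine Finset.sum_le_sum fun k _ => ?_
    nlinarith [sq_nonneg (e k + 4 * (S *ᵥ ζ) k)]
  have hI : ∑ i, (ζ i ^ 2 / 4 - 2 * (ζ i * dualVel S B e ζ ξ i)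
        - 2 * (σ i / (1 + σ i) * (B *ᵥ ξ) i * ((B *ᵥ ξ) i - (B *ᵥ x) i)))
      ≤ ∑ i, (ζ i ^ 2 / 2 + 8 * dualVel S B e ζ ξ i ^ 2
        + σ i * ((B *ᵥ x) i ^ 2 / 2 + 8 * (B *ᵥ filterVel s ξ x) i ^ 2)) := by
    refine Finset.sum_le_sum fun i _ => ?_
    have h0 := hσ i
    have hc : 1 + σ i ≠ 0 := by positivity
    set a' := (B *ᵥ filterVel s ξ x) i with ha'
    have e1 : (B *ᵥ ξ) i = (B *ᵥ x) i + (1 + σ i) * a' := by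
      rw [ha', mulVec_filterVel h]; field_simp; ring
    have e2 : σ i / (1 + σ i) * (B *ᵥ ξ) i * ((B *ᵥ ξ) i - (B *ᵥ x) i)
        = σ i * ((B *ᵥ x) i + (1 + σ i) * a') * a' := by
      rw [e1]; field_simp; ring
    rw [e2]
    nlinarith [sq_nonneg (ζ i + 4 * dualVel S B e ζ ξ i), sq_nonneg (dualVel S B e ζ ξ i),
      mul_nonneg h0 (sq_nonneg ((B *ᵥ x) i + 2 * a')), mul_nonneg h0 (sq_nonneg a'),
      mul_nonneg (mul_nonneg h0 h0) (sq_nonneg a')]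
  have hJ : ∑ j, ((1 - s j) / (1 + s j) * ξ j ^ 2 / 4
        + 2 * (ξ j * (γ j + linForce S B s e ζ ξ j) / (1 + s j))
        - 2 * (ξ j * (γ j + s j * gradFilter S B s e ζ ξ x j) / (1 + s j)
            + s j * ((1 - s j) / (1 + s j)) * ξ j * filterVel s ξ x j))
      ≤ ∑ j, ((1 - s j) / (1 + s j) * (ξ j ^ 2 / 2)
      + 16 * ((1 - s j) / (1 + s j)) * (primalVel S B s e ζ ξ γ j ^ 2 / 2)
      + s j * ((1 - s j) / (1 + s j)) * (x j ^ 2 / 2 + 8 * filterVel s ξ x j ^ 2)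
      + s j * (16 / (1 + s j) ^ 2 * (φ j - ξ j * gradFilter S B s e ζ ξ x j)
          + (16 / (1 + s j) ^ 2 - 1) * ψ j)) := by
    refine Finset.sum_le_sum fun j _ => ?_
    have h0 := hs j
    have h1 := hs1 j
    have hc : 0 < 1 + s j := by positivity
    have hd : 0 < 1 - s j := by linarith
    set r := (1 - s j) / (1 + s j) with hr
    have hr0 : 0 ≤ r := by positivity
    have e1 : ξ j * (γ j + linForce S B s e ζ ξ j) / (1 + s j)
        = -(r * (ξ j * primalVel S B s e ζ ξ γ j)) := by
      rw [hr, primalVel]; field_simp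
    have e2 : ξ j = x j + (1 + s j) * filterVel s ξ x j := by
      rw [filterVel]; field_simp; ring
    set x' := filterVel s ξ x j
    set y := gradFilter S B s e ζ ξ x j
    set u := primalVel S B s e ζ ξ γ j
    set T := 16 / (1 + s j) ^ 2 with hT
    set q := 2 / (1 + s j) with hq
    have hq1 : 1 ≤ q := by rw [hq, le_div_iff₀ hc]; linarith
    have hTq : q ≤ T := by
      rw [hT, hq, div_le_div_iff₀ hc (by positivity)]; nlinarith
    have e3 : 2 * (ξ j * (γ j + s j * y) / (1 + s j)) = q * (ξ j * γ j) + s j * (q * (ξ j * y)) := by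
      rw [hq]; field_simp
    have g1 : 0 ≤ r * (ξ j + 4 * u) ^ 2 := by positivity
    have g1' : 0 ≤ r * u ^ 2 := by positivity
    have g2 : 0 ≤ s j * r * (x j + 2 * x') ^ 2 := by positivity
    have g3 : 0 ≤ s j * r * x' ^ 2 := by positivity
    have g4 : 0 ≤ s j * (s j * r * x' ^ 2) := by positivity
    have g5 : 0 ≤ q * (ξ j * γ j) := mul_nonneg (by linarith) ((hφ j).trans (hφγ j))
    -- The coefficient of `s` that remains, `T (φ - ξ y) + (T - 1) ψ + q ξ y`, regrouped so that
    -- each summand has a sign: Fenchel-Young with `q ≤ T`, and `1 ≤ q`.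
    have g6 : 0 ≤ s j * ((T - q) * (φ j + ψ j - ξ j * y) + q * φ j + (q - 1) * ψ j) := by
      have := mul_nonneg (sub_nonneg.2 hTq) (sub_nonneg.2 (hfy j))
      have := mul_nonneg (by linarith : 0 ≤ q) (hφ j)
      have := mul_nonneg (sub_nonneg.2 hq1) (hψ j)
      positivity
    have e4 : s j * r * ξ j * x' = s j * r * (x j * x' + x' ^ 2) + s j * (s j * r * x' ^ 2) := by
      rw [e2]; ring
    rw [e1, mul_add 2 (_ / _) _, e3, e4]
    nlinarith
  unfold lyap
  simp only [Finset.sum_add_distrib, Finset.sum_sub_distrib, ← Finset.mul_sum,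
    ← Finset.sum_div] at hE hI hJ hid ⊢
  have : 0 ≤ ∑ k, (S *ᵥ ζ) k ^ 2 := Finset.sum_nonneg fun k _ => sq_nonneg _
  linarith

/-- An upper bound for the right difference quotients of the Lyapunov function along the flow, with
the second derivatives of the costs replaced by the lower bound `μ`; here `p` is the gradient of
the conjugate costs. -/
noncomputable def lyapRate (S : Matrix E I ℝ) (B : Matrix I J ℝ) (σ : I → ℝ) (s μ : J → ℝ)
    (e : E → ℝ) (ζ : I → ℝ) (ξ γ x p : J → ℝ) : ℝ :=
  ∑ k, (e k * (S *ᵥ ζ) k + 16 * ((S *ᵥ ζ) k * (S *ᵥ dualVel S B e ζ ξ) k))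
  + ∑ i, (ζ i * dualVel S B e ζ ξ i
      + 16 * (dualVel S B e ζ ξ i
        * dualVel S B (S *ᵥ ζ) (dualVel S B e ζ ξ) (primalVel S B s e ζ ξ γ) i)
      + σ i * ((B *ᵥ x) i * (B *ᵥ filterVel s ξ x) i
        + 16 * ((B *ᵥ filterVel s ξ x) i
          * (B *ᵥ filterVel s (primalVel S B s e ζ ξ γ) (filterVel s ξ x)) i)))
  + ∑ j, ((1 - s j) / (1 + s j) * (ξ j * primalVel S B s e ζ ξ γ j)
      + 16 * ((1 - s j) / (1 + s j)) * (primalVel S B s e ζ ξ γ j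
          * (-linForce S B s (S *ᵥ ζ) (dualVel S B e ζ ξ) (primalVel S B s e ζ ξ γ) j / (1 - s j))
        - (1 - s j)⁻¹ * μ j * primalVel S B s e ζ ξ γ j ^ 2)
      + s j * ((1 - s j) / (1 + s j)) * (x j * filterVel s ξ x j
        + 16 * (filterVel s ξ x j
          * filterVel s (primalVel S B s e ζ ξ γ) (filterVel s ξ x) j))
      + s j * (16 / (1 + s j) ^ 2 * (γ j * primalVel S B s e ζ ξ γ j
            - (primalVel S B s e ζ ξ γ j * gradFilter S B s e ζ ξ x j
              + ξ j * ((γ j - gradFilter S B s e ζ ξ x j) / (1 + s j))))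
          + (16 / (1 + s j) ^ 2 - 1)
            * (p j * ((γ j - gradFilter S B s e ζ ξ x j) / (1 + s j)))))

/-- The energy identity is used for the state with `γ`, and for the velocities with `μ` times the
primal velocity in the place of `γ`, which is the worst case allowed by strong convexity. The filter
terms leave only negative squares, since `ξ = x + (1 + s) x'`. -/
theorem lyapRate_le (h : Intertwines B σ s) (hσ : ∀ i, 0 ≤ σ i)
    (hs : ∀ j, 0 ≤ s j) (hs1 : ∀ j, s j < 1) {μ : J → ℝ} (hμ : ∀ j, 0 ≤ μ j) (e : E → ℝ)
    (ζ : I → ℝ) (ξ γ x p : J → ℝ)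
    (hp : ∀ j, 0 ≤ (ξ j - p j) * (γ j - gradFilter S B s e ζ ξ x j)) :
    lyapRate S B σ s μ e ζ ξ γ x p
      ≤ -(∑ k, (S *ᵥ ζ) k ^ 2 + 16 * ∑ k, (S *ᵥ dualVel S B e ζ ξ) k ^ 2
        + ∑ j, ξ j * γ j + 8 * ∑ j, μ j * primalVel S B s e ζ ξ γ j ^ 2) := by
  have hid := energy_identity (S := S) h hs e ζ ξ γ x
  have hid' := energy_identity (S := S) h hs (S *ᵥ ζ) (dualVel S B e ζ ξ)
    (primalVel S B s e ζ ξ γ) (fun j => μ j * primalVel S B s e ζ ξ γ j) (filterVel s ξ x)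
  simp only [gradFilter_velocity h hs hs1] at hid'
  have hI : ∑ i, (ζ i * dualVel S B e ζ ξ i
      + 16 * (dualVel S B e ζ ξ i
        * dualVel S B (S *ᵥ ζ) (dualVel S B e ζ ξ) (primalVel S B s e ζ ξ γ) i)
      + σ i * ((B *ᵥ x) i * (B *ᵥ filterVel s ξ x) i
        + 16 * ((B *ᵥ filterVel s ξ x) i
          * (B *ᵥ filterVel s (primalVel S B s e ζ ξ γ) (filterVel s ξ x)) i)))
      ≤ ∑ i, (ζ i * dualVel S B e ζ ξ i
      + 16 * (dualVel S B e ζ ξ i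
        * dualVel S B (S *ᵥ ζ) (dualVel S B e ζ ξ) (primalVel S B s e ζ ξ γ) i)
      + σ i / (1 + σ i) * (B *ᵥ ξ) i * ((B *ᵥ ξ) i - (B *ᵥ x) i)
      + 16 * (σ i / (1 + σ i) * (B *ᵥ primalVel S B s e ζ ξ γ) i
        * ((B *ᵥ primalVel S B s e ζ ξ γ) i - (B *ᵥ filterVel s ξ x) i))) := by
    refine Finset.sum_le_sum fun i _ => ?_
    have h0 := hσ i
    have hc : 0 < 1 + σ i := by positivity
    have e1 : (B *ᵥ ξ) i = (B *ᵥ x) i + (1 + σ i) * (B *ᵥ filterVel s ξ x) i := by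
      rw [mulVec_filterVel h]; field_simp; ring
    have e2 : σ i / (1 + σ i) * (B *ᵥ ξ) i * ((B *ᵥ ξ) i - (B *ᵥ x) i)
        = σ i * ((B *ᵥ x) i + (1 + σ i) * (B *ᵥ filterVel s ξ x) i) * (B *ᵥ filterVel s ξ x) i := by
      rw [e1]; field_simp; ring
    rw [e2, mulVec_filterVel h (primalVel S B s e ζ ξ γ)]
    set a' := (B *ᵥ filterVel s ξ x) i
    set b := (B *ᵥ primalVel S B s e ζ ξ γ) i
    have g1 : 0 ≤ σ i * (1 + σ i) * a' ^ 2 := by positivity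
    have g2 : 0 ≤ σ i / (1 + σ i) * (b - a') ^ 2 := by positivity
    have e3 : σ i * (a' * ((b - a') / (1 + σ i))) = σ i / (1 + σ i) * (a' * (b - a')) := by
      field_simp
    nlinarith
  have hJ : ∑ j, ((1 - s j) / (1 + s j) * (ξ j * primalVel S B s e ζ ξ γ j)
      + 16 * ((1 - s j) / (1 + s j)) * (primalVel S B s e ζ ξ γ j
          * (-linForce S B s (S *ᵥ ζ) (dualVel S B e ζ ξ) (primalVel S B s e ζ ξ γ) j / (1 - s j))
        - (1 - s j)⁻¹ * μ j * primalVel S B s e ζ ξ γ j ^ 2)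
      + s j * ((1 - s j) / (1 + s j)) * (x j * filterVel s ξ x j
        + 16 * (filterVel s ξ x j
          * filterVel s (primalVel S B s e ζ ξ γ) (filterVel s ξ x) j))
      + s j * (16 / (1 + s j) ^ 2 * (γ j * primalVel S B s e ζ ξ γ j
            - (primalVel S B s e ζ ξ γ j * gradFilter S B s e ζ ξ x j
              + ξ j * ((γ j - gradFilter S B s e ζ ξ x j) / (1 + s j))))
          + (16 / (1 + s j) ^ 2 - 1)
            * (p j * ((γ j - gradFilter S B s e ζ ξ x j) / (1 + s j)))))
      ≤ ∑ j, (-(ξ j * (γ j + linForce S B s e ζ ξ j) / (1 + s j))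
        + (ξ j * (γ j + s j * gradFilter S B s e ζ ξ x j) / (1 + s j)
            + s j * ((1 - s j) / (1 + s j)) * ξ j * filterVel s ξ x j)
        - 16 * (primalVel S B s e ζ ξ γ j * (μ j * primalVel S B s e ζ ξ γ j
          + linForce S B s (S *ᵥ ζ) (dualVel S B e ζ ξ) (primalVel S B s e ζ ξ γ) j) / (1 + s j))
        + 16 * (primalVel S B s e ζ ξ γ j * (μ j * primalVel S B s e ζ ξ γ j
          + s j * ((γ j - gradFilter S B s e ζ ξ x j) / (1 + s j))) / (1 + s j)
            + s j * ((1 - s j) / (1 + s j)) * primalVel S B s e ζ ξ γ j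
              * filterVel s (primalVel S B s e ζ ξ γ) (filterVel s ξ x) j)
        - ξ j * γ j - 8 * (μ j * primalVel S B s e ζ ξ γ j ^ 2)) := by
    refine Finset.sum_le_sum fun j _ => ?_
    have h0 := hs j
    have h1 := hs1 j
    have hc : 0 < 1 + s j := by positivity
    have hd : 0 < 1 - s j := by linarith
    set r := (1 - s j) / (1 + s j) with hr
    have hr0 : 0 ≤ r := by positivity
    set T := 16 / (1 + s j) ^ 2 with hT
    have hT1 : 1 ≤ T := by rw [hT, le_div_iff₀ (by positivity)]; nlinarith
    have e1 : r * (ξ j * primalVel S B s e ζ ξ γ j)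
        = -(ξ j * (γ j + linForce S B s e ζ ξ j) / (1 + s j)) := by
      rw [hr, primalVel]; field_simp
    set u := primalVel S B s e ζ ξ γ j
    set l := linForce S B s (S *ᵥ ζ) (dualVel S B e ζ ξ) (primalVel S B s e ζ ξ γ) j
    have e2 : 16 * r * (u * (-l / (1 - s j)) - (1 - s j)⁻¹ * μ j * u ^ 2)
        = - 16 * (u * (μ j * u + l) / (1 + s j)) := by
      rw [hr]; field_simp; ring
    have ex : ξ j = x j + (1 + s j) * filterVel s ξ x j := by
      rw [filterVel]; field_simp; ring
    have eu : u = filterVel s ξ x j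
        + (1 + s j) * filterVel s (primalVel S B s e ζ ξ γ) (filterVel s ξ x) j := by
      simp only [u]
      generalize primalVel S B s e ζ ξ γ = v
      generalize filterVel s ξ x = w
      rw [filterVel]; field_simp; ring
    set x' := filterVel s ξ x j
    set x'' := filterVel s (primalVel S B s e ζ ξ γ) (filterVel s ξ x) j
    set y := gradFilter S B s e ζ ξ x j
    have e3 : s j * r * (x j * x' + 16 * (x' * x'')) = s j * r * ξ j * x' + 16 * (s j * r * u * x'')
        - (1 + s j) * (s j * r * x' ^ 2) - 16 * ((1 + s j) * (s j * r * x'' ^ 2)) := by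
      rw [ex, eu]; ring
    -- With `y' = (γ - y) / (1 + s)`, the rate of `T (φ + ψ - ξ y) - ψ` is `T (γ - y) u - (T - 1) (ξ
    -- - p) y' - ξ y'`. As `T (1 + s)² = 16`, the first term cancels the product `16 u y'` of the
    -- velocity balance; the last turns `ξ (γ + s y) / (1 + s)` into `ξ γ`; the middle one has a
    -- sign by `hp`.
    have e4 : s j * (T * (γ j * u - (u * y + ξ j * ((γ j - y) / (1 + s j))))
          + (T - 1) * (p j * ((γ j - y) / (1 + s j))))
        = 16 * (u * (μ j * u + s j * ((γ j - y) / (1 + s j))) / (1 + s j))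
          - 16 / (1 + s j) * (μ j * u ^ 2)
          + (ξ j * (γ j + s j * y) / (1 + s j) - ξ j * γ j)
          - s j * (T - 1) / (1 + s j) * ((ξ j - p j) * (γ j - y)) := by
      rw [hT]; field_simp; ring
    have g1 : 0 ≤ (1 + s j) * (s j * r * x' ^ 2) := by positivity
    have g2 : 0 ≤ (1 + s j) * (s j * r * x'' ^ 2) := by positivity
    have g3 : 0 ≤ s j * (T - 1) / (1 + s j) * ((ξ j - p j) * (γ j - y)) :=
      mul_nonneg (div_nonneg (mul_nonneg h0 (sub_nonneg.2 hT1)) hc.le) (hp j)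
    have g4 : 8 * (μ j * u ^ 2) ≤ 16 / (1 + s j) * (μ j * u ^ 2) := by
      have := hμ j
      gcongr
      rw [le_div_iff₀ hc]; linarith
    rw [e1, e2, e3, e4]
    linarith
  unfold lyapRate
  simp only [Finset.sum_add_distrib, Finset.sum_sub_distrib, ← Finset.mul_sum,
    Finset.sum_neg_distrib] at hI hJ hid hid' ⊢
  linarith

end Energy

/-! ### Bounds by quadratic forms -/

/-- `f` is bounded by a constant multiple of `X`. -/
def QuadBdd {Ω : Type*} (X f : Ω → ℝ) : Prop := ∃ C, 0 ≤ C ∧ ∀ ω, f ω ≤ C * X ω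

/-- The square of the Euclidean length of `v` is bounded by a constant multiple of `X`. -/
def SqBdd {Ω ι : Type*} [Fintype ι] (X : Ω → ℝ) (v : Ω → ι → ℝ) : Prop :=
  QuadBdd X fun ω => ∑ i, v ω i ^ 2

namespace QuadBdd

variable {Ω : Type*} {X f g : Ω → ℝ}

theorem mono (hg : QuadBdd X g) (h : ∀ ω, f ω ≤ g ω) : QuadBdd X f := by
  obtain ⟨C, hC, hb⟩ := hg
  exact ⟨C, hC, fun ω => (h ω).trans (hb ω)⟩

theorem add (hf : QuadBdd X f) (hg : QuadBdd X g) : QuadBdd X fun ω => f ω + g ω := by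
  obtain ⟨C, hC, hb⟩ := hf
  obtain ⟨D, hD, hd⟩ := hg
  exact ⟨C + D, add_nonneg hC hD, fun ω => by rw [add_mul]; exact add_le_add (hb ω) (hd ω)⟩

theorem const_mul (hf : QuadBdd X f) {c : ℝ} (hc : 0 ≤ c) : QuadBdd X fun ω => c * f ω := by
  obtain ⟨C, hC, hb⟩ := hf
  exact ⟨c * C, mul_nonneg hc hC, fun ω => by
    rw [mul_assoc]; exact mul_le_mul_of_nonneg_left (hb ω) hc⟩

theorem sum {ι : Type*} {u : Finset ι} {f : ι → Ω → ℝ} (h : ∀ i ∈ u, QuadBdd X (f i)) : QuadBdd X fun ω => ∑ i ∈ u, f i ω := by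
  classical
  induction u using Finset.induction_on with
  | empty => exact ⟨0, le_rfl, fun ω => by simp⟩
  | insert i u hi ih =>
    simp only [Finset.sum_insert hi]
    exact (h i (Finset.mem_insert_self i u)).add
      (ih fun j hj => h j (Finset.mem_insert_of_mem hj))

end QuadBdd

namespace SqBdd

open Matrix

variable {Ω ι κ : Type*} [Fintype ι] [Fintype κ] {X : Ω → ℝ} {v w : Ω → ι → ℝ}

theorem coord (h : SqBdd X v) (i : ι) : QuadBdd X fun ω => v ω i ^ 2 :=
  QuadBdd.mono h fun ω => Finset.single_le_sum (f := fun i => v ω i ^ 2)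
    (fun _ _ => sq_nonneg _) (Finset.mem_univ i)

theorem mono_weight (hv : SqBdd X v) {c : ι → ℝ}
    (h : ∀ ω i, w ω i ^ 2 ≤ c i ^ 2 * v ω i ^ 2) : SqBdd X w := by
  refine QuadBdd.mono (QuadBdd.const_mul hv (Finset.sum_nonneg fun i (_ : i ∈ Finset.univ) =>
    sq_nonneg (c i))) fun ω => ?_
  rw [Finset.mul_sum]
  refine Finset.sum_le_sum fun i _ => (h ω i).trans ?_
  gcongr
  exact Finset.single_le_sum (f := fun i => c i ^ 2) (fun _ _ => sq_nonneg _) (Finset.mem_univ i)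

theorem weight (hv : SqBdd X v) (c : ι → ℝ) : SqBdd X fun ω i => c i * v ω i :=
  hv.mono_weight (c := c) fun ω i => by rw [mul_pow]

theorem add (hv : SqBdd X v) (hw : SqBdd X w) : SqBdd X fun ω => v ω + w ω := by
  refine QuadBdd.mono ((QuadBdd.add hv hw).const_mul zero_le_two) fun ω => ?_
  rw [← Finset.sum_add_distrib, Finset.mul_sum]
  refine Finset.sum_le_sum fun i _ => ?_
  simp only [Pi.add_apply]
  nlinarith [sq_nonneg (v ω i - w ω i)]

theorem neg (hv : SqBdd X v) : SqBdd X fun ω => -v ω := by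
  simpa [SqBdd] using hv

theorem sub (hv : SqBdd X v) (hw : SqBdd X w) : SqBdd X fun ω => v ω - w ω := by
  simpa [sub_eq_add_neg] using hv.add hw.neg

theorem mulVec (hv : SqBdd X v) (M : Matrix κ ι ℝ) : SqBdd X fun ω => M *ᵥ v ω := by
  refine QuadBdd.mono (QuadBdd.const_mul hv (Finset.sum_nonneg fun k (_ : k ∈ Finset.univ) =>
    Finset.sum_nonneg fun i (_ : i ∈ Finset.univ) => sq_nonneg (M k i))) fun ω => ?_
  rw [Finset.sum_mul]
  exact Finset.sum_le_sum fun k _ => Finset.sum_mul_sq_le_sq_mul_sq _ _ _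

end SqBdd

/-! ### Constants for the Lyapunov function -/

section Constants

open Matrix

variable {E I J : Type*} [Fintype E] [Fintype I] [Fintype J]

/-- A state of the error dynamics, together with values of the gradients, of the costs and of their
conjugates that satisfy the inequalities of strongly convex smooth functions. -/
structure FlowState (S : Matrix E I ℝ) (B : Matrix I J ℝ) (N : Matrix E E ℝ) (s μ : J → ℝ)
    (K : J → ℝ≥0) where
  e : E → ℝ
  ζ : I → ℝ
  ξ : J → ℝ
  γ : J → ℝ
  x : J → ℝ
  φ : J → ℝ
  ψ : J → ℝ
  p : J → ℝ
  mulVec_e : N *ᵥ (S *ᵥ (Sᵀ *ᵥ e)) = e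
  sq_grad_le : ∀ j, γ j ^ 2 ≤ (K j : ℝ) ^ 2 * ξ j ^ 2
  mul_sq_le : ∀ j, μ j * ξ j ^ 2 ≤ ξ j * γ j
  cost_nonneg : ∀ j, 0 ≤ φ j
  cost_le : ∀ j, φ j ≤ ξ j * γ j
  conj_nonneg : ∀ j, 0 ≤ ψ j
  conj_le : ∀ j, ψ j ≤ gradFilter S B s e ζ ξ x j ^ 2 / μ j
  fenchel_young : ∀ j, ξ j * gradFilter S B s e ζ ξ x j ≤ φ j + ψ j
  monotone : ∀ j, 0 ≤ (ξ j - p j) * (γ j - gradFilter S B s e ζ ξ x j)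

namespace FlowState

variable {S : Matrix E I ℝ} {B : Matrix I J ℝ} {N : Matrix E E ℝ} {σ : I → ℝ} {s μ : J → ℝ}
  {K : J → ℝ≥0}

/-- The squared length of the state of the error dynamics. -/
def sqLength (z : FlowState S B N s μ K) : ℝ :=
  ∑ k, z.e k ^ 2 + ∑ i, z.ζ i ^ 2 + ∑ j, z.ξ j ^ 2

/-- The squared length of the state of the error dynamics with the filter. -/
def fullSqLength (z : FlowState S B N s μ K) : ℝ := z.sqLength + ∑ j, z.x j ^ 2

/-- The velocity of the dual error. -/
def dv (z : FlowState S B N s μ K) : I → ℝ := dualVel S B z.e z.ζ z.ξ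

/-- The velocity of the primal error. -/
noncomputable def pv (z : FlowState S B N s μ K) : J → ℝ := primalVel S B s z.e z.ζ z.ξ z.γ

/-- The dissipation that the Lyapunov function controls. -/
noncomputable def baseDissipation (z : FlowState S B N s μ K) : ℝ :=
  ∑ k, (S *ᵥ z.ζ) k ^ 2 + ∑ k, (S *ᵥ z.dv) k ^ 2 + ∑ j, z.ξ j ^ 2 + ∑ j, z.pv j ^ 2

/-- The dissipation that the augmented Lyapunov function controls. -/
noncomputable def dissipation (z : FlowState S B N s μ K) : ℝ :=
  z.baseDissipation + ∑ j, (Bᵀ *ᵥ z.ζ) j ^ 2 + ∑ j, z.x j ^ 2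

/-- The terms added to the Lyapunov function. -/
noncomputable def extra (z : FlowState S B N s μ K) : ℝ :=
  ∑ j, s j * (Bᵀ *ᵥ z.ζ) j ^ 2 + ∑ j, z.x j ^ 2

/-- The derivative of the terms added to the Lyapunov function. -/
noncomputable def extraRate (z : FlowState S B N s μ K) : ℝ :=
  ∑ j, s j * (2 * ((Bᵀ *ᵥ z.ζ) j * (Bᵀ *ᵥ z.dv) j))
    + ∑ j, 2 * (z.x j * filterVel s z.ξ z.x j)

section

variable {X : FlowState S B N s μ K → ℝ}

theorem sqBdd_grad (hξ : SqBdd X fun z => z.ξ) : SqBdd X fun z => z.γ :=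
  hξ.mono_weight (c := fun j => (K j : ℝ)) fun z j => z.sq_grad_le j

theorem sqBdd_dv (he : SqBdd X fun z => z.e) (hζ : SqBdd X fun z => z.ζ)
    (hξ : SqBdd X fun z => z.ξ) : SqBdd X fun z => z.dv :=
  ((hξ.mulVec B).sub ((hζ.mulVec S).mulVec Sᵀ)).sub (he.mulVec Sᵀ)

theorem sqBdd_pv (he : SqBdd X fun z => z.e) (hζ : SqBdd X fun z => z.ζ)
    (hξ : SqBdd X fun z => z.ξ) : SqBdd X fun z => z.pv := by
  have := ((sqBdd_grad hξ).add ((hζ.mulVec Bᵀ).add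
    ((((hξ.mulVec B).sub (he.mulVec Sᵀ)).mulVec Bᵀ).weight s))).weight fun j => -(1 - s j)⁻¹
  convert this using 3 with z j
  simp only [pv, primalVel, linForce, Pi.add_apply, div_eq_inv_mul]
  ring

theorem sqBdd_filterVel (hξ : SqBdd X fun z => z.ξ) (hx : SqBdd X fun z => z.x) :
    SqBdd X fun z => filterVel s z.ξ z.x := by
  convert (hξ.sub hx).weight fun j => (1 + s j)⁻¹ using 3 with z j
  simp only [filterVel, Pi.sub_apply, div_eq_inv_mul]

theorem sqBdd_gradFilter (he : SqBdd X fun z => z.e) (hζ : SqBdd X fun z => z.ζ)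
    (hξ : SqBdd X fun z => z.ξ) (hx : SqBdd X fun z => z.x) :
    SqBdd X fun z => gradFilter S B s z.e z.ζ z.ξ z.x :=
  ((((hx.mulVec B).sub (he.mulVec Sᵀ)).sub hζ).mulVec Bᵀ).add
    ((hx.sub hξ).weight fun j => (1 - s j) / (1 + s j))

end

theorem sqLength_nonneg (z : FlowState S B N s μ K) : 0 ≤ z.sqLength := by
  unfold sqLength; positivity

theorem fullSqLength_nonneg (z : FlowState S B N s μ K) : 0 ≤ z.fullSqLength :=
  add_nonneg z.sqLength_nonneg (Finset.sum_nonneg fun _ _ => sq_nonneg _)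

theorem sqBdd_fullSqLength_e : SqBdd fullSqLength fun z : FlowState S B N s μ K => z.e :=
  ⟨1, zero_le_one, fun z => by
    unfold fullSqLength sqLength
    linarith [Finset.sum_nonneg fun i (_ : i ∈ Finset.univ) => sq_nonneg (z.ζ i),
      Finset.sum_nonneg fun j (_ : j ∈ Finset.univ) => sq_nonneg (z.ξ j),
      Finset.sum_nonneg fun j (_ : j ∈ Finset.univ) => sq_nonneg (z.x j)]⟩

theorem sqBdd_fullSqLength_ζ : SqBdd fullSqLength fun z : FlowState S B N s μ K => z.ζ :=
  ⟨1, zero_le_one, fun z => by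
    unfold fullSqLength sqLength
    linarith [Finset.sum_nonneg fun k (_ : k ∈ Finset.univ) => sq_nonneg (z.e k),
      Finset.sum_nonneg fun j (_ : j ∈ Finset.univ) => sq_nonneg (z.ξ j),
      Finset.sum_nonneg fun j (_ : j ∈ Finset.univ) => sq_nonneg (z.x j)]⟩

theorem sqBdd_fullSqLength_ξ : SqBdd fullSqLength fun z : FlowState S B N s μ K => z.ξ :=
  ⟨1, zero_le_one, fun z => by
    unfold fullSqLength sqLength
    linarith [Finset.sum_nonneg fun k (_ : k ∈ Finset.univ) => sq_nonneg (z.e k),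
      Finset.sum_nonneg fun i (_ : i ∈ Finset.univ) => sq_nonneg (z.ζ i),
      Finset.sum_nonneg fun j (_ : j ∈ Finset.univ) => sq_nonneg (z.x j)]⟩

theorem sqBdd_fullSqLength_x : SqBdd fullSqLength fun z : FlowState S B N s μ K => z.x :=
  ⟨1, zero_le_one, fun z => by
    unfold fullSqLength sqLength
    linarith [Finset.sum_nonneg fun k (_ : k ∈ Finset.univ) => sq_nonneg (z.e k),
      Finset.sum_nonneg fun i (_ : i ∈ Finset.univ) => sq_nonneg (z.ζ i),
      Finset.sum_nonneg fun j (_ : j ∈ Finset.univ) => sq_nonneg (z.ξ j)]⟩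

/-- All entries are linear in the state except `γ`, `φ`, `ψ`, and these are controlled by the
Lipschitz bound, by `φ ≤ ξ γ` and by `ψ ≤ y² / μ`. -/
theorem quadBdd_lyap (hσ : ∀ i, 0 ≤ σ i) (hs : ∀ j, 0 ≤ s j) (hs1 : ∀ j, s j < 1)
    (hμ : ∀ j, 0 < μ j) :
    QuadBdd fullSqLength fun z : FlowState S B N s μ K =>
      lyap S B σ s z.e z.ζ z.ξ z.γ z.x z.φ z.ψ := by
  have he := sqBdd_fullSqLength_e (S := S) (B := B) (N := N) (s := s) (μ := μ) (K := K)
  have hζ := sqBdd_fullSqLength_ζ (S := S) (B := B) (N := N) (s := s) (μ := μ) (K := K)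
  have hξ := sqBdd_fullSqLength_ξ (S := S) (B := B) (N := N) (s := s) (μ := μ) (K := K)
  have hx := sqBdd_fullSqLength_x (S := S) (B := B) (N := N) (s := s) (μ := μ) (K := K)
  have hSζ := hζ.mulVec S
  have hdv := sqBdd_dv he hζ hξ
  have hpv := sqBdd_pv he hζ hξ
  have hγ := sqBdd_grad hξ
  have hx' := sqBdd_filterVel hξ hx
  have hy := sqBdd_gradFilter he hζ hξ hx
  refine ((QuadBdd.sum (fun k _ => ?_)).add (QuadBdd.sum (fun i _ => ?_))).add
    (QuadBdd.sum (fun j _ => ?_))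
  · exact QuadBdd.mono (((he.coord k).const_mul (by norm_num : (0 : ℝ) ≤ 1 / 2)).add
      ((hSζ.coord k).const_mul (by norm_num : (0 : ℝ) ≤ 8))) fun z => le_of_eq (by ring)
  · exact QuadBdd.mono ((((hζ.coord i).const_mul (by norm_num : (0 : ℝ) ≤ 1 / 2)).add
      ((hdv.coord i).const_mul (by norm_num : (0 : ℝ) ≤ 8))).add
      (((((hx.mulVec B).coord i).const_mul (by norm_num : (0 : ℝ) ≤ 1 / 2)).add
        (((hx'.mulVec B).coord i).const_mul (by norm_num : (0 : ℝ) ≤ 8))).const_mul (hσ i)))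
      fun z => le_of_eq (by simp only [dv]; ring)
  · have h0 := hs j
    have h1 := hs1 j
    have hd : 0 < 1 - s j := by linarith
    have hc : 0 < 1 + s j := by linarith
    have hr0 : 0 ≤ (1 - s j) / (1 + s j) := by positivity
    have hT0 : 0 ≤ 16 / (1 + s j) ^ 2 := by positivity
    have hψ : QuadBdd fullSqLength fun z : FlowState S B N s μ K => z.ψ j :=
      QuadBdd.mono ((hy.coord j).const_mul (inv_nonneg.2 (hμ j).le)) fun z =>
        (z.conj_le j).trans (le_of_eq (by rw [div_eq_inv_mul]))
    have hφ : QuadBdd fullSqLength fun z : FlowState S B N s μ K => z.φ j :=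
      QuadBdd.mono ((hξ.coord j).add (hγ.coord j)) fun z =>
        (z.cost_le j).trans (by nlinarith [sq_nonneg (z.ξ j - z.γ j), sq_nonneg (z.ξ j + z.γ j)])
    have hξy : QuadBdd fullSqLength fun z : FlowState S B N s μ K =>
        -(z.ξ j * gradFilter S B s z.e z.ζ z.ξ z.x j) :=
      QuadBdd.mono ((hξ.coord j).add (hy.coord j)) fun z => by
        nlinarith [sq_nonneg (z.ξ j - gradFilter S B s z.e z.ζ z.ξ z.x j),
          sq_nonneg (z.ξ j + gradFilter S B s z.e z.ζ z.ξ z.x j)]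
    have hT1 : 0 ≤ 16 / (1 + s j) ^ 2 - 1 := by
      rw [sub_nonneg, le_div_iff₀ (by positivity)]; nlinarith
    exact QuadBdd.mono (((((hξ.coord j).const_mul (by positivity : 0 ≤ (1 - s j) / (1 + s j) / 2)).add
      ((hpv.coord j).const_mul (by positivity : 0 ≤ 8 * ((1 - s j) / (1 + s j))))).add
      ((((hx.coord j).const_mul (by norm_num : (0 : ℝ) ≤ 1 / 2)).add
        ((hx'.coord j).const_mul (by norm_num : (0 : ℝ) ≤ 8))).const_mul (mul_nonneg h0 hr0))).add
      (((((hφ.add hξy).const_mul hT0)).add (hψ.const_mul hT1)).const_mul h0))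
      fun z => le_of_eq (by simp only [pv]; ring)

theorem quadBdd_extra : QuadBdd fullSqLength (extra : FlowState S B N s μ K → ℝ) := by
  have hζ := sqBdd_fullSqLength_ζ (S := S) (B := B) (N := N) (s := s) (μ := μ) (K := K)
  have hx := sqBdd_fullSqLength_x (S := S) (B := B) (N := N) (s := s) (μ := μ) (K := K)
  refine QuadBdd.add (QuadBdd.sum (fun j _ => ?_)) hx
  exact QuadBdd.mono (((hζ.mulVec Bᵀ).coord j).const_mul (abs_nonneg (s j))) fun z =>
    mul_le_mul_of_nonneg_right (le_abs_self _) (sq_nonneg _)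

/-- The rate of the Lyapunov function. -/
noncomputable def rate (σ : I → ℝ) (z : FlowState S B N s μ K) : ℝ :=
  lyapRate S B σ s μ z.e z.ζ z.ξ z.γ z.x z.p

/-- The value of the Lyapunov function. -/
noncomputable def value (σ : I → ℝ) (z : FlowState S B N s μ K) : ℝ :=
  lyap S B σ s z.e z.ζ z.ξ z.γ z.x z.φ z.ψ

/-- A left inverse of `ζ ↦ (Sζ, Bᵀζ)` recovers `ζ`. Then `SSᵀe = SBξ - SSᵀSζ - Sζ'`, with `ζ'` the
dual velocity, is controlled, and `N` recovers `e` from it. -/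
theorem quadBdd_dissipation (hinj : ∀ ζ, S *ᵥ ζ = 0 → Bᵀ *ᵥ ζ = 0 → ζ = 0) :
    QuadBdd dissipation (fullSqLength : FlowState S B N s μ K → ℝ) := by
  classical
  have hb : ∀ z : FlowState S B N s μ K, ∑ k, (S *ᵥ z.ζ) k ^ 2 ≤ z.dissipation
      ∧ ∑ k, (S *ᵥ z.dv) k ^ 2 ≤ z.dissipation ∧ ∑ j, z.ξ j ^ 2 ≤ z.dissipation
      ∧ ∑ j, (Bᵀ *ᵥ z.ζ) j ^ 2 ≤ z.dissipation ∧ ∑ j, z.x j ^ 2 ≤ z.dissipation := by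
    intro z
    have h1 : 0 ≤ ∑ k, (S *ᵥ z.ζ) k ^ 2 := Finset.sum_nonneg fun _ _ => sq_nonneg _
    have h2 : 0 ≤ ∑ k, (S *ᵥ z.dv) k ^ 2 := Finset.sum_nonneg fun _ _ => sq_nonneg _
    have h3 : 0 ≤ ∑ j, z.ξ j ^ 2 := Finset.sum_nonneg fun _ _ => sq_nonneg _
    have h4 : 0 ≤ ∑ j, z.pv j ^ 2 := Finset.sum_nonneg fun _ _ => sq_nonneg _
    have h5 : 0 ≤ ∑ j, (Bᵀ *ᵥ z.ζ) j ^ 2 := Finset.sum_nonneg fun _ _ => sq_nonneg _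
    have h6 : 0 ≤ ∑ j, z.x j ^ 2 := Finset.sum_nonneg fun _ _ => sq_nonneg _
    unfold dissipation baseDissipation
    refine ⟨?_, ?_, ?_, ?_, ?_⟩ <;> linarith
  have hSζ : SqBdd dissipation fun z : FlowState S B N s μ K => S *ᵥ z.ζ :=
    ⟨1, zero_le_one, fun z => by rw [one_mul]; exact (hb z).1⟩
  have hSv : SqBdd dissipation fun z : FlowState S B N s μ K => S *ᵥ z.dv :=
    ⟨1, zero_le_one, fun z => by rw [one_mul]; exact (hb z).2.1⟩
  have hξ : SqBdd dissipation fun z : FlowState S B N s μ K => z.ξ :=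
    ⟨1, zero_le_one, fun z => by rw [one_mul]; exact (hb z).2.2.1⟩
  have hBζ : SqBdd dissipation fun z : FlowState S B N s μ K => Bᵀ *ᵥ z.ζ :=
    ⟨1, zero_le_one, fun z => by rw [one_mul]; exact (hb z).2.2.2.1⟩
  have hx : SqBdd dissipation fun z : FlowState S B N s μ K => z.x :=
    ⟨1, zero_le_one, fun z => by rw [one_mul]; exact (hb z).2.2.2.2⟩
  have hζ : SqBdd dissipation fun z : FlowState S B N s μ K => z.ζ := by
    let f : (I → ℝ) →ₗ[ℝ] (E → ℝ) × (J → ℝ) := S.mulVecLin.prod Bᵀ.mulVecLin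
    have hf : LinearMap.ker f = ⊥ := by
      refine LinearMap.ker_eq_bot'.2 fun ζ hζ => hinj ζ ?_ ?_
      · exact congrArg Prod.fst hζ
      · exact congrArg Prod.snd hζ
    obtain ⟨g, hg⟩ := f.exists_leftInverse_of_injective hf
    have key : ∀ ζ, ζ = (LinearMap.toMatrix' (g ∘ₗ LinearMap.inl ℝ _ _)) *ᵥ (S *ᵥ ζ)
        + (LinearMap.toMatrix' (g ∘ₗ LinearMap.inr ℝ _ _)) *ᵥ (Bᵀ *ᵥ ζ) := by
      intro ζ
      rw [LinearMap.toMatrix'_mulVec, LinearMap.toMatrix'_mulVec]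
      have h1 := LinearMap.congr_fun hg ζ
      simp only [LinearMap.comp_apply, LinearMap.id_apply, LinearMap.inl_apply,
        LinearMap.inr_apply] at h1 ⊢
      rw [← map_add]
      simpa [f, mulVec_transpose] using h1.symm
    have := (hSζ.mulVec (LinearMap.toMatrix' (g ∘ₗ LinearMap.inl ℝ _ _))).add
      (hBζ.mulVec (LinearMap.toMatrix' (g ∘ₗ LinearMap.inr ℝ _ _)))
    simpa only [← key] using this
  have he : SqBdd dissipation fun z : FlowState S B N s μ K => z.e := by
    have := ((((hξ.mulVec B).mulVec S).sub ((hSζ.mulVec Sᵀ).mulVec S)).sub hSv).mulVec N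
    have key : ∀ z : FlowState S B N s μ K,
        N *ᵥ (S *ᵥ (B *ᵥ z.ξ) - S *ᵥ (Sᵀ *ᵥ (S *ᵥ z.ζ)) - S *ᵥ z.dv) = z.e := by
      intro z
      conv_rhs => rw [← z.mulVec_e]
      congr 1
      simp only [dv, dualVel, mulVec_sub]
      abel
    simpa only [key] using this
  exact ((QuadBdd.add he hζ).add hξ).add hx

/-- By the primal equation, `Bᵀζ + s Bᵀζ' = -(1 - s) ξ' - γ - s BᵀSᵀSζ`, where everything on the
right is dissipated. The inequality `2 s a b ≤ (a + s b)² - a²` therefore produces `-|Bᵀζ|²`, also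
where `s = 0`. -/
theorem extraRate_le (hs : ∀ j, 0 ≤ s j) (hs1 : ∀ j, s j < 1) :
    ∃ C, 0 ≤ C ∧ ∀ z : FlowState S B N s μ K,
      z.extraRate ≤ C * z.baseDissipation - ∑ j, (Bᵀ *ᵥ z.ζ) j ^ 2 - (∑ j, z.x j ^ 2) / 2 := by
  have hb : ∀ z : FlowState S B N s μ K, ∑ k, (S *ᵥ z.ζ) k ^ 2 ≤ z.baseDissipation
      ∧ ∑ j, z.ξ j ^ 2 ≤ z.baseDissipation ∧ ∑ j, z.pv j ^ 2 ≤ z.baseDissipation := by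
    intro z
    have h1 : 0 ≤ ∑ k, (S *ᵥ z.ζ) k ^ 2 := Finset.sum_nonneg fun _ _ => sq_nonneg _
    have h2 : 0 ≤ ∑ k, (S *ᵥ z.dv) k ^ 2 := Finset.sum_nonneg fun _ _ => sq_nonneg _
    have h3 : 0 ≤ ∑ j, z.ξ j ^ 2 := Finset.sum_nonneg fun _ _ => sq_nonneg _
    have h4 : 0 ≤ ∑ j, z.pv j ^ 2 := Finset.sum_nonneg fun _ _ => sq_nonneg _
    unfold baseDissipation
    refine ⟨?_, ?_, ?_⟩ <;> linarith
  have hSζ : SqBdd baseDissipation fun z : FlowState S B N s μ K => S *ᵥ z.ζ :=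
    ⟨1, zero_le_one, fun z => by rw [one_mul]; exact (hb z).1⟩
  have hξ : SqBdd baseDissipation fun z : FlowState S B N s μ K => z.ξ :=
    ⟨1, zero_le_one, fun z => by rw [one_mul]; exact (hb z).2.1⟩
  have hpv : SqBdd baseDissipation fun z : FlowState S B N s μ K => z.pv :=
    ⟨1, zero_le_one, fun z => by rw [one_mul]; exact (hb z).2.2⟩
  have hw : SqBdd baseDissipation fun z : FlowState S B N s μ K =>
      fun j => (Bᵀ *ᵥ z.ζ) j + s j * (Bᵀ *ᵥ z.dv) j := by
    have := ((hpv.weight fun j => -(1 - s j)).sub (sqBdd_grad hξ)).sub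
      (((hSζ.mulVec Sᵀ).mulVec Bᵀ).weight s)
    convert this using 3 with z j
    have hd : 1 - s j ≠ 0 := (sub_pos.2 (hs1 j)).ne'
    simp only [dv, dualVel, pv, primalVel, linForce, mulVec_sub, Pi.sub_apply]
    field_simp
    ring
  obtain ⟨C, hC, hCb⟩ := QuadBdd.add hw hξ
  refine ⟨C, hC, fun z => ?_⟩
  have h1 : ∑ j, s j * (2 * ((Bᵀ *ᵥ z.ζ) j * (Bᵀ *ᵥ z.dv) j))
      ≤ ∑ j, (((Bᵀ *ᵥ z.ζ) j + s j * (Bᵀ *ᵥ z.dv) j) ^ 2 - (Bᵀ *ᵥ z.ζ) j ^ 2) :=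
    Finset.sum_le_sum fun j _ => by nlinarith [sq_nonneg (s j * (Bᵀ *ᵥ z.dv) j)]
  have h2 : ∑ j, 2 * (z.x j * filterVel s z.ξ z.x j) ≤ ∑ j, (z.ξ j ^ 2 - z.x j ^ 2 / 2) := by
    refine Finset.sum_le_sum fun j _ => ?_
    have h0 := hs j
    have h1 := hs1 j
    rw [filterVel, ← mul_div_assoc, ← mul_div_assoc, div_le_iff₀ (by linarith)]
    nlinarith [sq_nonneg (z.ξ j - z.x j), mul_nonneg h0 (sq_nonneg (z.ξ j)),
      mul_nonneg (sub_nonneg.2 h1.le) (sq_nonneg (z.x j))]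
  rw [Finset.sum_sub_distrib] at h1 h2
  rw [← Finset.sum_div] at h2
  have := hCb z
  unfold extraRate
  linarith

theorem rate_le (h : Intertwines B σ s) (hσ : ∀ i, 0 ≤ σ i) (hs : ∀ j, 0 ≤ s j)
    (hs1 : ∀ j, s j < 1) (hμ : ∀ j, 0 < μ j) :
    ∃ c, 0 < c ∧ ∀ z : FlowState S B N s μ K, z.rate σ ≤ -(c * z.baseDissipation) := by
  -- `(M + 1)⁻¹` is a common positive lower bound of `1` and all `μ j`, obtained without a minimum
  -- over a possibly empty index set.
  set M := ∑ j, (μ j)⁻¹ with hM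
  have hM0 : 0 ≤ M := Finset.sum_nonneg fun j _ => (inv_pos.2 (hμ j)).le
  have hm : ∀ j, (M + 1)⁻¹ ≤ μ j := fun j => by
    have : (μ j)⁻¹ ≤ M := Finset.single_le_sum (f := fun j => (μ j)⁻¹)
      (fun j _ => (inv_pos.2 (hμ j)).le) (Finset.mem_univ j)
    exact inv_le_of_inv_le₀ (hμ j) (by linarith)
  have hm0 : 0 < (M + 1)⁻¹ := by positivity
  have hm1 : (M + 1)⁻¹ ≤ 1 := inv_le_one_of_one_le₀ (by linarith)
  refine ⟨(M + 1)⁻¹, hm0, fun z => ?_⟩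
  refine (lyapRate_le h hσ hs hs1 (fun j => (hμ j).le) z.e z.ζ z.ξ z.γ z.x z.p
    z.monotone).trans (neg_le_neg ?_)
  have h1 : (M + 1)⁻¹ * ∑ j, z.ξ j ^ 2 ≤ ∑ j, z.ξ j * z.γ j := by
    rw [Finset.mul_sum]
    exact Finset.sum_le_sum fun j _ =>
      (mul_le_mul_of_nonneg_right (hm j) (sq_nonneg _)).trans (z.mul_sq_le j)
  have h2 : (M + 1)⁻¹ * ∑ j, z.pv j ^ 2 ≤ ∑ j, μ j * z.pv j ^ 2 := by
    rw [Finset.mul_sum]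
    exact Finset.sum_le_sum fun j _ => mul_le_mul_of_nonneg_right (hm j) (sq_nonneg _)
  have h3 : 0 ≤ ∑ k, (S *ᵥ z.ζ) k ^ 2 := Finset.sum_nonneg fun _ _ => sq_nonneg _
  have h4 : 0 ≤ ∑ k, (S *ᵥ z.dv) k ^ 2 := Finset.sum_nonneg fun _ _ => sq_nonneg _
  have h5 : 0 ≤ (M + 1)⁻¹ * ∑ j, z.pv j ^ 2 := by positivity
  have h6 := mul_le_mul_of_nonneg_right hm1 h3
  have h7 := mul_le_mul_of_nonneg_right hm1 h4
  unfold baseDissipation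
  change _ ≤ ∑ k, (S *ᵥ z.ζ) k ^ 2 + 16 * ∑ k, (S *ᵥ z.dv) k ^ 2 + ∑ j, z.ξ j * z.γ j
    + 8 * ∑ j, μ j * z.pv j ^ 2
  linarith

theorem quadBdd_value (h : Intertwines B σ s) (hσ : ∀ i, 0 ≤ σ i)
    (hs : ∀ j, 0 ≤ s j) (hs1 : ∀ j, s j < 1) :
    QuadBdd (value σ) (sqLength : FlowState S B N s μ K → ℝ) := by
  have hr : ∀ j, 0 < (1 - s j) / (1 + s j) := fun j =>
    div_pos (sub_pos.2 (hs1 j)) (by linarith [hs j])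
  have hb : ∀ z : FlowState S B N s μ K, _ := fun z => le_lyap (S := S) h hσ hs hs1 z.e z.ζ z.ξ z.γ
    z.x z.φ z.ψ z.cost_nonneg z.conj_nonneg z.cost_le z.fenchel_young
  have hn : ∀ z : FlowState S B N s μ K, 0 ≤ ∑ k, z.e k ^ 2 ∧ 0 ≤ ∑ i, z.ζ i ^ 2
      ∧ 0 ≤ ∑ j, (1 - s j) / (1 + s j) * z.ξ j ^ 2 := fun z =>
    ⟨Finset.sum_nonneg fun _ _ => sq_nonneg _, Finset.sum_nonneg fun _ _ => sq_nonneg _,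
      Finset.sum_nonneg fun j _ => mul_nonneg (hr j).le (sq_nonneg _)⟩
  have he : SqBdd (value σ) fun z : FlowState S B N s μ K => z.e :=
    ⟨4, by norm_num, fun z => by
      have := hb z; obtain ⟨h1, h2, h3⟩ := hn z; unfold value; linarith⟩
  have hζ : SqBdd (value σ) fun z : FlowState S B N s μ K => z.ζ :=
    ⟨4, by norm_num, fun z => by
      have := hb z; obtain ⟨h1, h2, h3⟩ := hn z; unfold value; linarith⟩
  have hξ : SqBdd (value σ) fun z : FlowState S B N s μ K => z.ξ := by
    refine QuadBdd.sum fun j _ => ?_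
    refine ⟨4 * ((1 - s j) / (1 + s j))⁻¹, by have := hr j; positivity, fun z => ?_⟩
    have h0 := hb z
    obtain ⟨h1, h2, h3⟩ := hn z
    have h4 : (1 - s j) / (1 + s j) * z.ξ j ^ 2 ≤ ∑ j, (1 - s j) / (1 + s j) * z.ξ j ^ 2 :=
      Finset.single_le_sum (f := fun j => (1 - s j) / (1 + s j) * z.ξ j ^ 2)
        (fun j _ => mul_nonneg (hr j).le (sq_nonneg _)) (Finset.mem_univ j)
    rw [mul_comm 4, mul_assoc, ← div_eq_inv_mul, le_div_iff₀ (hr j)]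
    unfold value
    linarith
  exact (QuadBdd.add he hζ).add hξ

/-- Constants for a strict Lyapunov function of the error dynamics. -/
theorem exists_constants (h : Intertwines B σ s) (hσ : ∀ i, 0 ≤ σ i)
    (hs : ∀ j, 0 ≤ s j) (hs1 : ∀ j, s j < 1) (hμ : ∀ j, 0 < μ j)
    (hinj : ∀ ζ, S *ᵥ ζ = 0 → Bᵀ *ᵥ ζ = 0 → ζ = 0) :
    ∃ ε κ C, 0 ≤ ε ∧ 0 < κ ∧ 0 < C ∧ ∀ z : FlowState S B N s μ K,
      z.rate σ + ε * z.extraRate ≤ -κ * (z.value σ + ε * z.extra) ∧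
      z.sqLength ≤ C * (z.value σ + ε * z.extra) ∧
      z.value σ + ε * z.extra ≤ C * z.fullSqLength := by
  obtain ⟨c, hc, hrate⟩ := rate_le (S := S) (N := N) (K := K) h hσ hs hs1 hμ
  obtain ⟨C₁, hC₁, hextra⟩ := extraRate_le (S := S) (B := B) (N := N) (μ := μ) (K := K) hs hs1
  obtain ⟨C₂, hC₂, hdiss⟩ := quadBdd_dissipation (N := N) (s := s) (μ := μ) (K := K) hinj
  obtain ⟨C₃, hC₃, hlow⟩ := quadBdd_value (S := S) (N := N) (μ := μ) (K := K) h hσ hs hs1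
  -- This gives `ε * C₁ ≤ c / 2`, so half of the base dissipation survives the added terms; `d`
  -- below is then the rate left for the full dissipation.
  set ε := c / (2 * (C₁ + 1)) with hε
  have hε0 : 0 < ε := by positivity
  obtain ⟨C₄, hC₄, hup⟩ := (quadBdd_lyap (S := S) (B := B) (N := N) (K := K) hσ hs hs1 hμ).add
    (quadBdd_extra.const_mul hε0.le)
  set d := min (c / 2) (ε / 2) with hd
  have hd0 : 0 < d := lt_min (by positivity) (by positivity)
  refine ⟨ε, d / ((C₂ + 1) * (C₄ + 1)), C₃ + C₄ + 1, hε0.le, by positivity, by positivity,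
    fun z => ⟨?_, ?_, ?_⟩⟩
  · have h1 := hrate z
    have h2 := mul_le_mul_of_nonneg_left (hextra z) hε0.le
    have hb0 : 0 ≤ z.baseDissipation := by unfold baseDissipation; positivity
    have hw0 : 0 ≤ ∑ j, (Bᵀ *ᵥ z.ζ) j ^ 2 := Finset.sum_nonneg fun _ _ => sq_nonneg _
    have hx0 : 0 ≤ ∑ j, z.x j ^ 2 := Finset.sum_nonneg fun _ _ => sq_nonneg _
    have h3 : ε * C₁ ≤ c / 2 := by
      rw [hε, div_mul_eq_mul_div, div_le_div_iff₀ (by positivity) two_pos]; nlinarith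
    have h4 : z.rate σ + ε * z.extraRate ≤ -(d * z.dissipation) := by
      have hd1 : d ≤ c / 2 := min_le_left _ _
      have hd2 : d ≤ ε / 2 := min_le_right _ _
      have g1 := mul_le_mul_of_nonneg_right h3 hb0
      have g2 := mul_le_mul_of_nonneg_right hd1 hb0
      have g3 := mul_le_mul_of_nonneg_right hd2 hw0
      have g4 := mul_le_mul_of_nonneg_right hd2 hx0
      have g5 := mul_nonneg hε0.le hw0
      unfold dissipation
      linarith
    have hdis0 : 0 ≤ z.dissipation := by unfold dissipation; positivity
    have h5 : z.value σ + ε * z.extra ≤ (C₂ + 1) * (C₄ + 1) * z.dissipation := by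
      have g1 := hup z
      have g2 := mul_le_mul_of_nonneg_left (hdiss z) hC₄
      have g3 := mul_nonneg hC₂ hdis0
      have g4 := mul_nonneg hC₄ hdis0
      unfold value
      nlinarith
    refine h4.trans ?_
    rw [neg_mul, neg_le_neg_iff, div_mul_eq_mul_div, div_le_iff₀ (by positivity), mul_assoc]
    refine mul_le_mul_of_nonneg_left ?_ hd0.le
    linarith
  · have h1 := hlow z
    have h2 := z.sqLength_nonneg
    have h3 : 0 ≤ z.value σ := by
      have := le_lyap (S := S) h hσ hs hs1 z.e z.ζ z.ξ z.γ z.x z.φ z.ψ z.cost_nonneg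
        z.conj_nonneg z.cost_le z.fenchel_young
      refine le_trans ?_ this
      have : 0 ≤ ∑ j, (1 - s j) / (1 + s j) * z.ξ j ^ 2 := Finset.sum_nonneg fun j _ =>
        mul_nonneg (div_nonneg (sub_nonneg.2 (hs1 j).le) (by linarith [hs j])) (sq_nonneg _)
      positivity
    have h4 : 0 ≤ ε * z.extra := by
      refine mul_nonneg hε0.le (add_nonneg (Finset.sum_nonneg fun j _ =>
        mul_nonneg (hs j) (sq_nonneg _)) (Finset.sum_nonneg fun j _ => sq_nonneg _))
    nlinarith [mul_nonneg hC₃ h4, mul_nonneg hC₄ h3, mul_nonneg hC₄ h4]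
  · have h1 := hup z
    have h2 := z.fullSqLength_nonneg
    unfold value
    nlinarith [mul_nonneg hC₃ h2]

end FlowState

end Constants

/-! ### Decay of the error dynamics -/

/-- A first order low-pass filter of a signal that is continuous on `[0, ∞)`. -/
theorem exists_filter {c : ℝ} (hc : c ≠ 0) {u : ℝ → ℝ} (hu : ContinuousOn u (Set.Ici 0)) :
    ∃ x : ℝ → ℝ, x 0 = 0 ∧ ∀ t, 0 ≤ t → HasDerivWithinAt x ((u t - x t) / c) (Set.Ici 0) t := by
  -- Freezing `u` at negative times makes the integrand of the variation of constants formula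
  -- continuous on the whole line.
  have hcont : Continuous fun t => u (max t 0) :=
    hu.comp_continuous (by fun_prop) fun t => Set.mem_Ici.2 (le_max_right _ _)
  have hg : Continuous fun t => Real.exp (t / c) * u (max t 0) / c :=
    ((Real.continuous_exp.comp (continuous_id.div_const c)).mul hcont).div_const c
  refine ⟨fun t => Real.exp (-t / c) * ∫ r in (0 : ℝ)..t, Real.exp (r / c) * u (max r 0) / c,
    by simp, fun t ht => HasDerivAt.hasDerivWithinAt ?_⟩
  have h1 : HasDerivAt (fun t : ℝ => Real.exp (-t / c)) (Real.exp (-t / c) * (-1 / c)) t :=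
    ((hasDerivAt_neg t).div_const c).exp
  have h2 := (hg.integral_hasStrictDerivAt 0 t).hasDerivAt
  refine (h1.mul h2).congr_deriv ?_
  have h3 : Real.exp (-t / c) * Real.exp (t / c) = 1 := by
    rw [← Real.exp_add, neg_div, neg_add_cancel, Real.exp_zero]
  rw [max_eq_left ht]
  beta_reduce
  generalize (∫ r in (0 : ℝ)..t, Real.exp (r / c) * u (max r 0) / c) = A
  generalize Real.exp (-t / c) = a at h3 ⊢
  generalize Real.exp (t / c) = b at h3 ⊢
  field_simp
  linear_combination (u t) * h3

section Decay

open Matrix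

theorem HasDerivWithinAt.filterVel {J : Type*} [Fintype J] {s : J → ℝ} {ξ x : ℝ → J → ℝ} {ξ' x' : J → ℝ}
    {T : Set ℝ} {t : ℝ} (hξ : HasDerivWithinAt ξ ξ' T t)
    (hx : HasDerivWithinAt x x' T t) :
    HasDerivWithinAt (fun t => filterVel s (ξ t) (x t)) (filterVel s ξ' x') T t :=
  hasDerivWithinAt_pi.2 fun j =>
    ((hasDerivWithinAt_pi.1 hξ j).sub (hasDerivWithinAt_pi.1 hx j)).div_const _

theorem ContinuousOn.mulVec {I J : Type*} [Fintype J] (M : Matrix I J ℝ) {u : ℝ → J → ℝ} {T : Set ℝ}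
    (h : ContinuousOn u T) : ContinuousOn (fun t => M *ᵥ u t) T :=
  (continuous_const.matrix_mulVec continuous_id).comp_continuousOn h

variable {E I J : Type*} [Fintype E] [Fintype I] [Fintype J]

theorem HasDerivWithinAt.mulVec (M : Matrix I J ℝ) {u : ℝ → J → ℝ} {u' : J → ℝ} {T : Set ℝ}
    {t : ℝ} (h : HasDerivWithinAt u u' T t) :
    HasDerivWithinAt (fun t => M *ᵥ u t) (M *ᵥ u') T t :=
  (M.mulVecLin.toContinuousLinearMap.hasFDerivAt (x := u t)).comp_hasDerivWithinAt t h

variable {S : Matrix E I ℝ} {B : Matrix I J ℝ} {N : Matrix E E ℝ} {σ : I → ℝ} {s μ : J → ℝ}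
  {K : J → ℝ≥0} {e : ℝ → E → ℝ} {ζ : ℝ → I → ℝ} {ξ x : ℝ → J → ℝ} {e' : E → ℝ} {ζ' : I → ℝ}
  {ξ' x' : J → ℝ} {T : Set ℝ} {t : ℝ}

theorem HasDerivWithinAt.dualVel (he : HasDerivWithinAt e e' T t)
    (hζ : HasDerivWithinAt ζ ζ' T t) (hξ : HasDerivWithinAt ξ ξ' T t) :
    HasDerivWithinAt (fun t => dualVel S B (e t) (ζ t) (ξ t)) (dualVel S B e' ζ' ξ') T t :=
  ((hξ.mulVec B).sub ((hζ.mulVec S).mulVec Sᵀ)).sub (he.mulVec Sᵀ)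

theorem HasDerivWithinAt.linForce (he : HasDerivWithinAt e e' T t)
    (hζ : HasDerivWithinAt ζ ζ' T t) (hξ : HasDerivWithinAt ξ ξ' T t) (j : J) :
    HasDerivWithinAt (fun t => linForce S B s (e t) (ζ t) (ξ t) j)
      (linForce S B s e' ζ' ξ' j) T t :=
  (hasDerivWithinAt_pi.1 (hζ.mulVec Bᵀ) j).add
    ((hasDerivWithinAt_pi.1 (((hξ.mulVec B).sub (he.mulVec Sᵀ)).mulVec Bᵀ) j).const_mul (s j))

theorem HasDerivWithinAt.gradFilter (he : HasDerivWithinAt e e' T t)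
    (hζ : HasDerivWithinAt ζ ζ' T t) (hξ : HasDerivWithinAt ξ ξ' T t)
    (hx : HasDerivWithinAt x x' T t) (j : J) :
    HasDerivWithinAt (fun t => gradFilter S B s (e t) (ζ t) (ξ t) (x t) j)
      (gradFilter S B s e' ζ' ξ' x' j) T t :=
  (hasDerivWithinAt_pi.1 ((((hx.mulVec B).sub (he.mulVec Sᵀ)).sub hζ).mulVec Bᵀ) j).add
    (((hasDerivWithinAt_pi.1 hx j).sub (hasDerivWithinAt_pi.1 hξ j)).const_mul _)

theorem HasDerivWithinAt.sq {f : ℝ → ℝ} {f' : ℝ} (h : HasDerivWithinAt f f' T t) :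
    HasDerivWithinAt (fun t => f t ^ 2) (2 * (f t * f')) T t :=
  (h.pow 2).congr_deriv (by simp; ring)

/-- The state of the flow for given costs. -/
noncomputable def flowState (hμ : ∀ j, 0 < μ j) {F : J → ℝ → ℝ}
    (hF : ∀ j, StronglyConvexSmooth (μ j) (K j) (F j)) (hF0 : ∀ j, F j 0 = 0)
    (hF0' : ∀ j, deriv (F j) 0 = 0) (e : E → ℝ) (he : N *ᵥ (S *ᵥ (Sᵀ *ᵥ e)) = e) (ζ : I → ℝ)
    (ξ x : J → ℝ) : FlowState S B N s μ K where
  e := e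
  ζ := ζ
  ξ := ξ
  γ j := deriv (F j) (ξ j)
  x := x
  φ j := F j (ξ j)
  ψ j := convexConj (F j) (gradFilter S B s e ζ ξ x j)
  p j := derivInv (F j) (gradFilter S B s e ζ ξ x j)
  mulVec_e := he
  sq_grad_le j := (hF j).sq_deriv_le (hF0' j) _
  mul_sq_le j := (hF j).mul_sq_le (hF0' j) _
  cost_nonneg j := (hF j).nonneg (hμ j) (hF0 j) (hF0' j) _
  cost_le j := (hF j).le_mul_deriv (hμ j) (hF0 j) _
  conj_nonneg j := (hF j).convexConj_nonneg (hμ j) (hF0 j) _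
  conj_le j := (hF j).convexConj_le (hμ j) (hF0 j) (hF0' j) _
  fenchel_young j := (hF j).fenchel_young (hμ j) _ _
  monotone j := by
    have := (hF j).strong (derivInv (F j) (gradFilter S B s e ζ ξ x j)) (ξ j)
    rw [(hF j).deriv_derivInv (hμ j)] at this
    exact le_trans (mul_nonneg (hμ j).le (sq_nonneg _)) this

/-- Only the kinetic energy, which contains `F'(ξ)`, and the conjugate are handled by one-sided
bounds; their coefficients in `lyap` are nonnegative. Everything else is differentiated exactly. -/
theorem hasUpperSlope_lyap (h : Intertwines B σ s) (hs : ∀ j, 0 ≤ s j) (hs1 : ∀ j, s j < 1)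
    (hμ : ∀ j, 0 < μ j) {F : J → ℝ → ℝ}
    (hF : ∀ j, StronglyConvexSmooth (μ j) (K j) (F j))
    (he : HasDerivWithinAt e (S *ᵥ ζ t) (Set.Ici t) t)
    (hζ : HasDerivWithinAt ζ (dualVel S B (e t) (ζ t) (ξ t)) (Set.Ici t) t)
    (hξ : HasDerivWithinAt ξ
      (primalVel S B s (e t) (ζ t) (ξ t) fun j => deriv (F j) (ξ t j)) (Set.Ici t) t)
    (hx : HasDerivWithinAt x (filterVel s (ξ t) (x t)) (Set.Ici t) t) :
    HasUpperSlope (fun t => lyap S B σ s (e t) (ζ t) (ξ t) (fun j => deriv (F j) (ξ t j)) (x t)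
        (fun j => F j (ξ t j))
        fun j => convexConj (F j) (gradFilter S B s (e t) (ζ t) (ξ t) (x t) j)) t
      (lyapRate S B σ s μ (e t) (ζ t) (ξ t) (fun j => deriv (F j) (ξ t j)) (x t)
        fun j => derivInv (F j) (gradFilter S B s (e t) (ζ t) (ξ t) (x t) j)) := by
  have hSζ := hζ.mulVec S
  have hdv := he.dualVel (S := S) (B := B) hζ hξ
  have hx' := hξ.filterVel (s := s) hx
  refine ((HasUpperSlope.sum fun k _ => HasDerivWithinAt.hasUpperSlope ?_).add
    (HasUpperSlope.sum fun i _ => HasDerivWithinAt.hasUpperSlope ?_)).add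
    (HasUpperSlope.sum fun j _ => ?_)
  · refine (((hasDerivWithinAt_pi.1 he k).sq.div_const 2).add
      ((hasDerivWithinAt_pi.1 hSζ k).sq.const_mul 8)).congr_deriv ?_
    ring
  · refine ((((hasDerivWithinAt_pi.1 hζ i).sq.div_const 2).add
      ((hasDerivWithinAt_pi.1 hdv i).sq.const_mul 8)).add
      ((((hasDerivWithinAt_pi.1 (hx.mulVec B) i).sq.div_const 2).add
        ((hasDerivWithinAt_pi.1 (hx'.mulVec B) i).sq.const_mul 8)).const_mul (σ i))).congr_deriv ?_
    ring
  · have h0 := hs j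
    have h1 := hs1 j
    have hd : 0 < 1 - s j := by linarith
    have hc : 0 < 1 + s j := by linarith
    have hr0 : 0 ≤ (1 - s j) / (1 + s j) := by positivity
    have hT1 : 0 ≤ 16 / (1 + s j) ^ 2 - 1 := by
      rw [sub_nonneg, le_div_iff₀ (by positivity)]; nlinarith
    have hy := he.gradFilter (S := S) (B := B) (s := s) hζ hξ hx j
    rw [gradFilter_velocity h hs hs1] at hy
    have hξj := hasDerivWithinAt_pi.1 hξ j
    have hFξ : HasDerivWithinAt (fun t => F j (ξ t j)) _ (Set.Ici t) t :=
      ((hF j).differentiable (ξ t j)).hasDerivAt.comp_hasDerivWithinAt t hξj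
    have hvel : ∀ t, -linForce S B s (e t) (ζ t) (ξ t) j / (1 - s j)
        - (1 - s j)⁻¹ * deriv (F j) (ξ t j)
        = primalVel S B s (e t) (ζ t) (ξ t) (fun j => deriv (F j) (ξ t j)) j := by
      intro t; rw [primalVel]; field_simp; ring
    have hkin := (hF j).hasUpperSlope_half_sq_velocity (inv_nonneg.2 hd.le)
      (x := fun t => ξ t j) (ℓ := fun t => -linForce S B s (e t) (ζ t) (ξ t) j / (1 - s j)) (t := t)
      (hξj.congr_deriv (hvel t).symm) ((he.linForce (s := s) hζ hξ j).neg.div_const (1 - s j))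
    simp only [hvel] at hkin
    have hconj := (hF j).hasUpperSlope_convexConj (hμ j) hy
    refine ((HasUpperSlope.add (HasDerivWithinAt.hasUpperSlope ?_)
      (hkin.const_mul (mul_nonneg (by norm_num) hr0))).add
      (HasDerivWithinAt.hasUpperSlope ?_)).add
      (HasUpperSlope.const_mul (HasUpperSlope.add (HasDerivWithinAt.hasUpperSlope ?_)
        (hconj.const_mul hT1)) h0)
    · refine ((hξj.sq.div_const 2).const_mul _).congr_deriv ?_
      ring
    · refine ((((hasDerivWithinAt_pi.1 hx j).sq.div_const 2).add
        ((hasDerivWithinAt_pi.1 hx' j).sq.const_mul 8)).const_mul _).congr_deriv ?_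
      ring
    · exact (hFξ.sub (hξj.mul hy)).const_mul _

theorem continuousOn_lyap (hμ : ∀ j, 0 < μ j) {F : J → ℝ → ℝ}
    (hF : ∀ j, StronglyConvexSmooth (μ j) (K j) (F j))
    (he : ContinuousOn e T) (hζ : ContinuousOn ζ T) (hξ : ContinuousOn ξ T)
    (hx : ContinuousOn x T) :
    ContinuousOn (fun t => lyap S B σ s (e t) (ζ t) (ξ t) (fun j => deriv (F j) (ξ t j)) (x t)
        (fun j => F j (ξ t j))
        fun j => convexConj (F j) (gradFilter S B s (e t) (ζ t) (ξ t) (x t) j)) T := by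
  have hF1 : ∀ j, Continuous (F j) := fun j => (hF j).differentiable.continuous
  have hF2 : ∀ j, Continuous (deriv (F j)) := fun j => (hF j).lipschitz.continuous
  have hF3 : ∀ j, Continuous (convexConj (F j)) := fun j => (hF j).continuous_convexConj (hμ j)
  have hξj : ∀ j, ContinuousOn (fun t => ξ t j) T := continuousOn_pi.1 hξ
  have hxj : ∀ j, ContinuousOn (fun t => x t j) T := continuousOn_pi.1 hx
  have hdv : ContinuousOn (fun t => dualVel S B (e t) (ζ t) (ξ t)) T :=
    ((hξ.mulVec B).sub ((hζ.mulVec S).mulVec Sᵀ)).sub (he.mulVec Sᵀ)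
  have hv : ContinuousOn (fun t => filterVel s (ξ t) (x t)) T :=
    continuousOn_pi.2 fun j => ((hξj j).sub (hxj j)).div_const _
  have hl : ∀ j, ContinuousOn (fun t => linForce S B s (e t) (ζ t) (ξ t) j) T := fun j =>
    (continuousOn_pi.1 (hζ.mulVec Bᵀ) j).add (continuousOn_const.mul
      (continuousOn_pi.1 (((hξ.mulVec B).sub (he.mulVec Sᵀ)).mulVec Bᵀ) j))
  have hy : ∀ j, ContinuousOn (fun t => gradFilter S B s (e t) (ζ t) (ξ t) (x t) j) T := fun j =>
    (continuousOn_pi.1 ((((hx.mulVec B).sub (he.mulVec Sᵀ)).sub hζ).mulVec Bᵀ) j).add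
      (continuousOn_const.mul ((hxj j).sub (hξj j)))
  have hp : ∀ j, ContinuousOn (fun t =>
      primalVel S B s (e t) (ζ t) (ξ t) (fun j => deriv (F j) (ξ t j)) j) T := fun j =>
    (((hF2 j).comp_continuousOn (hξj j)).add (hl j)).neg.div_const _
  refine ((continuousOn_finsetSum _ fun k _ => ?_).add
    (continuousOn_finsetSum _ fun i _ => ?_)).add (continuousOn_finsetSum _ fun j _ => ?_)
  · exact (((continuousOn_pi.1 he k).pow 2).div_const 2).add
      (continuousOn_const.mul ((continuousOn_pi.1 (hζ.mulVec S) k).pow 2))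
  · exact ((((continuousOn_pi.1 hζ i).pow 2).div_const 2).add
      (continuousOn_const.mul ((continuousOn_pi.1 hdv i).pow 2))).add (continuousOn_const.mul
      ((((continuousOn_pi.1 (hx.mulVec B) i).pow 2).div_const 2).add
        (continuousOn_const.mul ((continuousOn_pi.1 (hv.mulVec B) i).pow 2))))
  · exact (((continuousOn_const.mul (((hξj j).pow 2).div_const 2)).add
      (continuousOn_const.mul (((hp j).pow 2).div_const 2))).add
      (continuousOn_const.mul ((((hxj j).pow 2).div_const 2).add
        (continuousOn_const.mul ((continuousOn_pi.1 hv j).pow 2))))).add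
      (continuousOn_const.mul ((continuousOn_const.mul
        (((hF1 j).comp_continuousOn (hξj j)).sub ((hξj j).mul (hy j)))).add
        (continuousOn_const.mul ((hF3 j).comp_continuousOn (hy j)))))

/-- The filter is built along a given solution and started at `0`, so it does not enter the initial
length. The constants precede `F` because `FlowState` knows the costs only through inequalities in
`μ` and `K`. -/
theorem exists_exponential_decay (h : Intertwines B σ s) (hσ : ∀ i, 0 ≤ σ i)
    (hs : ∀ j, 0 ≤ s j) (hs1 : ∀ j, s j < 1) (hμ : ∀ j, 0 < μ j)
    (hinj : ∀ ζ, S *ᵥ ζ = 0 → Bᵀ *ᵥ ζ = 0 → ζ = 0) (N : Matrix E E ℝ) (K : J → ℝ≥0) :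
    ∃ C > (0 : ℝ), ∃ c > (0 : ℝ), ∀ F : J → ℝ → ℝ,
      (∀ j, StronglyConvexSmooth (μ j) (K j) (F j)) → (∀ j, F j 0 = 0) →
      (∀ j, deriv (F j) 0 = 0) → ∀ (e : ℝ → E → ℝ) (ζ : ℝ → I → ℝ) (ξ : ℝ → J → ℝ),
      (∀ t, 0 ≤ t → HasDerivWithinAt e (S *ᵥ ζ t) (Set.Ici 0) t) →
      (∀ t, 0 ≤ t → HasDerivWithinAt ζ (dualVel S B (e t) (ζ t) (ξ t)) (Set.Ici 0) t) →
      (∀ t, 0 ≤ t → HasDerivWithinAt ξ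
        (primalVel S B s (e t) (ζ t) (ξ t) fun j => deriv (F j) (ξ t j)) (Set.Ici 0) t) →
      (∀ t, 0 ≤ t → N *ᵥ (S *ᵥ (Sᵀ *ᵥ e t)) = e t) → ∀ t, 0 ≤ t →
      ∑ k, e t k ^ 2 + ∑ i, ζ t i ^ 2 + ∑ j, ξ t j ^ 2
        ≤ C * Real.exp (-c * t) * (∑ k, e 0 k ^ 2 + ∑ i, ζ 0 i ^ 2 + ∑ j, ξ 0 j ^ 2) := by
  obtain ⟨ε, κ, C, hε, hκ, hC, hconst⟩ :=
    FlowState.exists_constants (S := S) (N := N) (K := K) h hσ hs hs1 hμ hinj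
  refine ⟨C * C, by positivity, κ, hκ, fun F hF hF0 hF0' e ζ ξ he hζ hξ hN t ht => ?_⟩
  have hfilter : ∀ j, ∃ x : ℝ → ℝ, x 0 = 0 ∧
      ∀ t, 0 ≤ t → HasDerivWithinAt x ((ξ t j - x t) / (1 + s j)) (Set.Ici 0) t := fun j =>
    exists_filter (by have := hs j; positivity) fun t ht =>
      (hasDerivWithinAt_pi.1 (hξ t ht) j).continuousWithinAt
  choose x' hx0 hx' using hfilter
  set x : ℝ → J → ℝ := fun t j => x' j t with hxdef
  have hx : ∀ t, 0 ≤ t → HasDerivWithinAt x (filterVel s (ξ t) (x t)) (Set.Ici 0) t :=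
    fun t ht => hasDerivWithinAt_pi.2 fun j => hx' j t ht
  set L : ℝ → ℝ := fun t => lyap S B σ s (e t) (ζ t) (ξ t) (fun j => deriv (F j) (ξ t j)) (x t)
    (fun j => F j (ξ t j)) fun j => convexConj (F j) (gradFilter S B s (e t) (ζ t) (ξ t) (x t) j)
    with hL
  set X : ℝ → ℝ := fun t => ∑ j, s j * (Bᵀ *ᵥ ζ t) j ^ 2 + ∑ j, x t j ^ 2 with hX
  set X' : ℝ → ℝ := fun t =>
    ∑ j, s j * (2 * ((Bᵀ *ᵥ ζ t) j * (Bᵀ *ᵥ dualVel S B (e t) (ζ t) (ξ t)) j))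
      + ∑ j, 2 * (x t j * filterVel s (ξ t) (x t) j) with hX'
  have hXd : ∀ t, 0 ≤ t → HasDerivWithinAt X (X' t) (Set.Ici t) t := fun t ht => by
    refine HasDerivWithinAt.mono (t := Set.Ici 0) ?_ (Set.Ici_subset_Ici.2 ht)
    exact (HasDerivWithinAt.fun_sum fun j _ =>
      (hasDerivWithinAt_pi.1 ((hζ t ht).mulVec Bᵀ) j).sq.const_mul (s j)).add
      (HasDerivWithinAt.fun_sum fun j _ => (hasDerivWithinAt_pi.1 (hx t ht) j).sq)
  set z : ∀ t, 0 ≤ t → FlowState S B N s μ K := fun t ht =>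
    flowState hμ hF hF0 hF0' (e t) (hN t ht) (ζ t) (ξ t) (x t) with hz
  have hcont : ContinuousOn (fun t => L t + ε * X t) (Set.Ici 0) := by
    refine (continuousOn_lyap hμ hF (fun t ht => (he t ht).continuousWithinAt)
      (fun t ht => (hζ t ht).continuousWithinAt) (fun t ht => (hξ t ht).continuousWithinAt)
      (fun t ht => (hx t ht).continuousWithinAt)).add (continuousOn_const.mul ?_)
    refine (continuousOn_finsetSum _ fun j _ => continuousOn_const.mul (ContinuousOn.pow
      (fun t ht => (hasDerivWithinAt_pi.1 ((hζ t ht).mulVec Bᵀ) j).continuousWithinAt) 2)).add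
      (continuousOn_finsetSum _ fun j _ => ContinuousOn.pow
      (fun t ht => (hasDerivWithinAt_pi.1 (hx t ht) j).continuousWithinAt) 2)
  have hdecay := le_mul_exp_of_hasUpperSlope (κ := κ) hcont
    (D := fun t => lyapRate S B σ s μ (e t) (ζ t) (ξ t) (fun j => deriv (F j) (ξ t j)) (x t)
        (fun j => derivInv (F j) (gradFilter S B s (e t) (ζ t) (ξ t) (x t) j)) + ε * X' t)
    (fun t ht => by
      have hsub : Set.Ici t ⊆ Set.Ici 0 := Set.Ici_subset_Ici.2 ht
      exact (hasUpperSlope_lyap h hs hs1 hμ hF ((he t ht).mono hsub) ((hζ t ht).mono hsub)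
        ((hξ t ht).mono hsub) ((hx t ht).mono hsub)).add
        ((hXd t ht).hasUpperSlope.const_mul hε))
    (fun t ht => (hconst (z t ht)).1) ht
  have h1 : ∑ k, e t k ^ 2 + ∑ i, ζ t i ^ 2 + ∑ j, ξ t j ^ 2 ≤ C * (L t + ε * X t) :=
    (hconst (z t ht)).2.1
  have h2 : L 0 + ε * X 0 ≤ C * (∑ k, e 0 k ^ 2 + ∑ i, ζ 0 i ^ 2 + ∑ j, ξ 0 j ^ 2
      + ∑ j, x 0 j ^ 2) := (hconst (z 0 le_rfl)).2.2
  have h3 : ∑ j, x 0 j ^ 2 = 0 := by simp [hxdef, hx0]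
  rw [h3, add_zero] at h2
  calc _ ≤ C * (L t + ε * X t) := h1
    _ ≤ C * ((L 0 + ε * X 0) * Real.exp (-κ * t)) := by gcongr
    _ ≤ C * (C * (∑ k, e 0 k ^ 2 + ∑ i, ζ 0 i ^ 2 + ∑ j, ξ 0 j ^ 2) * Real.exp (-κ * t)) := by
        gcongr
    _ = _ := by ring

end Decay

/-! ### Global solutions of differential equations with Lipschitz right-hand side -/

section GlobalODE

variable {X : Type*} [NormedAddCommGroup X] [NormedSpace ℝ X]

theorem norm_integral_le_of_norm_le_exp {g : ℝ → X} {A c τ : ℝ} (hc : 0 < c) (hA : 0 ≤ A)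
    (hτ : 0 ≤ τ) (hg : ∀ r, 0 ≤ r → ‖g r‖ ≤ A * Real.exp (c * r)) :
    ‖∫ r in (0 : ℝ)..τ, g r‖ ≤ A / c * Real.exp (c * τ) := by
  have hcont : Continuous fun r => A * Real.exp (c * r) := by fun_prop
  have h1 : ‖∫ r in (0 : ℝ)..τ, g r‖ ≤ ∫ r in (0 : ℝ)..τ, A * Real.exp (c * r) :=
    intervalIntegral.norm_integral_le_of_norm_le hτ
      (Filter.Eventually.of_forall fun r hr => hg r hr.1.le) (hcont.intervalIntegrable _ _)
  have h2 : ∫ r in (0 : ℝ)..τ, A * Real.exp (c * r)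
      = A / c * Real.exp (c * τ) - A / c * Real.exp (c * 0) := by
    refine intervalIntegral.integral_eq_sub_of_hasDerivAt
      (f := fun r => A / c * Real.exp (c * r)) (fun r _ => ?_) (hcont.intervalIntegrable _ _)
    refine ((((hasDerivAt_id r).const_mul c).exp).const_mul (A / c)).congr_deriv ?_
    simp only [id]
    field_simp
  rw [h2] at h1
  have : 0 ≤ A / c * Real.exp (c * 0) := by positivity
  linarith

/-- Picard iteration in an exponentially weighted norm: with `z = z₀ + exp (c t) • u`, `u` bounded
and `c = K + 1`, the integral operator contracts by `K / c` on the whole half-line at once. -/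
theorem LipschitzWith.exists_solvesODE [CompleteSpace X] {F : X → X} {K : ℝ≥0}
    (hF : LipschitzWith K F) (z₀ : X) : ∃ z : ℝ → X, z 0 = z₀ ∧ SolvesODE F z := by
  set c : ℝ := K + 1 with hc
  have hc0 : 0 < c := by positivity
  let field : BoundedContinuousFunction ℝ X → ℝ → X := fun u r => F (z₀ + Real.exp (c * r) • u r)
  have hcont : ∀ u, Continuous (field u) := fun u => by
    have := u.continuous
    have := hF.continuous
    fun_prop
  have hbound : ∀ u r, 0 ≤ r → ‖field u r‖ ≤ (‖F z₀‖ + K * ‖u‖) * Real.exp (c * r) := by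
    intro u r hr
    have h1 : ‖field u r - F z₀‖ ≤ K * (Real.exp (c * r) * ‖u‖) := by
      have := hF.dist_le_mul (z₀ + Real.exp (c * r) • u r) z₀
      rw [dist_eq_norm, dist_eq_norm, add_sub_cancel_left, norm_smul, Real.norm_eq_abs,
        Real.abs_exp] at this
      refine this.trans ?_
      gcongr
      exact u.norm_coe_le_norm r
    have h2 : ‖field u r‖ ≤ ‖F z₀‖ + ‖field u r - F z₀‖ := by
      simpa using norm_add_le (F z₀) (field u r - F z₀)
    have h3 : 1 ≤ Real.exp (c * r) := Real.one_le_exp (by positivity)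
    nlinarith [norm_nonneg (F z₀)]
  have hdiff : ∀ u v r, 0 ≤ r →
      ‖field u r - field v r‖ ≤ (K * dist u v) * Real.exp (c * r) := by
    intro u v r _
    have := hF.dist_le_mul (z₀ + Real.exp (c * r) • u r) (z₀ + Real.exp (c * r) • v r)
    rw [dist_add_left, dist_smul₀, dist_eq_norm, Real.norm_eq_abs, Real.abs_exp] at this
    calc ‖field u r - field v r‖ ≤ K * (Real.exp (c * r) * dist (u r) (v r)) := this
      _ ≤ K * (Real.exp (c * r) * dist u v) := by
          gcongr
          exact BoundedContinuousFunction.dist_coe_le_dist r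
      _ = _ := by ring
  -- Negative times are read as `0`, so that the operator acts on bounded continuous functions on
  -- `ℝ`.
  let Φ : BoundedContinuousFunction ℝ X → BoundedContinuousFunction ℝ X := fun u =>
    BoundedContinuousFunction.ofNormedAddCommGroup
      (fun t => Real.exp (-c * max t 0) • ∫ r in (0 : ℝ)..max t 0, field u r)
      (by
        have h1 : Continuous fun τ => ∫ r in (0 : ℝ)..τ, field u r :=
          intervalIntegral.continuous_primitive (fun a b => (hcont u).intervalIntegrable a b) 0
        have h2 : Continuous fun t : ℝ => max t 0 := by fun_prop
        exact (Real.continuous_exp.comp (h2.const_mul (-c))).smul (h1.comp h2))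
      ((‖F z₀‖ + K * ‖u‖) / c)
      (fun t => by
        have h0 : 0 ≤ max t 0 := le_max_right _ _
        have := norm_integral_le_of_norm_le_exp hc0 (by positivity) h0 (hbound u)
        rw [norm_smul, Real.norm_eq_abs, Real.abs_exp]
        calc _ ≤ Real.exp (-c * max t 0)
              * ((‖F z₀‖ + K * ‖u‖) / c * Real.exp (c * max t 0)) := by gcongr
          _ = (‖F z₀‖ + K * ‖u‖) / c * (Real.exp (-c * max t 0) * Real.exp (c * max t 0)) := by
              ring
          _ = _ := by rw [← Real.exp_add]; simp)
  have hcontr : ContractingWith (Real.toNNReal (K / c)) Φ := by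
    refine ⟨?_, LipschitzWith.of_dist_le_mul fun u v => ?_⟩
    · rw [Real.toNNReal_lt_one, div_lt_one hc0]; simp [hc]
    · rw [Real.coe_toNNReal _ (by positivity)]
      refine (BoundedContinuousFunction.dist_le (by positivity)).2 fun t => ?_
      have h0 : 0 ≤ max t 0 := le_max_right _ _
      have h1 := norm_integral_le_of_norm_le_exp hc0 (by positivity) h0 (hdiff u v)
      rw [intervalIntegral.integral_sub ((hcont u).intervalIntegrable _ _)
        ((hcont v).intervalIntegrable _ _)] at h1
      change dist (Real.exp (-c * max t 0) • ∫ r in (0 : ℝ)..max t 0, field u r)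
        (Real.exp (-c * max t 0) • ∫ r in (0 : ℝ)..max t 0, field v r) ≤ _
      rw [dist_smul₀, Real.norm_eq_abs, Real.abs_exp, dist_eq_norm]
      calc _ ≤ Real.exp (-c * max t 0) * (K * dist u v / c * Real.exp (c * max t 0)) := by gcongr
        _ = K / c * dist u v * (Real.exp (-c * max t 0) * Real.exp (c * max t 0)) := by ring
        _ = _ := by rw [← Real.exp_add]; simp
  set u := ContractingWith.fixedPoint Φ hcontr
  have hu : Φ u = u := hcontr.fixedPoint_isFixedPt
  have hu' : ∀ t, 0 ≤ t → Real.exp (c * t) • u t = ∫ r in (0 : ℝ)..t, field u r := by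
    intro t ht
    have : u t = Real.exp (-c * max t 0) • ∫ r in (0 : ℝ)..max t 0, field u r := by
      conv_lhs => rw [← hu]
      rfl
    rw [this, max_eq_left ht, smul_smul, ← Real.exp_add]
    simp
  have hu0 : u 0 = 0 := by simpa using hu' 0 le_rfl
  refine ⟨fun t => z₀ + Real.exp (c * t) • u t, by simp [hu0], fun t ht => ?_⟩
  have h1 : HasDerivAt (fun t => z₀ + ∫ r in (0 : ℝ)..t, field u r) (field u t) t :=
    ((hcont u).integral_hasStrictDerivAt 0 t).hasDerivAt.const_add z₀
  exact h1.hasDerivWithinAt.congr (fun r hr => by rw [hu' r hr]) (by rw [hu' t ht])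

end GlobalODE

/-! ### Lipschitz functions with unspecified constants -/

/-- Some constant is a Lipschitz constant of `f`. -/
def IsLip {X Y : Type*} [PseudoEMetricSpace X] [PseudoEMetricSpace Y] (f : X → Y) : Prop :=
  ∃ K, LipschitzWith K f

namespace IsLip

variable {X : Type*} [SeminormedAddCommGroup X]

theorem const {Y : Type*} [PseudoEMetricSpace Y] (c : Y) : IsLip fun _ : X => c :=
  ⟨0, LipschitzWith.const c⟩

theorem comp {Y Z : Type*} [PseudoEMetricSpace Y] [PseudoEMetricSpace Z] {g : Y → Z} {f : X → Y}
    (hg : IsLip g) (hf : IsLip f) : IsLip fun x => g (f x) := by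
  obtain ⟨K, hK⟩ := hf
  obtain ⟨M, hM⟩ := hg
  exact ⟨M * K, hM.comp hK⟩

theorem add {f g : X → ℝ} (hf : IsLip f) (hg : IsLip g) : IsLip fun x => f x + g x := by
  obtain ⟨K, hK⟩ := hf
  obtain ⟨M, hM⟩ := hg
  exact ⟨K + M, hK.add hM⟩

theorem neg {f : X → ℝ} (hf : IsLip f) : IsLip fun x => -f x := by
  obtain ⟨K, hK⟩ := hf
  exact ⟨K, hK.neg⟩

theorem sub {f g : X → ℝ} (hf : IsLip f) (hg : IsLip g) : IsLip fun x => f x - g x := by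
  simpa only [sub_eq_add_neg] using hf.add hg.neg

theorem const_mul {f : X → ℝ} (hf : IsLip f) (c : ℝ) : IsLip fun x => c * f x :=
  IsLip.comp (g := fun r => c * r) ⟨‖c‖₊, LipschitzWith.of_dist_le_mul fun r r' => by
    rw [Real.dist_eq, Real.dist_eq, ← mul_sub, abs_mul]; rfl⟩ hf

theorem mul_const {f : X → ℝ} (hf : IsLip f) (c : ℝ) : IsLip fun x => f x * c := by
  simpa only [mul_comm] using hf.const_mul c

theorem sum {ι : Type*} {u : Finset ι} {f : ι → X → ℝ} (h : ∀ i ∈ u, IsLip (f i)) :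
    IsLip fun x => ∑ i ∈ u, f i x := by
  classical
  induction u using Finset.induction_on with
  | empty => simpa using const (X := X) (0 : ℝ)
  | insert i u hi ih =>
    simp only [Finset.sum_insert hi]
    exact (h i (Finset.mem_insert_self i u)).add
      (ih fun j hj => h j (Finset.mem_insert_of_mem hj))

theorem pi {ι : Type*} [Fintype ι] {Y : ι → Type*} [∀ i, PseudoEMetricSpace (Y i)]
    {f : X → ∀ i, Y i} (h : ∀ i, IsLip fun x => f x i) : IsLip f := by
  choose K hK using h
  refine ⟨∑ i, K i, fun x y => edist_pi_le_iff.2 fun i => (hK i x y).trans ?_⟩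
  gcongr
  exact Finset.single_le_sum (f := K) (fun _ _ => zero_le) (Finset.mem_univ i)

theorem prodMk {Y Z : Type*} [PseudoEMetricSpace Y] [PseudoEMetricSpace Z] {f : X → Y} {g : X → Z}
    (hf : IsLip f) (hg : IsLip g) : IsLip fun x => (f x, g x) := by
  obtain ⟨K, hK⟩ := hf
  obtain ⟨M, hM⟩ := hg
  exact ⟨max K M, hK.prodMk hM⟩

theorem euclidean {ι : Type*} [Fintype ι] {f : X → EuclideanSpace ℝ ι}
    (h : ∀ i, IsLip fun x => f x i) : IsLip f :=
  IsLip.comp (g := (EuclideanSpace.equiv ι ℝ).symm)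
    ⟨_, (EuclideanSpace.equiv ι ℝ).symm.toContinuousLinearMap.lipschitz⟩ (IsLip.pi h)

theorem id : IsLip fun x : X => x :=
  ⟨1, LipschitzWith.id⟩

theorem fst {Y Z : Type*} [PseudoEMetricSpace Y] [PseudoEMetricSpace Z] {f : X → Y × Z}
    (hf : IsLip f) : IsLip fun x => (f x).1 :=
  IsLip.comp ⟨1, LipschitzWith.prod_fst⟩ hf

theorem snd {Y Z : Type*} [PseudoEMetricSpace Y] [PseudoEMetricSpace Z] {f : X → Y × Z}
    (hf : IsLip f) : IsLip fun x => (f x).2 :=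
  IsLip.comp ⟨1, LipschitzWith.prod_snd⟩ hf

theorem apply {ι : Type*} [Fintype ι] {Y : ι → Type*} [∀ i, PseudoEMetricSpace (Y i)]
    {f : X → ∀ i, Y i} (hf : IsLip f) (i : ι) : IsLip fun x => f x i :=
  IsLip.comp (g := fun y : ∀ i, Y i => y i) ⟨1, LipschitzWith.eval i⟩ hf

theorem euclidean_apply {ι : Type*} [Fintype ι] {f : X → EuclideanSpace ℝ ι} (hf : IsLip f)
    (i : ι) : IsLip fun x => f x i :=
  IsLip.comp (g := fun y : EuclideanSpace ℝ ι => y i)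
    ⟨_, (EuclideanSpace.proj i : EuclideanSpace ℝ ι →L[ℝ] ℝ).lipschitz⟩ hf

end IsLip

/-! ### The gradient of a separable cost -/

theorem gradient_localCost {d : ℕ} {g : Fin d → ℝ → ℝ} (hg : ∀ l, Differentiable ℝ (g l))
    (x : EuclideanSpace ℝ (Fin d)) :
    gradient (localCost g) x = WithLp.toLp 2 fun l => deriv (g l) (x l) := by
  refine HasGradientAt.gradient ?_
  rw [hasGradientAt_iff_hasFDerivAt]
  have h : HasFDerivAt (localCost g)
      (∑ l, deriv (g l) (x l) • (EuclideanSpace.proj l : EuclideanSpace ℝ (Fin d) →L[ℝ] ℝ)) x := by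
    refine HasFDerivAt.fun_sum fun l _ => ?_
    exact (hg l (x l)).hasDerivAt.comp_hasFDerivAt x
      (EuclideanSpace.proj l : EuclideanSpace ℝ (Fin d) →L[ℝ] ℝ).hasFDerivAt
  have e : InnerProductSpace.toDual ℝ (EuclideanSpace ℝ (Fin d))
      (WithLp.toLp 2 fun l => deriv (g l) (x l))
      = ∑ l, deriv (g l) (x l) • (EuclideanSpace.proj l : EuclideanSpace ℝ (Fin d) →L[ℝ] ℝ) := by
    refine ContinuousLinearMap.ext fun v => ?_
    simp [PiLp.inner_apply, mul_comm]
  rw [e]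
  exact h

/-! ### The KKT system -/

section KKT

open Matrix

/-- Stationarity gives `x(ν) = (f')⁻¹(-Wᵀν)`, and feasibility becomes the dual equation `-W x(ν) =
-b`. By cocoercivity of the `f'`, pairing its left side with an increment of `ν` dominates `|Wᵀ(ν -
ν')|² / M`, and `Wᵀ` is bounded below since it is injective. -/
theorem exists_stationary_feasible {P J : Type*} [Fintype P] [Fintype J] {μ : J → ℝ} {K : J → ℝ≥0}
    {f : J → ℝ → ℝ} (hμ : ∀ j, 0 < μ j) (hf : ∀ j, StronglyConvexSmooth (μ j) (K j) (f j))
    (W : Matrix P J ℝ) (hW : ∀ ν, Wᵀ *ᵥ ν = 0 → ν = 0) (b : P → ℝ) :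
    ∃ (x : J → ℝ) (ν : P → ℝ), (∀ j, deriv (f j) (x j) + (Wᵀ *ᵥ ν) j = 0) ∧ W *ᵥ x = b := by
  classical
  let x : EuclideanSpace ℝ P → J → ℝ := fun ν j => derivInv (f j) (-(Wᵀ *ᵥ ν.ofLp) j)
  let T : EuclideanSpace ℝ P → EuclideanSpace ℝ P := fun ν => WithLp.toLp 2 (-(W *ᵥ x ν))
  have hlip : IsLip T := by
    refine IsLip.euclidean fun k => IsLip.neg (IsLip.sum fun j _ => IsLip.const_mul ?_ _)
    refine IsLip.comp ⟨_, (hf j).lipschitzWith_derivInv (hμ j)⟩ (IsLip.neg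
      (IsLip.sum fun i _ => IsLip.const_mul ?_ _))
    exact IsLip.id.euclidean_apply i
  obtain ⟨KT, hKT⟩ := hlip
  obtain ⟨C, hC, hbound⟩ : QuadBdd (fun ν : P → ℝ => ∑ j, (Wᵀ *ᵥ ν) j ^ 2)
      fun ν => ∑ k, ν k ^ 2 := by
    obtain ⟨g, hg⟩ := Wᵀ.mulVecLin.exists_leftInverse_of_injective
      (LinearMap.ker_eq_bot'.2 fun ν hν => hW ν hν)
    have h1 : SqBdd (fun ν : P → ℝ => ∑ j, (Wᵀ *ᵥ ν) j ^ 2) fun ν => Wᵀ *ᵥ ν :=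
      ⟨1, zero_le_one, fun ν => by rw [one_mul]⟩
    have h2 := h1.mulVec (LinearMap.toMatrix' g)
    have key : ∀ ν, LinearMap.toMatrix' g *ᵥ (Wᵀ *ᵥ ν) = ν := fun ν => by
      rw [LinearMap.toMatrix'_mulVec]
      exact LinearMap.congr_fun hg ν
    simp only [key] at h2
    exact h2
  -- A common bound for the Lipschitz constants; the summand `1` keeps it positive for empty `J`.
  set M : ℝ := ∑ j, (K j : ℝ) + 1 with hM
  have hM0 : 0 < M := by positivity
  have hKM : ∀ j, (K j : ℝ) ≤ M := fun j => by
    have : (K j : ℝ) ≤ ∑ j, (K j : ℝ) := Finset.single_le_sum (f := fun j => (K j : ℝ))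
      (fun _ _ => NNReal.coe_nonneg _) (Finset.mem_univ j)
    linarith
  have hmono : ∀ ν ν', (M * (C + 1))⁻¹ * ‖ν - ν'‖ ^ 2 ≤ inner ℝ (ν - ν') (T ν - T ν') := by
    intro ν ν'
    have hin : inner ℝ (ν - ν') (T ν - T ν')
        = ∑ j, (x ν j - x ν' j) * (-(Wᵀ *ᵥ ν.ofLp) j - -(Wᵀ *ᵥ ν'.ofLp) j) := by
      have h1 := sum_mul_transpose_mulVec W (x ν - x ν') (ν.ofLp - ν'.ofLp)
      have h2 : ∑ j, (x ν j - x ν' j) * (-(Wᵀ *ᵥ ν.ofLp) j - -(Wᵀ *ᵥ ν'.ofLp) j)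
          = -∑ j, (x ν - x ν') j * (Wᵀ *ᵥ (ν.ofLp - ν'.ofLp)) j := by
        rw [← Finset.sum_neg_distrib]
        refine Finset.sum_congr rfl fun j _ => ?_
        rw [mulVec_sub, Pi.sub_apply, Pi.sub_apply]; ring
      rw [h2, h1, PiLp.inner_apply, ← Finset.sum_neg_distrib]
      refine Finset.sum_congr rfl fun k _ => ?_
      simp only [T, PiLp.sub_apply, Pi.neg_apply, mulVec_sub, Pi.sub_apply, RCLike.inner_apply,
        conj_trivial]
      ring
    have hco : ∑ j, (Wᵀ *ᵥ (ν.ofLp - ν'.ofLp)) j ^ 2 ≤ M * inner ℝ (ν - ν') (T ν - T ν') := by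
      rw [hin, Finset.mul_sum]
      refine Finset.sum_le_sum fun j _ => ?_
      have h1 := (hf j).sq_deriv_sub_le (hμ j) (x ν' j) (x ν j)
      have h2 := (hf j).strong (x ν' j) (x ν j)
      have h3 : 0 ≤ μ j * ‖x ν j - x ν' j‖ ^ 2 := mul_nonneg (hμ j).le (sq_nonneg _)
      simp only [x, (hf j).deriv_derivInv (hμ j)] at h1 h2 h3 ⊢
      have h4 := mul_le_mul_of_nonneg_right (hKM j) (h3.trans h2)
      rw [mulVec_sub, Pi.sub_apply]
      calc _ = (-(Wᵀ *ᵥ ν.ofLp) j - -(Wᵀ *ᵥ ν'.ofLp) j) ^ 2 := by ring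
        _ ≤ _ := h1.trans h4
    have h5 : ‖ν - ν'‖ ^ 2 ≤ C * ∑ j, (Wᵀ *ᵥ (ν.ofLp - ν'.ofLp)) j ^ 2 := by
      rw [EuclideanSpace.real_norm_sq_eq]
      exact hbound _
    have h6 : 0 ≤ inner ℝ (ν - ν') (T ν - T ν') := by
      have : 0 ≤ M * inner ℝ (ν - ν') (T ν - T ν') :=
        le_trans (Finset.sum_nonneg fun _ _ => sq_nonneg _) hco
      exact nonneg_of_mul_nonneg_right this hM0
    rw [inv_mul_le_iff₀ (by positivity)]
    have h7 := mul_le_mul_of_nonneg_left hco hC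
    have h8 := mul_nonneg hM0.le h6
    nlinarith
  obtain ⟨ν, hν⟩ := surjective_of_stronglyMonotone (by positivity) hKT hmono (WithLp.toLp 2 (-b))
  refine ⟨x ν, ν.ofLp, fun j => ?_, ?_⟩
  · simp only [x, (hf j).deriv_derivInv (hμ j), neg_add_cancel]
  · have : -(W *ᵥ x ν) = -b := congrArg WithLp.ofLp hν
    exact neg_injective this

/-- Pairing the difference of the stationarity equations with `x - x'` kills the multipliers,
because `W (x - x') = 0`; strong convexity then gives `x = x'`, and injectivity of `Wᵀ` gives `ν =
ν'`. -/
theorem stationary_feasible_unique {P J : Type*} [Fintype P] [Fintype J] {μ : J → ℝ}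
    {K : J → ℝ≥0} {f : J → ℝ → ℝ} (hμ : ∀ j, 0 < μ j)
    (hf : ∀ j, StronglyConvexSmooth (μ j) (K j) (f j))
    {W : Matrix P J ℝ} (hW : ∀ ν, Wᵀ *ᵥ ν = 0 → ν = 0) {x x' : J → ℝ} {ν ν' : P → ℝ}
    (h : ∀ j, deriv (f j) (x j) + (Wᵀ *ᵥ ν) j = 0) (h' : ∀ j, deriv (f j) (x' j) + (Wᵀ *ᵥ ν') j = 0)
    (hx : W *ᵥ x = W *ᵥ x') : x = x' ∧ ν = ν' := by
  have h0 := sum_mul_transpose_mulVec W (x - x') (ν - ν')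
  rw [mulVec_sub W, hx, sub_self] at h0
  have h1 : ∑ j, (x j - x' j) * (deriv (f j) (x j) - deriv (f j) (x' j)) = 0 := by
    rw [← neg_eq_zero, ← Finset.sum_neg_distrib]
    simp only [Pi.zero_apply, zero_mul, Finset.sum_const_zero] at h0
    rw [← h0]
    refine Finset.sum_congr rfl fun j _ => ?_
    rw [mulVec_sub, Pi.sub_apply, Pi.sub_apply]
    linear_combination (-(x j - x' j)) * (h j - h' j)
  have h2 : ∀ j, μ j * ‖x j - x' j‖ ^ 2 ≤ (x j - x' j) * (deriv (f j) (x j) - deriv (f j) (x' j)) :=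
    fun j => (hf j).strong (x' j) (x j)
  have h3 := (Finset.sum_eq_zero_iff_of_nonneg fun j _ =>
    le_trans (mul_nonneg (hμ j).le (sq_nonneg _)) (h2 j)).1 h1
  have hxx : x = x' := by
    funext j
    have h4 : μ j * ‖x j - x' j‖ ^ 2 ≤ 0 := (h2 j).trans (h3 j (Finset.mem_univ j)).le
    have h5 : ‖x j - x' j‖ ^ 2 ≤ 0 := nonpos_of_mul_nonpos_right h4 (hμ j)
    have h6 : ‖x j - x' j‖ = 0 := pow_eq_zero_iff two_ne_zero |>.1 (le_antisymm h5 (sq_nonneg _))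
    exact sub_eq_zero.1 (norm_eq_zero.1 h6)
  refine ⟨hxx, sub_eq_zero.1 (hW _ ?_)⟩
  funext j
  rw [mulVec_sub, Pi.sub_apply, Pi.zero_apply]
  have := h j
  rw [hxx] at this
  linear_combination this - h' j

end KKT

/-! ### Decay for primal-dual dynamics coupled through a symmetric positive matrix -/

section Laplacian

open Matrix

variable {I J : Type*} [Fintype I] [Fintype J]

open scoped MatrixOrder in
theorem Matrix.PosSemidef.exists_eq_transpose_mul_self [DecidableEq I] {L : Matrix I I ℝ}
    (hL : L.PosSemidef) : ∃ S : Matrix I I ℝ, L = Sᵀ * S := by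
  obtain ⟨S, hS⟩ := CStarAlgebra.nonneg_iff_eq_star_mul_self.mp hL.nonneg
  refine ⟨S, ?_⟩
  rw [hS, star_eq_conjTranspose, conjTranspose_eq_transpose_of_trivial]

/-- Fredholm alternative: a functional that vanishes on the range but not at `η` is, by symmetry of
`L`, the pairing with a kernel vector. -/
theorem exists_mulVec_eq_of_forall_dotProduct [DecidableEq I] {L : Matrix I I ℝ} (hL : L.IsSymm)
    {η : I → ℝ} (h : ∀ d, L *ᵥ d = 0 → d ⬝ᵥ η = 0) : ∃ u, L *ᵥ u = η := by
  by_contra hne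
  have hmem : η ∉ LinearMap.range L.mulVecLin := fun ⟨u, hu⟩ => hne ⟨u, hu⟩
  obtain ⟨f, hf, hrange⟩ := Submodule.exists_dual_map_eq_bot_of_notMem hmem inferInstance
  set d : I → ℝ := fun i => f (Pi.single i 1) with hd
  have hfd : ∀ u, f u = d ⬝ᵥ u := fun u => by
    conv_lhs => rw [pi_eq_sum_univ' u]
    simp [hd, dotProduct, mul_comm]
  have hLd : L *ᵥ d = 0 := by
    refine dotProduct_eq_zero _ fun u => ?_
    have h1 : f (L *ᵥ u) = 0 := by
      have : f (L *ᵥ u) ∈ (LinearMap.range L.mulVecLin).map f := ⟨_, ⟨u, rfl⟩, rfl⟩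
      rwa [hrange, Submodule.mem_bot] at this
    rw [← h1, hfd, dotProduct_mulVec, ← mulVec_transpose, hL.eq]
  exact hf ((hfd η).trans (h d hLd))

/-- `SSᵀ` is injective on the range of `S`, as `SSᵀSu = 0` forces `Su = 0`; `N` extends its inverse
linearly. For `η = SᵀSu` it yields `NSη = Su`, the vector `e` in the range of `S` with `Sᵀe = η`. -/
theorem exists_mul_mul_transpose_mul_eq [DecidableEq I] (S : Matrix I I ℝ) :
    ∃ N : Matrix I I ℝ, ∀ u, N *ᵥ (S *ᵥ (Sᵀ *ᵥ (S *ᵥ u))) = S *ᵥ u := by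
  set A : (I → ℝ) →ₗ[ℝ] I → ℝ := S.mulVecLin ∘ₗ Sᵀ.mulVecLin ∘ₗ S.mulVecLin with hA
  have hzero : ∀ v : I → ℝ, Sᵀ *ᵥ (S *ᵥ v) = 0 → S *ᵥ v = 0 := fun v hv => by
    have := dotProduct_mulVec v Sᵀ (S *ᵥ v)
    rw [hv, dotProduct_zero, vecMul_transpose] at this
    exact dotProduct_self_eq_zero.1 this.symm
  have hker : ∀ u, A u = 0 → S *ᵥ u = 0 := fun u hu => by
    refine hzero _ ?_
    have h1 : S *ᵥ (Sᵀ *ᵥ (S *ᵥ u)) = 0 := hu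
    have := dotProduct_mulVec (S *ᵥ u) S (Sᵀ *ᵥ (S *ᵥ u))
    rw [h1, dotProduct_zero, ← mulVec_transpose] at this
    exact dotProduct_self_eq_zero.1 this.symm
  obtain ⟨r, hr⟩ := A.rangeRestrict.exists_rightInverse_of_surjective
    (LinearMap.range_rangeRestrict A)
  obtain ⟨g, hg⟩ := (S.mulVecLin ∘ₗ r).exists_extend
  refine ⟨LinearMap.toMatrix' g, fun u => ?_⟩
  have h1 : g (A u) = S *ᵥ r (A.rangeRestrict u) := LinearMap.congr_fun hg (A.rangeRestrict u)
  have h2 : A (r (A.rangeRestrict u) - u) = 0 := by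
    rw [map_sub, sub_eq_zero]
    exact congrArg Subtype.val (LinearMap.congr_fun hr (A.rangeRestrict u))
  have h3 := hker _ h2
  rw [mulVec_sub, sub_eq_zero] at h3
  rw [LinearMap.toMatrix'_mulVec]
  exact h1.trans h3

theorem dotProduct_eq_zero_of_hasDerivWithinAt {L : Matrix I I ℝ} (hL : L.IsSymm)
    {η ζ : ℝ → I → ℝ}
    (hη : ∀ t, 0 ≤ t → HasDerivWithinAt η (L *ᵥ ζ t) (Set.Ici 0) t) {d : I → ℝ}
    (hd : L *ᵥ d = 0) (h0 : d ⬝ᵥ η 0 = 0) {t : ℝ} (ht : 0 ≤ t) : d ⬝ᵥ η t = 0 := by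
  have hderiv : ∀ r, 0 ≤ r → HasDerivWithinAt (fun r => d ⬝ᵥ η r) 0 (Set.Ici 0) r := fun r hr => by
    have h1 : HasDerivWithinAt (fun r => d ⬝ᵥ η r) (d ⬝ᵥ L *ᵥ ζ r) (Set.Ici 0) r :=
      HasDerivWithinAt.fun_sum fun i _ => (hasDerivWithinAt_pi.1 (hη r hr) i).const_mul (d i)
    rwa [dotProduct_mulVec, ← mulVec_transpose, hL.eq, hd, zero_dotProduct] at h1
  rw [← h0]
  refine constant_of_has_deriv_right_zero (a := 0) (b := t)
    (fun r hr => ((hderiv r hr.1).mono Set.Icc_subset_Ici_self).continuousWithinAt)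
    (fun r hr => (hderiv r hr.1).mono (Set.Ici_subset_Ici.2 hr.1)) t ⟨ht, le_rfl⟩

/-- With `L = SᵀS` and `e = NSη` the system takes the form of `exists_exponential_decay`. Pairings
of `η` with kernel vectors of `L` are conserved, so `η` stays in the range of `L`; hence `Sᵀe = η`
at all times, and the lengths of `e` and `η` are comparable. -/
theorem exists_exponential_decay_of_posSemidef {L : Matrix I I ℝ} (hL : L.PosSemidef)
    {B : Matrix I J ℝ} {σ : I → ℝ} {s μ : J → ℝ} (h : Intertwines B σ s) (hσ : ∀ i, 0 ≤ σ i)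
    (hs : ∀ j, 0 ≤ s j) (hs1 : ∀ j, s j < 1) (hμ : ∀ j, 0 < μ j)
    (hinj : ∀ ζ, L *ᵥ ζ = 0 → Bᵀ *ᵥ ζ = 0 → ζ = 0) (K : J → ℝ≥0) :
    ∃ C > (0 : ℝ), ∃ c > (0 : ℝ), ∀ F : J → ℝ → ℝ,
      (∀ j, StronglyConvexSmooth (μ j) (K j) (F j)) → (∀ j, F j 0 = 0) →
      (∀ j, deriv (F j) 0 = 0) → ∀ (η ζ : ℝ → I → ℝ) (ξ : ℝ → J → ℝ),
      (∀ t, 0 ≤ t → HasDerivWithinAt η (L *ᵥ ζ t) (Set.Ici 0) t) →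
      (∀ t, 0 ≤ t → HasDerivWithinAt ζ (B *ᵥ ξ t - L *ᵥ ζ t - η t) (Set.Ici 0) t) →
      (∀ t, 0 ≤ t → HasDerivWithinAt ξ (fun j => -(deriv (F j) (ξ t j) + ((Bᵀ *ᵥ ζ t) j
        + s j * (Bᵀ *ᵥ (B *ᵥ ξ t - η t)) j)) / (1 - s j)) (Set.Ici 0) t) →
      (∀ d, L *ᵥ d = 0 → d ⬝ᵥ η 0 = 0) → ∀ t, 0 ≤ t →
      ∑ i, η t i ^ 2 + ∑ i, ζ t i ^ 2 + ∑ j, ξ t j ^ 2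
        ≤ C * Real.exp (-c * t) * (∑ i, η 0 i ^ 2 + ∑ i, ζ 0 i ^ 2 + ∑ j, ξ 0 j ^ 2) := by
  classical
  obtain ⟨S, hS⟩ := hL.exists_eq_transpose_mul_self
  have hLS : ∀ u, L *ᵥ u = Sᵀ *ᵥ (S *ᵥ u) := fun u => by rw [hS, mulVec_mulVec]
  have hsymm : L.IsSymm := by rw [hS]; exact isSymm_transpose_mul_self S
  obtain ⟨N, hN⟩ := exists_mul_mul_transpose_mul_eq S
  obtain ⟨C, hC, c, hc, hdecay⟩ := exists_exponential_decay (S := S) h hσ hs hs1 hμ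
    (fun ζ h1 h2 => hinj ζ (by rw [hLS, h1, mulVec_zero]) h2) N K
  have hto : SqBdd (fun u : I → ℝ => ∑ i, u i ^ 2) fun u => N *ᵥ (S *ᵥ u) :=
    SqBdd.mulVec (SqBdd.mulVec ⟨1, zero_le_one, fun u => by rw [one_mul]⟩ S) N
  have hfrom : SqBdd (fun u : I → ℝ => ∑ i, u i ^ 2) fun u => Sᵀ *ᵥ u :=
    SqBdd.mulVec ⟨1, zero_le_one, fun u => by rw [one_mul]⟩ Sᵀ
  obtain ⟨C₁, hC₁, hto⟩ := hto
  obtain ⟨C₂, hC₂, hfrom⟩ := hfrom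
  refine ⟨(C₂ + 1) * (C * (C₁ + 1)), by positivity, c, hc,
    fun F hF hF0 hF0' η ζ ξ hη hζ hξ h0 t ht => ?_⟩
  set e : ℝ → I → ℝ := fun t => N *ᵥ (S *ᵥ η t) with he
  have hSe : ∀ t, 0 ≤ t → Sᵀ *ᵥ e t = η t := fun t ht => by
    obtain ⟨u, hu⟩ := exists_mulVec_eq_of_forall_dotProduct hsymm fun d hd =>
      dotProduct_eq_zero_of_hasDerivWithinAt hsymm hη hd (h0 d hd) ht
    change Sᵀ *ᵥ (N *ᵥ (S *ᵥ η t)) = η t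
    rw [← hu, hLS, hN]
  have hmain := hdecay F hF hF0 hF0' e ζ ξ
    (fun t ht => by
      have := ((hη t ht).mulVec S).mulVec N
      rwa [hLS, hN] at this)
    (fun t ht => by
      have := hζ t ht
      rwa [hLS, ← hSe t ht] at this)
    (fun t ht => by
      have := hξ t ht
      rwa [← hSe t ht] at this)
    (fun t ht => by rw [hSe t ht]) t ht
  have h1 : ∑ i, η t i ^ 2 ≤ C₂ * ∑ i, e t i ^ 2 := by
    have : ∑ i, (Sᵀ *ᵥ e t) i ^ 2 ≤ C₂ * ∑ i, e t i ^ 2 := hfrom (e t)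
    rwa [hSe t ht] at this
  have h2 : ∑ i, e 0 i ^ 2 ≤ C₁ * ∑ i, η 0 i ^ 2 := hto (η 0)
  have hnn : ∀ u : I → ℝ, 0 ≤ ∑ i, u i ^ 2 := fun u => Finset.sum_nonneg fun _ _ => sq_nonneg _
  have hnnJ : ∀ u : J → ℝ, 0 ≤ ∑ i, u i ^ 2 := fun u => Finset.sum_nonneg fun _ _ => sq_nonneg _
  have hE := Real.exp_pos (-c * t)
  calc ∑ i, η t i ^ 2 + ∑ i, ζ t i ^ 2 + ∑ j, ξ t j ^ 2
      ≤ (C₂ + 1) * (∑ i, e t i ^ 2 + ∑ i, ζ t i ^ 2 + ∑ j, ξ t j ^ 2) := by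
        linear_combination h1 + hnn (e t) + C₂ * (hnn (ζ t) + hnnJ (ξ t))
    _ ≤ (C₂ + 1) * (C * Real.exp (-c * t) *
          (∑ i, e 0 i ^ 2 + ∑ i, ζ 0 i ^ 2 + ∑ j, ξ 0 j ^ 2)) := by gcongr
    _ ≤ (C₂ + 1) * (C * Real.exp (-c * t) *
          ((C₁ + 1) * (∑ i, η 0 i ^ 2 + ∑ i, ζ 0 i ^ 2 + ∑ j, ξ 0 j ^ 2))) := by
        gcongr
        linear_combination h2 + hnn (η 0) + C₁ * (hnn (ζ 0) + hnnJ (ξ 0))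
    _ = _ := by ring

/-! ### Weighted graph Laplacians -/

/-- The Laplacian of a weighted adjacency matrix. -/
def weightedLaplacian [DecidableEq I] (A : Matrix I I ℝ) : Matrix I I ℝ :=
  diagonal (fun q => ∑ r, A q r) - A

variable [DecidableEq I] {A : Matrix I I ℝ}

theorem weightedLaplacian_mulVec (A : Matrix I I ℝ) (ζ : I → ℝ) (q : I) :
    (weightedLaplacian A *ᵥ ζ) q = ∑ r, A q r * (ζ q - ζ r) := by
  rw [weightedLaplacian, sub_mulVec, Pi.sub_apply, mulVec_diagonal]
  simp only [mulVec, dotProduct, mul_sub, Finset.sum_sub_distrib, Finset.sum_mul]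

theorem two_mul_dotProduct_weightedLaplacian (hA : A.IsSymm) (ζ : I → ℝ) :
    2 * (ζ ⬝ᵥ weightedLaplacian A *ᵥ ζ) = ∑ q, ∑ r, A q r * (ζ q - ζ r) ^ 2 := by
  have h1 : ζ ⬝ᵥ weightedLaplacian A *ᵥ ζ = ∑ q, ∑ r, ζ q * (A q r * (ζ q - ζ r)) := by
    simp only [dotProduct, weightedLaplacian_mulVec, Finset.mul_sum]
  have h2 : ζ ⬝ᵥ weightedLaplacian A *ᵥ ζ = ∑ q, ∑ r, ζ r * (A q r * (ζ r - ζ q)) := by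
    rw [h1, Finset.sum_comm]
    exact Finset.sum_congr rfl fun q _ => Finset.sum_congr rfl fun r _ => by rw [hA.apply]
  rw [two_mul]
  conv_lhs => rw [h1]; arg 2; rw [← h1, h2]
  simp only [← Finset.sum_add_distrib]
  exact Finset.sum_congr rfl fun q _ => Finset.sum_congr rfl fun r _ => by ring

theorem posSemidef_weightedLaplacian (hA : A.IsSymm) (hA0 : ∀ q r, 0 ≤ A q r) :
    (weightedLaplacian A).PosSemidef := by
  refine PosSemidef.of_dotProduct_mulVec_nonneg ?_ fun ζ => ?_
  · rw [IsHermitian, conjTranspose_eq_transpose_of_trivial, weightedLaplacian, transpose_sub,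
      diagonal_transpose, hA.eq]
  · have := two_mul_dotProduct_weightedLaplacian hA ζ
    have h0 : 0 ≤ ∑ q, ∑ r, A q r * (ζ q - ζ r) ^ 2 :=
      Finset.sum_nonneg fun q _ => Finset.sum_nonneg fun r _ => mul_nonneg (hA0 q r) (sq_nonneg _)
    rw [star_trivial]
    linarith

theorem eq_of_weightedLaplacian_mulVec_eq_zero (hA : A.IsSymm) (hA0 : ∀ q r, 0 ≤ A q r)
    {ζ : I → ℝ} (h : weightedLaplacian A *ᵥ ζ = 0) {q r : I} (hqr : 0 < A q r) : ζ q = ζ r := by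
  have h1 := two_mul_dotProduct_weightedLaplacian hA ζ
  have hnn : ∀ q r, 0 ≤ A q r * (ζ q - ζ r) ^ 2 := fun q r => mul_nonneg (hA0 q r) (sq_nonneg _)
  rw [h, dotProduct_zero, mul_zero, eq_comm,
    Finset.sum_eq_zero_iff_of_nonneg fun q _ => Finset.sum_nonneg fun r _ => hnn q r] at h1
  have h2 := (Finset.sum_eq_zero_iff_of_nonneg fun r _ => hnn q r).1 (h1 q (Finset.mem_univ q)) r
    (Finset.mem_univ r)
  have h3 := (mul_eq_zero.1 h2).resolve_left hqr.ne'
  exact sub_eq_zero.1 (pow_eq_zero_iff two_ne_zero |>.1 h3)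

end Laplacian

/-! ### The algorithm in coordinates -/

section Coordinates

open Matrix

variable {N p : ℕ} {n : Fin N → ℕ} {V : Fin p → Finset (Fin N)}

/-- The matrix of `x ↦ ([wˡ]_k xˡ)_{k, l}`. -/
def localWeights (w : ∀ i, Matrix (Fin p) (Fin (n i)) ℝ) (V : Fin p → Finset (Fin N)) :
    Matrix (Σ k, V k) (Σ i, Fin (n i)) ℝ :=
  fun q j => if (q.2 : Fin N) = j.1 then w j.1 q.1 j.2 else 0

/-- The disjoint union of the subgraphs, with the gains included in the weights. -/
def couplingWeights (a : Matrix (Fin N) (Fin N) ℝ) (V : Fin p → Finset (Fin N)) (β : Fin p → ℝ) :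
    Matrix (Σ k, V k) (Σ k, V k) ℝ :=
  fun q r => if q.1 = r.1 then β q.1 * a q.2 r.2 else 0

/-- The coordinates of a dual variable. -/
def dualCoord (v : DualVar V) (q : Σ k, V k) : ℝ := v q.1 q.2

/-- The coordinates of a primal variable. -/
def primalCoord (x : PrimalVar n) (j : Σ i, Fin (n i)) : ℝ := x j.1 j.2

theorem isSymm_couplingWeights {a : Matrix (Fin N) (Fin N) ℝ} (ha : a.IsSymm) (β : Fin p → ℝ) :
    (couplingWeights a V β).IsSymm := by
  refine IsSymm.ext fun q r => ?_
  unfold couplingWeights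
  by_cases h : q.1 = r.1
  · rw [if_pos h, if_pos h.symm, ha.apply, congrArg β h]
  · rw [if_neg h, if_neg (Ne.symm h)]

theorem couplingWeights_nonneg {a : Matrix (Fin N) (Fin N) ℝ} (ha : ∀ i j, 0 ≤ a i j)
    {β : Fin p → ℝ} (hβ : ∀ k, 0 < β k) (q r : Σ k, V k) : 0 ≤ couplingWeights a V β q r := by
  unfold couplingWeights
  split_ifs
  · exact mul_nonneg (hβ _).le (ha _ _)
  · exact le_rfl

theorem weightedLaplacian_couplingWeights_mulVec (a : Matrix (Fin N) (Fin N) ℝ) (β : Fin p → ℝ)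
    (v : DualVar V) (q : Σ k, V k) :
    (weightedLaplacian (couplingWeights a V β) *ᵥ dualCoord v) q
      = β q.1 * disagreement a v q.1 q.2 := by
  rw [weightedLaplacian_mulVec, Fintype.sum_sigma, Finset.sum_eq_single q.1]
  · simp only [couplingWeights, if_true, disagreement, Finset.mul_sum, dualCoord, mul_assoc]
  · intro k _ hk
    refine Finset.sum_eq_zero fun l _ => ?_
    rw [couplingWeights, if_neg (Ne.symm hk), zero_mul]
  · exact fun h => absurd (Finset.mem_univ _) h

theorem localWeights_mulVec (w : ∀ i, Matrix (Fin p) (Fin (n i)) ℝ) (x : PrimalVar n)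
    (q : Σ k, V k) :
    (localWeights w V *ᵥ primalCoord x) q = rowDot (w q.2) q.1 (x q.2) := by
  rw [mulVec, dotProduct, Fintype.sum_sigma, Finset.sum_eq_single (q.2 : Fin N)]
  · simp only [localWeights, if_true, rowDot, primalCoord]
  · intro i _ hi
    refine Finset.sum_eq_zero fun m _ => ?_
    rw [localWeights, if_neg (Ne.symm hi), zero_mul]
  · exact fun h => absurd (Finset.mem_univ _) h

theorem localWeights_transpose_mulVec (w : ∀ i, Matrix (Fin p) (Fin (n i)) ℝ)
    (d : (Σ k, V k) → ℝ) (j : Σ i, Fin (n i)) :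
    ((localWeights w V)ᵀ *ᵥ d) j
      = ∑ k : {k : Fin p // j.1 ∈ V k}, d ⟨k, ⟨j.1, k.2⟩⟩ * w j.1 k j.2 := by
  refine (Fintype.sum_of_injective (fun k : {k : Fin p // j.1 ∈ V k} =>
    (⟨k, ⟨j.1, k.2⟩⟩ : Σ k, V k)) (fun k k' h => Subtype.ext (congrArg Sigma.fst h)) _ _ ?_ ?_).symm
  · rintro ⟨k, l, hl⟩ hq
    have : ¬ l = j.1 := by
      rintro rfl
      exact hq ⟨⟨k, hl⟩, rfl⟩
    simp only [transpose_apply, localWeights, if_neg this, zero_mul]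
  · intro k
    simp only [transpose_apply, localWeights, if_true, mul_comm]

theorem sum_subtype_mul_weights {w : ∀ i, Matrix (Fin p) (Fin (n i)) ℝ}
    (hV : ∀ k i, w i k ≠ 0 → i ∈ V k) (ν : Fin p → ℝ) (j : Σ i, Fin (n i)) :
    ∑ k : {k : Fin p // j.1 ∈ V k}, ν k * w j.1 k j.2 = ((stackedWeights w)ᵀ *ᵥ ν) j := by
  refine Fintype.sum_of_injective Subtype.val Subtype.val_injective _ _ ?_ ?_
  · intro k hk
    have : w j.1 k = 0 := by
      by_contra h
      exact hk ⟨⟨k, hV k j.1 h⟩, rfl⟩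
    simp only [transpose_apply, stackedWeights, this, Pi.zero_apply, zero_mul]
  · intro k
    simp only [transpose_apply, stackedWeights, mul_comm]

theorem stackedWeights_mulVec (w : ∀ i, Matrix (Fin p) (Fin (n i)) ℝ) (x : PrimalVar n)
    (k : Fin p) : (stackedWeights w *ᵥ primalCoord x) k = ∑ i, rowDot (w i) k (x i) := by
  rw [mulVec, dotProduct, Fintype.sum_sigma]
  rfl

theorem sum_rowDot_eq {w : ∀ i, Matrix (Fin p) (Fin (n i)) ℝ}
    (hV : ∀ k i, w i k ≠ 0 → i ∈ V k) (x : PrimalVar n) (k : Fin p) :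
    ∑ l : V k, rowDot (w l) k (x l) = ∑ i, rowDot (w i) k (x i) := by
  refine Fintype.sum_of_injective Subtype.val Subtype.val_injective _ _ ?_ fun _ => rfl
  intro i hi
  have : w i k = 0 := by
    by_contra h
    exact hi ⟨⟨i, hV k i h⟩, rfl⟩
  simp [rowDot, this]

/-- Vanishing Dirichlet energy forces equality across every edge, and then along every walk in the
connected subgraph. -/
theorem eq_of_laplacian_eq_zero {a : Matrix (Fin N) (Fin N) ℝ} (ha : ∀ i j, 0 ≤ a i j)
    (hasymm : a.IsSymm)
    (hconn : ∀ k, ((weightGraph a).induce (V k : Set (Fin N))).Connected)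
    {β : Fin p → ℝ} (hβ : ∀ k, 0 < β k) {ζ : (Σ k, V k) → ℝ}
    (h : weightedLaplacian (couplingWeights a V β) *ᵥ ζ = 0) (k : Fin p) (l l' : V k) :
    ζ ⟨k, l⟩ = ζ ⟨k, l'⟩ := by
  have hadj : ∀ l l' : V k, 0 < a l l' → ζ ⟨k, l⟩ = ζ ⟨k, l'⟩ := fun l l' hl =>
    eq_of_weightedLaplacian_mulVec_eq_zero (isSymm_couplingWeights hasymm β)
      (couplingWeights_nonneg ha hβ) h
      (by simpa only [couplingWeights, if_true] using mul_pos (hβ k) hl)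
  obtain ⟨walk⟩ := (hconn k).preconnected l l'
  induction walk with
  | nil => rfl
  | cons hstep _ ih =>
    refine Eq.trans ?_ ih
    obtain ⟨_, h1 | h1⟩ := (SimpleGraph.fromRel_adj _ _ _).1 (SimpleGraph.comap_adj.1 hstep)
    · exact hadj _ _ h1
    · exact (hadj _ _ h1).symm

/-- On the kernel of the Laplacian a dual vector is one multiplier per constraint. Since agents
outside `V k` have zero `k`-th row, the second equation then says that the multipliers lie in the
kernel of the transpose of `stackedWeights w`. -/
theorem eq_zero_of_laplacian_eq_zero {w : ∀ i, Matrix (Fin p) (Fin (n i)) ℝ}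
    (hW : ∀ ν, (stackedWeights w)ᵀ *ᵥ ν = 0 → ν = 0) (hV : ∀ k i, w i k ≠ 0 → i ∈ V k)
    {a : Matrix (Fin N) (Fin N) ℝ} (ha : ∀ i j, 0 ≤ a i j) (hasymm : a.IsSymm)
    (hconn : ∀ k, ((weightGraph a).induce (V k : Set (Fin N))).Connected)
    {β : Fin p → ℝ} (hβ : ∀ k, 0 < β k) {ζ : (Σ k, V k) → ℝ}
    (h : weightedLaplacian (couplingWeights a V β) *ᵥ ζ = 0)
    (h' : (localWeights w V)ᵀ *ᵥ ζ = 0) : ζ = 0 := by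
  have hne : ∀ k, Nonempty (V k) := fun k => (hconn k).nonempty
  set ν : Fin p → ℝ := fun k => ζ ⟨k, (hne k).some⟩ with hν
  have hζ : ∀ q, ζ q = ν q.1 := fun q => eq_of_laplacian_eq_zero ha hasymm hconn hβ h q.1 q.2 _
  have hν0 : ν = 0 := by
    refine hW ν (funext fun j => ?_)
    rw [← sum_subtype_mul_weights hV, ← h', localWeights_transpose_mulVec]
    exact Finset.sum_congr rfl fun k _ => by rw [hζ]
  funext q
  rw [hζ, hν0]
  rfl

theorem intertwines_localWeights (w : ∀ i, Matrix (Fin p) (Fin (n i)) ℝ) (φ : Fin N → ℝ) :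
    Intertwines (localWeights w V) (fun q => φ q.2) fun j => φ j.1 := fun q j h => by
  have : (q.2 : Fin N) = j.1 := by
    by_contra hne
    exact h (if_neg hne)
  simp only [this]

theorem isKKT_iff {f : ∀ i, Fin (n i) → ℝ → ℝ} (hf : ∀ i l, Differentiable ℝ (f i l))
    {w : ∀ i, Matrix (Fin p) (Fin (n i)) ℝ} {b : Fin p → ℝ} {x : PrimalVar n} {ν : Fin p → ℝ} :
    IsKKT f w b x ν ↔
      (∀ j : Σ i, Fin (n i), deriv (f j.1 j.2) (primalCoord x j) + ((stackedWeights w)ᵀ *ᵥ ν) j = 0)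
        ∧ stackedWeights w *ᵥ primalCoord x = b := by
  have key : ∀ (i : Fin N) (l : Fin (n i)),
      (gradient (localCost (f i)) (x i) + ∑ k, ν k • rowVec (w i) k) l
        = deriv (f i l) (x i l) + ((stackedWeights w)ᵀ *ᵥ ν) ⟨i, l⟩ := fun i l => by
    rw [gradient_localCost (hf i)]
    simp [rowVec, mulVec, dotProduct, stackedWeights, mul_comm]
  constructor
  · rintro ⟨h1, h2⟩
    refine ⟨fun j => ?_, funext fun k => (stackedWeights_mulVec w x k).trans (h2 k)⟩
    have := key j.1 j.2
    rw [h1] at this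
    exact this.symm
  · rintro ⟨h1, h2⟩
    refine ⟨fun i => ?_, fun k => by rw [← stackedWeights_mulVec, h2]⟩
    ext l
    rw [key]
    exact h1 ⟨i, l⟩

theorem algField_primal {f : ∀ i, Fin (n i) → ℝ → ℝ} (hf : ∀ i l, Differentiable ℝ (f i l))
    (w : ∀ i, Matrix (Fin p) (Fin (n i)) ℝ) (a : Matrix (Fin N) (Fin N) ℝ) (bbar : ∀ k, V k → ℝ)
    (β : Fin p → ℝ) (ρ : Fin N → ℝ) (z : AlgState n V) (i : Fin N) (m : Fin (n i)) :
    (algField f w a bbar β ρ z).2.2 i m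
      = -((1 + ρ i) * deriv (f i m) (z.2.2 i m))
        - ρ i * ∑ k : {k : Fin p // i ∈ V k},
            (rowDot (w i) k (z.2.2 i) - bbar k ⟨i, k.2⟩) * w i k m
        + ρ i * ∑ k : {k : Fin p // i ∈ V k}, z.1 k ⟨i, k.2⟩ * w i k m
        - (1 + ρ i) * ∑ k : {k : Fin p // i ∈ V k}, z.2.1 k ⟨i, k.2⟩ * w i k m := by
  obtain ⟨y, v, x⟩ := z
  simp [algField, gradient_localCost (hf i), rowVec]

end Coordinates

/-! ### Convergence of the algorithm -/

section Convergence

open Matrix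

variable {N p : ℕ} {n : Fin N → ℕ} {V : Fin p → Finset (Fin N)}

/-- Subtraction of the tangent at `c` and translation of `c` to the origin. -/
noncomputable def bregman (g : ℝ → ℝ) (c u : ℝ) : ℝ := g (c + u) - g c - deriv g c * u

theorem bregman_zero (g : ℝ → ℝ) (c : ℝ) : bregman g c 0 = 0 := by simp [bregman]

namespace StronglyConvexSmooth

variable {μ : ℝ} {K : ℝ≥0} {g : ℝ → ℝ}

theorem deriv_bregman (h : StronglyConvexSmooth μ K g) (c u : ℝ) :
    deriv (bregman g c) u = deriv g (c + u) - deriv g c := by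
  refine HasDerivAt.deriv ?_
  have h1 := ((h.differentiable (c + u)).hasDerivAt.comp_const_add c u).sub_const (g c)
  refine (h1.sub ((hasDerivAt_id u).const_mul (deriv g c))).congr_deriv (by rw [mul_one])

/-- The shift keeps both moduli, so costs centred at the unknown KKT point still fall under
constants chosen in advance. -/
theorem bregman (h : StronglyConvexSmooth μ K g) (c : ℝ) :
    StronglyConvexSmooth μ K (bregman g c) where
  differentiable := by
    have := h.differentiable
    unfold _root_.bregman
    fun_prop
  strong x z := by
    have := h.strong (c + x) (c + z)
    simp only [h.deriv_bregman]
    simpa only [add_sub_add_left_eq_sub, sub_sub_sub_cancel_right] using this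
  lipschitz := by
    refine LipschitzWith.of_dist_le_mul fun x z => ?_
    simp only [h.deriv_bregman, dist_sub_right]
    simpa only [dist_add_left] using h.lipschitz.dist_le_mul (c + x) (c + z)

end StronglyConvexSmooth

/-- The sum of the squares of the coordinates of a state. -/
def sqNorm (z : AlgState n V) : ℝ :=
  ∑ q, dualCoord z.1 q ^ 2 + ∑ q, dualCoord z.2.1 q ^ 2 + ∑ j, primalCoord z.2.2 j ^ 2

/-! ### Comparison of the sum of squares with the norm of the state -/

theorem sum_sq_dualCoord (v : DualVar V) : ∑ q, dualCoord v q ^ 2 = ∑ k, ‖v k‖ ^ 2 := by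
  rw [Fintype.sum_sigma]
  exact Finset.sum_congr rfl fun k _ => (EuclideanSpace.real_norm_sq_eq (v k)).symm

theorem sum_sq_primalCoord (x : PrimalVar n) : ∑ j, primalCoord x j ^ 2 = ∑ i, ‖x i‖ ^ 2 := by
  rw [Fintype.sum_sigma]
  exact Finset.sum_congr rfl fun i _ => (EuclideanSpace.real_norm_sq_eq (x i)).symm

theorem norm_sq_le_sum_norm_sq {ι : Type*} [Fintype ι] {E : ι → Type*}
    [∀ i, SeminormedAddCommGroup (E i)] (x : ∀ i, E i) : ‖x‖ ^ 2 ≤ ∑ i, ‖x i‖ ^ 2 := by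
  have h0 : 0 ≤ ∑ i, ‖x i‖ ^ 2 := Finset.sum_nonneg fun _ _ => sq_nonneg _
  refine (Real.le_sqrt (norm_nonneg _) h0).1 ((pi_norm_le_iff_of_nonneg (Real.sqrt_nonneg _)).2
    fun i => Real.le_sqrt_of_sq_le ?_)
  exact Finset.single_le_sum (f := fun i => ‖x i‖ ^ 2) (fun _ _ => sq_nonneg _) (Finset.mem_univ i)

theorem sum_norm_sq_le {ι : Type*} [Fintype ι] {E : ι → Type*}
    [∀ i, SeminormedAddCommGroup (E i)] (x : ∀ i, E i) :
    ∑ i, ‖x i‖ ^ 2 ≤ Fintype.card ι * ‖x‖ ^ 2 := by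
  rw [← nsmul_eq_mul, ← Finset.card_univ, ← Finset.sum_const]
  exact Finset.sum_le_sum fun i _ => pow_le_pow_left₀ (norm_nonneg _) (norm_le_pi_norm x i) 2

theorem norm_sq_le_sqNorm (z : AlgState n V) : ‖z‖ ^ 2 ≤ sqNorm z := by
  obtain ⟨y, v, x⟩ := z
  have h1 := norm_sq_le_sum_norm_sq y
  have h2 := norm_sq_le_sum_norm_sq v
  have h3 := norm_sq_le_sum_norm_sq x
  rw [sqNorm, sum_sq_dualCoord, sum_sq_dualCoord, sum_sq_primalCoord, Prod.norm_mk, Prod.norm_mk]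
  dsimp only
  have := sq_nonneg ‖y‖
  have := sq_nonneg ‖v‖
  have := sq_nonneg ‖x‖
  rcases max_cases ‖y‖ (max ‖v‖ ‖x‖) with h | h
  · rw [h.1]; linarith
  · rw [h.1]
    rcases max_cases ‖v‖ ‖x‖ with h | h
    · rw [h.1]; linarith
    · rw [h.1]; linarith

theorem sqNorm_le (z : AlgState n V) : sqNorm z ≤ (2 * p + N) * ‖z‖ ^ 2 := by
  obtain ⟨y, v, x⟩ := z
  have h1 := sum_norm_sq_le y
  have h2 := sum_norm_sq_le v
  have h3 := sum_norm_sq_le x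
  rw [Fintype.card_fin] at h1 h2 h3
  rw [sqNorm, sum_sq_dualCoord, sum_sq_dualCoord, sum_sq_primalCoord]
  have hy : ‖y‖ ≤ ‖(y, v, x)‖ := norm_fst_le (y, v, x)
  have hvx : ‖(v, x)‖ ≤ ‖(y, v, x)‖ := norm_snd_le (y, v, x)
  have hv : ‖v‖ ≤ ‖(y, v, x)‖ := (norm_fst_le (v, x)).trans hvx
  have hx : ‖x‖ ≤ ‖(y, v, x)‖ := (norm_snd_le (v, x)).trans hvx
  calc _ ≤ p * ‖y‖ ^ 2 + p * ‖v‖ ^ 2 + N * ‖x‖ ^ 2 := add_le_add (add_le_add h1 h2) h3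
    _ ≤ p * ‖(y, v, x)‖ ^ 2 + p * ‖(y, v, x)‖ ^ 2 + N * ‖(y, v, x)‖ ^ 2 := by gcongr
    _ = _ := by ring

theorem HasDerivWithinAt.euclidean_apply {ι : Type*} [Fintype ι] {u : ℝ → EuclideanSpace ℝ ι}
    {u' : EuclideanSpace ℝ ι} {T : Set ℝ} {t : ℝ} (h : HasDerivWithinAt u u' T t) (i : ι) :
    HasDerivWithinAt (fun t => u t i) (u' i) T t :=
  (EuclideanSpace.proj i : EuclideanSpace ℝ ι →L[ℝ] ℝ).hasFDerivAt.comp_hasDerivWithinAt t h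

theorem HasDerivWithinAt.dualCoord {v : ℝ → DualVar V} {v' : DualVar V} {T : Set ℝ} {t : ℝ}
    (h : HasDerivWithinAt v v' T t) :
    HasDerivWithinAt (fun t => dualCoord (v t)) (dualCoord v') T t :=
  hasDerivWithinAt_pi.2 fun q => (hasDerivWithinAt_pi.1 h q.1).euclidean_apply q.2

theorem HasDerivWithinAt.primalCoord {x : ℝ → PrimalVar n} {x' : PrimalVar n} {T : Set ℝ} {t : ℝ}
    (h : HasDerivWithinAt x x' T t) :
    HasDerivWithinAt (fun t => primalCoord (x t)) (primalCoord x') T t :=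
  hasDerivWithinAt_pi.2 fun j => (hasDerivWithinAt_pi.1 h j.1).euclidean_apply j.2

/-! ### The KKT point and the decay of the error -/

theorem exists_isKKT {w : ∀ i, Matrix (Fin p) (Fin (n i)) ℝ}
    (hW : ∀ ν, (stackedWeights w)ᵀ *ᵥ ν = 0 → ν = 0)
    {μ : ∀ i, Fin (n i) → ℝ} (hμ : ∀ i l, 0 < μ i l) {K : ∀ i, Fin (n i) → ℝ≥0}
    {f : ∀ i, Fin (n i) → ℝ → ℝ} (hf : ∀ i l, StronglyConvexSmooth (μ i l) (K i l) (f i l))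
    (b : Fin p → ℝ) : ∃ (x : PrimalVar n) (ν : Fin p → ℝ), IsKKT f w b x ν := by
  obtain ⟨x, ν, h1, h2⟩ := exists_stationary_feasible (fun j : Σ i, Fin (n i) => hμ j.1 j.2)
    (fun j => hf j.1 j.2) (stackedWeights w) hW b
  exact ⟨fun i => WithLp.toLp 2 fun l => x ⟨i, l⟩, ν,
    (isKKT_iff fun i l => (hf i l).differentiable).2 ⟨h1, h2⟩⟩

theorem IsKKT.unique {w : ∀ i, Matrix (Fin p) (Fin (n i)) ℝ}
    (hW : ∀ ν, (stackedWeights w)ᵀ *ᵥ ν = 0 → ν = 0)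
    {μ : ∀ i, Fin (n i) → ℝ} (hμ : ∀ i l, 0 < μ i l) {K : ∀ i, Fin (n i) → ℝ≥0}
    {f : ∀ i, Fin (n i) → ℝ → ℝ} (hf : ∀ i l, StronglyConvexSmooth (μ i l) (K i l) (f i l))
    {b : Fin p → ℝ} {x x' : PrimalVar n} {ν ν' : Fin p → ℝ} (h : IsKKT f w b x ν)
    (h' : IsKKT f w b x' ν') : x = x' ∧ ν = ν' := by
  rw [isKKT_iff fun i l => (hf i l).differentiable] at h h'
  obtain ⟨h1, h2⟩ := stationary_feasible_unique (fun j : Σ i, Fin (n i) => hμ j.1 j.2)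
    (fun j => hf j.1 j.2) hW h.1 h'.1 (h.2.trans h'.2.symm)
  refine ⟨?_, h2⟩
  funext i
  ext l
  exact congrFun h1 ⟨i, l⟩

theorem isLip_algField {μ : ∀ i, Fin (n i) → ℝ} {K : ∀ i, Fin (n i) → ℝ≥0}
    {f : ∀ i, Fin (n i) → ℝ → ℝ} (hf : ∀ i l, StronglyConvexSmooth (μ i l) (K i l) (f i l))
    (w : ∀ i, Matrix (Fin p) (Fin (n i)) ℝ) (a : Matrix (Fin N) (Fin N) ℝ) (bbar : ∀ k, V k → ℝ)
    (β : Fin p → ℝ) (ρ : Fin N → ℝ) : IsLip (algField f w a bbar β ρ) := by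
  have hy : ∀ k (l : V k), IsLip fun z : AlgState n V => z.1 k l := fun k l =>
    (IsLip.id.fst.apply k).euclidean_apply l
  have hv : ∀ k (l : V k), IsLip fun z : AlgState n V => z.2.1 k l := fun k l =>
    (IsLip.id.snd.fst.apply k).euclidean_apply l
  have hx : ∀ i (m : Fin (n i)), IsLip fun z : AlgState n V => z.2.2 i m := fun i m =>
    (IsLip.id.snd.snd.apply i).euclidean_apply m
  have hrow : ∀ i k, IsLip fun z : AlgState n V => rowDot (w i) k (z.2.2 i) := fun i k =>
    IsLip.sum fun m _ => (hx i m).const_mul _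
  have hdis : ∀ k (l : V k), IsLip fun z : AlgState n V => β k * disagreement a z.2.1 k l :=
    fun k l => (IsLip.sum fun j _ => ((hv k l).sub (hv k j)).const_mul _).const_mul _
  have hF₁ : IsLip fun z => (algField f w a bbar β ρ z).1 :=
    IsLip.pi fun k => IsLip.euclidean fun l => hdis k l
  have hF₂ : IsLip fun z => (algField f w a bbar β ρ z).2.1 :=
    IsLip.pi fun k => IsLip.euclidean fun l =>
      (((hrow l k).sub (IsLip.const _)).sub (hdis k l)).sub (hy k l)
  have hF₃ : IsLip fun z => (algField f w a bbar β ρ z).2.2 := by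
    refine IsLip.pi fun i => IsLip.euclidean fun m => ?_
    simp only [algField_primal (fun i l => (hf i l).differentiable)]
    refine IsLip.sub (IsLip.add (IsLip.sub (IsLip.neg (IsLip.const_mul ?_ _))
      (IsLip.const_mul (IsLip.sum fun k _ => ?_) _)) (IsLip.const_mul (IsLip.sum fun k _ => ?_) _))
      (IsLip.const_mul (IsLip.sum fun k _ => ?_) _)
    · exact IsLip.comp ⟨_, (hf i m).lipschitz⟩ (hx i m)
    · exact ((hrow i k).sub (IsLip.const _)).mul_const _
    · exact (hy k ⟨i, k.2⟩).mul_const _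
    · exact (hv k ⟨i, k.2⟩).mul_const _
  exact hF₁.prodMk (hF₂.prodMk hF₃)

/-- With `s = ρ / (1 + ρ)` and `1 - s = (1 + ρ)⁻¹`, the error of the algorithm obeys the abstract
dynamics with Bregman-shifted costs. The target values of `y` make the constants cancel in the dual
equation; stationarity does so in the primal one. -/
theorem exists_sqNorm_decay {w : ∀ i, Matrix (Fin p) (Fin (n i)) ℝ}
    (hW : ∀ ν, (stackedWeights w)ᵀ *ᵥ ν = 0 → ν = 0)
    {a : Matrix (Fin N) (Fin N) ℝ} (ha : ∀ i j, 0 ≤ a i j) (hasymm : a.IsSymm)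
    (hV : ∀ k i, w i k ≠ 0 → i ∈ V k)
    (hconn : ∀ k, ((weightGraph a).induce (V k : Set (Fin N))).Connected)
    {β : Fin p → ℝ} (hβ : ∀ k, 0 < β k) {ρ : Fin N → ℝ} (hρ : ∀ i, 0 ≤ ρ i)
    {μ : ∀ i, Fin (n i) → ℝ} (hμ : ∀ i l, 0 < μ i l) (K : ∀ i, Fin (n i) → ℝ≥0) :
    ∃ C > (0 : ℝ), ∃ c > (0 : ℝ),
      ∀ (f : ∀ i, Fin (n i) → ℝ → ℝ) (b : Fin p → ℝ) (bbar : ∀ k, V k → ℝ),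
        (∀ i l, StronglyConvexSmooth (μ i l) (K i l) (f i l)) →
        (∀ k, ∑ l : V k, bbar k l = b k) →
        ∀ (xs : PrimalVar n) (ν : Fin p → ℝ), IsKKT f w b xs ν →
        ∀ z : ℝ → AlgState n V, SolvesODE (algField f w a bbar β ρ) z → ZeroSumY (z 0) →
        ∀ t : ℝ, 0 ≤ t →
          sqNorm (z t - targetState w bbar xs ν) ≤
            C * Real.exp (-c * t) * sqNorm (z 0 - targetState w bbar xs ν) := by
  have hρ1 : ∀ i, 0 < 1 + ρ i := fun i => by have := hρ i; positivity
  have hs1 : ∀ i, 1 - ρ i / (1 + ρ i) = (1 + ρ i)⁻¹ := fun i => by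
    have := (hρ1 i).ne'
    field_simp
    ring
  obtain ⟨C, hC, c, hc, hdecay⟩ := exists_exponential_decay_of_posSemidef
    (posSemidef_weightedLaplacian (isSymm_couplingWeights (V := V) hasymm β)
      (couplingWeights_nonneg ha hβ))
    (intertwines_localWeights w fun i => ρ i / (1 + ρ i))
    (fun q => div_nonneg (hρ _) (hρ1 _).le) (fun j => div_nonneg (hρ _) (hρ1 _).le)
    (fun j => by rw [← sub_pos, hs1]; exact inv_pos.2 (hρ1 _)) (fun j => hμ j.1 j.2)
    (fun ζ h1 h2 => eq_zero_of_laplacian_eq_zero hW hV ha hasymm hconn hβ h1 h2)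
    fun j => K j.1 j.2
  refine ⟨C, hC, c, hc, fun f b bbar hf hb xs ν hkkt z hz h0 t ht => ?_⟩
  have hfd : ∀ i l, Differentiable ℝ (f i l) := fun i l => (hf i l).differentiable
  have hkkt' := (isKKT_iff hfd).1 hkkt
  set zs := targetState w bbar xs ν with hzs
  have hd : ∀ t, 0 ≤ t →
      HasDerivWithinAt (fun t => z t - zs) (algField f w a bbar β ρ (z t)) (Set.Ici 0) t :=
    fun t ht => (hz t ht).sub_const zs
  have hcons : weightedLaplacian (couplingWeights a V β) *ᵥ dualCoord (consensusDual V ν) = 0 := by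
    funext q
    rw [weightedLaplacian_couplingWeights_mulVec]
    simp [disagreement, consensusDual]
  have hlap : ∀ v : DualVar V, weightedLaplacian (couplingWeights a V β)
      *ᵥ dualCoord (v - consensusDual V ν) = fun q => β q.1 * disagreement a v q.1 q.2 := fun v => by
    have : dualCoord (v - consensusDual V ν) = dualCoord v - dualCoord (consensusDual V ν) := rfl
    rw [this, mulVec_sub, hcons, sub_zero]
    exact funext fun q => weightedLaplacian_couplingWeights_mulVec a β v q
  have hrow : ∀ (x : PrimalVar n) (q : Σ k, V k), (localWeights w V *ᵥ primalCoord (x - xs)) q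
      = rowDot (w q.2) q.1 (x q.2) - rowDot (w q.2) q.1 (xs q.2) := fun x q => by
    have : primalCoord (x - xs) = primalCoord x - primalCoord xs := rfl
    rw [this, mulVec_sub, Pi.sub_apply, localWeights_mulVec, localWeights_mulVec]
  refine hdecay (fun j => bregman (f j.1 j.2) (primalCoord xs j)) (fun j => (hf _ _).bregman _)
    (fun j => bregman_zero _ _) (fun j => by rw [(hf _ _).deriv_bregman, add_zero, sub_self])
    (fun t => dualCoord (z t - zs).1) (fun t => dualCoord (z t - zs).2.1)
    (fun t => primalCoord (z t - zs).2.2) (fun t ht => ?_) (fun t ht => ?_) (fun t ht => ?_)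
    (fun d hd => ?_) t ht
  · refine (HasDerivWithinAt.dualCoord (hd t ht).fst).congr_deriv ?_
    exact (hlap (z t).2.1).symm
  · refine (HasDerivWithinAt.dualCoord (hd t ht).snd.fst).congr_deriv ?_
    funext q
    have h1 := congrFun (hlap (z t).2.1) q
    have h2 := hrow (z t).2.2 q
    change _ = (localWeights w V *ᵥ primalCoord ((z t).2.2 - xs)) q
      - (weightedLaplacian (couplingWeights a V β) *ᵥ dualCoord ((z t).2.1 - consensusDual V ν)) q
      - ((z t).1 q.1 q.2 - (rowDot (w q.2) q.1 (xs q.2) - bbar q.1 q.2))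
    rw [h1, h2]
    change (rowDot (w q.2) q.1 ((z t).2.2 q.2) - bbar q.1 q.2)
      - β q.1 * disagreement a (z t).2.1 q.1 q.2 - (z t).1 q.1 q.2 = _
    ring
  · refine (HasDerivWithinAt.primalCoord (hd t ht).snd.snd).congr_deriv ?_
    funext j
    obtain ⟨i, m⟩ := j
    have hst := hkkt'.1 ⟨i, m⟩
    rw [← sum_subtype_mul_weights hV] at hst
    change (algField f w a bbar β ρ (z t)).2.2 i m = _
    rw [algField_primal hfd, hs1, (hf i m).deriv_bregman, localWeights_transpose_mulVec,
      localWeights_transpose_mulVec, div_inv_eq_mul]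
    have e1 : primalCoord xs ⟨i, m⟩ + primalCoord (z t - zs).2.2 ⟨i, m⟩ = (z t).2.2 i m :=
      add_sub_cancel (xs i m) ((z t).2.2 i m)
    have e2 : ∀ k : {k : Fin p // i ∈ V k},
        (localWeights w V *ᵥ primalCoord (z t - zs).2.2 - dualCoord (z t - zs).1) ⟨k, ⟨i, k.2⟩⟩
          = (rowDot (w i) k ((z t).2.2 i) - bbar k ⟨i, k.2⟩) - (z t).1 k ⟨i, k.2⟩ := fun k => by
      have h2 := hrow (z t).2.2 ⟨k, ⟨i, k.2⟩⟩
      change (localWeights w V *ᵥ primalCoord ((z t).2.2 - xs)) ⟨k, ⟨i, k.2⟩⟩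
        - ((z t).1 k ⟨i, k.2⟩ - (rowDot (w i) k (xs i) - bbar k ⟨i, k.2⟩)) = _
      rw [h2]
      ring
    have e3 : ∀ k : {k : Fin p // i ∈ V k}, dualCoord (z t - zs).2.1 ⟨k, ⟨i, k.2⟩⟩
        = (z t).2.1 k ⟨i, k.2⟩ - ν k := fun k => rfl
    have e4 : ∀ γ Z T, -(γ + (Z + ρ i / (1 + ρ i) * T)) * (1 + ρ i)
        = -((1 + ρ i) * (γ + Z)) - ρ i * T := fun γ Z T => by
      have := (hρ1 i).ne'
      field_simp
      ring
    simp only [e4, e1, e2, e3, sub_mul _ _ (w i _ m), Finset.sum_sub_distrib] at hst ⊢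
    linear_combination -(1 + ρ i) * hst
  -- Kernel vectors are constant on each subgraph, so only the sums of the error of `y` matter. They
  -- vanish: those of `y` by initialization, those of the target by feasibility and the splitting of
  -- `b`.
  · have hconst : ∀ q r : Σ k, V k, q.1 = r.1 → d q = d r := by
      rintro ⟨k, l⟩ ⟨_, l'⟩ rfl
      exact eq_of_laplacian_eq_zero ha hasymm hconn hβ hd k l l'
    rw [dotProduct, Fintype.sum_sigma]
    refine Finset.sum_eq_zero fun k _ => ?_
    obtain ⟨l₀⟩ := (hconn k).nonempty
    have h1 : ∀ l : V k, d ⟨k, l⟩ * dualCoord (z 0 - zs).1 ⟨k, l⟩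
        = d ⟨k, l₀⟩ * ((z 0).1 k l - (rowDot (w l) k (xs l) - bbar k l)) := fun l => by
      rw [hconst ⟨k, l⟩ ⟨k, l₀⟩ rfl]
      rfl
    simp only [h1, ← Finset.mul_sum, Finset.sum_sub_distrib]
    rw [h0 k, sum_rowDot_eq hV, hb k, hkkt.feasible k]
    ring

theorem exists_norm_decay {w : ∀ i, Matrix (Fin p) (Fin (n i)) ℝ}
    (hW : ∀ ν, (stackedWeights w)ᵀ *ᵥ ν = 0 → ν = 0)
    {a : Matrix (Fin N) (Fin N) ℝ} (ha : ∀ i j, 0 ≤ a i j) (hasymm : a.IsSymm)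
    (hV : ∀ k i, w i k ≠ 0 → i ∈ V k)
    (hconn : ∀ k, ((weightGraph a).induce (V k : Set (Fin N))).Connected)
    {β : Fin p → ℝ} (hβ : ∀ k, 0 < β k) {ρ : Fin N → ℝ} (hρ : ∀ i, 0 ≤ ρ i)
    {μ : ∀ i, Fin (n i) → ℝ} (hμ : ∀ i l, 0 < μ i l) (K : ∀ i, Fin (n i) → ℝ≥0) :
    ∃ C > (0 : ℝ), ∃ c > (0 : ℝ),
      ∀ (f : ∀ i, Fin (n i) → ℝ → ℝ) (b : Fin p → ℝ) (bbar : ∀ k, V k → ℝ),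
        (∀ i l, StronglyConvexSmooth (μ i l) (K i l) (f i l)) →
        (∀ k, ∑ l : V k, bbar k l = b k) →
        ∀ (xs : PrimalVar n) (ν : Fin p → ℝ), IsKKT f w b xs ν →
        ∀ z : ℝ → AlgState n V, SolvesODE (algField f w a bbar β ρ) z → ZeroSumY (z 0) →
        ∀ t : ℝ, 0 ≤ t →
          ‖z t - targetState w bbar xs ν‖ ≤
            C * Real.exp (-c * t) * ‖z 0 - targetState w bbar xs ν‖ := by
  obtain ⟨C, hC, c, hc, hdecay⟩ := exists_sqNorm_decay hW ha hasymm hV hconn hβ hρ hμ K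
  -- The factor `2 * p + N` bounds `sqNorm` by the squared sup norm over blocks, and the `1` keeps
  -- the constant positive when there are no blocks. Taking square roots halves the rate.
  refine ⟨√(C * (2 * p + N + 1)), by positivity, c / 2, by positivity,
    fun f b bbar hf hb xs ν hkkt z hz h0 t ht => ?_⟩
  refine abs_le_of_sq_le_sq' ?_ (by positivity) |>.2
  have h1 := hdecay f b bbar hf hb xs ν hkkt z hz h0 t ht
  have h2 := norm_sq_le_sqNorm (z t - targetState w bbar xs ν)
  have h3 := sqNorm_le (z 0 - targetState w bbar xs ν)
  set r := ‖z 0 - targetState w bbar xs ν‖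
  have h4 : Real.exp (-(c / 2) * t) ^ 2 = Real.exp (-c * t) := by
    rw [← Real.exp_nat_mul]; congr 1; push_cast; ring
  rw [mul_pow, mul_pow, Real.sq_sqrt (by positivity), h4]
  calc _ ≤ _ := h2.trans h1
    _ ≤ C * Real.exp (-c * t) * ((2 * p + N) * r ^ 2) := by gcongr
    _ ≤ C * Real.exp (-c * t) * ((2 * p + N + 1) * r ^ 2) := by
        gcongr ?_ * (?_ * _)
        exact le_add_of_nonneg_right zero_le_one
    _ = _ := by ring

end Convergence

theorem theorem2 {N p : ℕ} (n : Fin N → ℕ)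
    -- weight matrices, with `W` of full row rank
    (w : ∀ i, Matrix (Fin p) (Fin (n i)) ℝ)
    (hW : LinearIndependent ℝ (fun k => stackedWeights w k))
    -- undirected weighted graph, and connected subgraphs containing the coupled agents
    (a : Matrix (Fin N) (Fin N) ℝ) (ha : ∀ i j, 0 ≤ a i j) (hasymm : a.IsSymm)
    (V : Fin p → Finset (Fin N)) (hV : ∀ k i, w i k ≠ 0 → i ∈ V k)
    (hconn : ∀ k, ((weightGraph a).induce (V k : Set (Fin N))).Connected)
    -- gains
    (β : Fin p → ℝ) (hβ : ∀ k, 0 < β k)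
    (ρ : Fin N → ℝ) (hρ : ∀ i, 0 ≤ ρ i)
    -- moduli of strong convexity and Lipschitz constants of the gradients
    (μ : ∀ i, Fin (n i) → ℝ) (hμ : ∀ i l, 0 < μ i l) (K : ∀ i, Fin (n i) → ℝ≥0) :
    -- the KKT point exists and is unique, solutions exist, and they converge to it
    (∀ (f : ∀ i, Fin (n i) → ℝ → ℝ) (b : Fin p → ℝ) (bbar : ∀ k, V k → ℝ),
      (∀ i l, StronglyConvexSmooth (μ i l) (K i l) (f i l)) →
      (∀ k, ∑ l : V k, bbar k l = b k) →
      ∃ (xs : PrimalVar n) (ν : Fin p → ℝ),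
        IsKKT f w b xs ν ∧
        (∀ (xs' : PrimalVar n) (ν' : Fin p → ℝ), IsKKT f w b xs' ν' → xs' = xs ∧ ν' = ν) ∧
        (∀ z₀ : AlgState n V, ZeroSumY z₀ →
          ∃ z : ℝ → AlgState n V, z 0 = z₀ ∧ SolvesODE (algField f w a bbar β ρ) z) ∧
        (∀ z : ℝ → AlgState n V, SolvesODE (algField f w a bbar β ρ) z → ZeroSumY (z 0) →
          Filter.Tendsto (fun t => (z t).2) Filter.atTop (𝓝 (consensusDual V ν, xs)))) ∧
    -- exponential convergence when all the penalty parameters are positive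
    ((∀ i, 0 < ρ i) →
      ∃ C > (0 : ℝ), ∃ c > (0 : ℝ),
        ∀ (f : ∀ i, Fin (n i) → ℝ → ℝ) (b : Fin p → ℝ) (bbar : ∀ k, V k → ℝ),
          (∀ i l, StronglyConvexSmooth (μ i l) (K i l) (f i l)) →
          (∀ k, ∑ l : V k, bbar k l = b k) →
          ∀ (xs : PrimalVar n) (ν : Fin p → ℝ), IsKKT f w b xs ν →
          ∀ z : ℝ → AlgState n V, SolvesODE (algField f w a bbar β ρ) z → ZeroSumY (z 0) →
          ∀ t : ℝ, 0 ≤ t →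
            ‖z t - targetState w bbar xs ν‖ ≤
              C * Real.exp (-c * t) * ‖z 0 - targetState w bbar xs ν‖) := by
  have hW' : ∀ d : Fin p → ℝ, Matrix.mulVec (stackedWeights w).transpose d = 0 → d = 0 :=
    fun d hd => by
      refine funext (Fintype.linearIndependent_iff.1 hW d ?_)
      rw [← hd]
      funext j
      simp [Matrix.mulVec, dotProduct, mul_comm]
  -- This estimate serves both conclusions: it is the exponential bound itself, and it makes the
  -- whole state, hence `(v, x)`, tend to the target.
  obtain ⟨C, hC, c, hc, hdecay⟩ := exists_norm_decay hW' ha hasymm hV hconn hβ hρ hμ K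
  refine ⟨fun f b bbar hf hb => ?_, fun _ => ⟨C, hC, c, hc, hdecay⟩⟩
  obtain ⟨xs, ν, hkkt⟩ := exists_isKKT hW' hμ hf b
  obtain ⟨M, hlip⟩ := isLip_algField hf w a bbar β ρ
  refine ⟨xs, ν, hkkt, fun xs' ν' h' => h'.unique hW' hμ hf hkkt,
    fun z₀ _ => hlip.exists_solvesODE z₀, fun z hz h0 => ?_⟩
  have hexp : Filter.Tendsto (fun t => Real.exp (-c * t)) Filter.atTop (𝓝 0) :=
    Real.tendsto_exp_atBot.comp (Filter.tendsto_id.const_mul_atTop_of_neg (neg_lt_zero.2 hc))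
  have hbound := (hexp.const_mul C).mul_const ‖z 0 - targetState w bbar xs ν‖
  rw [mul_zero, zero_mul] at hbound
  have hz' : Filter.Tendsto z Filter.atTop (𝓝 (targetState w bbar xs ν)) := by
    rw [tendsto_iff_norm_sub_tendsto_zero]
    refine squeeze_zero' (Filter.Eventually.of_forall fun _ => norm_nonneg _) ?_ hbound
    filter_upwards [Filter.eventually_ge_atTop 0] with t ht
    exact hdecay f b bbar hf hb xs ν hkkt z hz h0 t ht
  exact (continuous_snd.tendsto _).comp hz'
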